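/- Let $(M,\omega,\mathbb T)$ be a compact symplectic toric manifold of dimension $2m$: $(M,\omega)$ is a compact connected symplectic $2m$-manifold with a smooth effective hamiltonian action of the torus $\mathbb T=(S^1)^m$, with moment map $\mu:M\to\mathfrak t^*$, so that $\mu$ is $\mathbb T$-invariant and $\omega(\xi^\sharp,\cdot)=-d\mu^\xi$ for all $\xi\in\mathfrak t$. Fix a basis $(\xi_1,\dots,\xi_m)$ of $\mathfrak t$ and put $\mu^i=\mu^{\xi_i}$, $K_i=\xi_i^\sharp$. Let $\Delta=\mu(M)$, let $\mathring M\subset M$ be the open dense set on which $\mathbb T$ acts freely, which is also $\mu^{-1}(\mathring\Delta)$, and let $v_\omega=\omega^m/m!$. Write $\mathrm{grad}_\omega f=-\omega^{-1}df$, i.e. $\omega(\mathrm{grad}_\omega f,\cdot)=-df$, and let $A^{*_\omega}$ be the $\omega$-adjoint, $\omega(AX,Y)=\omega(X,A^{*_\omega}Y)$. Let $GAK^{\mathbb T}_\omega(M)$ be the space of smooth $\mathbb T$-invariant complex endomorphisms $K$ of $T^{\mathbb C}M$ with $K^2=-\mathrm{Id}$, $K^{*_\omega}=-\overline K$ and $\omega(U,\overline{KU})>0$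 for $U\neq0$. Its tangent space at $K$ is the space of smooth $\mathbb T$-invariant $\dot K$ with $\dot K^{*_\omega}=-\overline{\dot K}$ and $\dot KK+K\dot K=0$, and it carries the formal symplectic form $\Omega_K(\dot K_1,\dot K_2)=\frac12\int_M\mathrm{tr}(K\dot K_1\dot K_2)\,v_\omega$. Let $C^\infty_{c,0}(M)^{\mathbb T}$ be the space of smooth $\mathbb T$-invariant functions $f$ with $\int_Mf\,v_\omega=0$ and support in $\mathring M$, and let $\mathrm{Ham}^{\mathbb T}_c(M,\omega)$ be the group generated by the time-one flows of the fields $\mathrm{grad}_\omega f$, $f\in C^\infty_{c,0}(M)^{\mathbb T}$. It acts by $\varphi\cdot K=\varphi_*K\varphi_*^{-1}$; for $V=\mathrm{grad}_\omega f$ with flow $\varphi_t$ let $V^\sharp_K=\frac{d}{dt}\big|_{0}\varphi_t\cdot K$. **Theorem.** The action of $\mathrm{Ham}^{\mathbb T}_c(M,\omega)$ on $GAK^{\mathbb T}_\omega(M)$ is hamiltonian, with moment map $\nu:GAK^{\mathbb T}_\omega(M)\to(C^\infty_{c,0}(M)^{\mathbb T})^*$ given by $$\nu^f(K)=-\int_{\mathring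 M}f\Big(\sum_{i,j=1}^m\frac{\partial^2\,\mathrm{Re}\,Q_{ij}}{\partial\mu^i\partial\mu^j}\Big)v_\omega,\qquad Q_{ij}=\omega(KK_i,K_j),$$ where $\partial/\partial\mu^i$ is applied to $\mathbb T$-invariant functions on $\mathring M$ in momentum-angle coordinates. That is, the action is well defined and preserves $\Omega$; $\nu$ is linear in $f$ and equivariant, $\nu^{f\circ\varphi^{-1}}(\varphi\cdot K)=\nu^f(K)$; and $d\nu^f_K(\dot K)=-\Omega_K(V^\sharp_K,\dot K)$ for $V=\mathrm{grad}_\omega f$ and every tangent vector $\dot K$ at $K$. Moreover, let $J\in DGK^{\mathbb T}_\omega(M)$, i.e. $J$ is a $\mathbb T$-invariant almost complex structure with $\omega(X,JX)>0$ for $X\ne0$, such that $J$ and $J^{*_\omega}$ are integrable and $J^{*_\omega}\mathcal K=J\mathcal K$ on $\mathring M$, where $\mathcal K=\mathrm{span}(K_1,\dots,K_m)$; it corresponds to the element $K=-2(J-J^{*_\omega})^{-1}-i(J+J^{*_\omega})(J-J^{*_\omega})^{-1}$ of $GAK^{\mathbb T}_\omega(M)$. On $\mathring M$ let $\partial/\partial\mu^1,\dots,\partial/\partial\mu^m$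 be the basis of $J\mathcal K$ with $d\mu^i(\partial/\partial\mu^j)=\delta_{ij}$, let $\Psi$ be the matrix with $J\,\partial/\partial\mu^j=\sum_i\Psi_{ij}K_i$, let $S$ be its symmetric part and $(S^{ij})=S^{-1}$. Then $$\nu^f(J)=\int_{\mathring M}f\Big(\sum_{i,j=1}^m\frac{\partial^2S^{ij}}{\partial\mu^i\partial\mu^j}\Big)v_\omega .$$ In particular, if $\tau\in C^\infty(\mathring\Delta)$ is a symplectic potential of $J$, i.e. $\Psi=\mathrm{Hess}(\tau)\circ\mu+C$ with a constant antisymmetric matrix $C$, this holds with $S_{ij}=\partial^2\tau/\partial\mu^i\partial\mu^j$. -/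

import Mathlib

open scoped Manifold ContDiff TensorProduct
open Bundle MeasureTheory

noncomputable section

namespace ToricGK

/-- The model space `ℝ^{2m}`. -/
abbrev Model (m : ℕ) : Type := EuclideanSpace ℝ (Fin (2 * m))

/-- The compact torus of dimension `m`; its Lie algebra `𝔱` is `Fin m → ℝ`. -/
abbrev Torus (m : ℕ) : Type := Fin m → Circle

/-- The exponential map `𝔱 → 𝕋`. -/
def torusExp {m : ℕ} (θ : Fin m → ℝ) : Torus m := fun i => Circle.exp (θ i)

section Fields

variable {m : ℕ} {M : Type*} [TopologicalSpace M] [ChartedSpace (Model m) M]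

/-- The differential of a real function on `M`. -/
def dif (m : ℕ) {M : Type*} [TopologicalSpace M] [ChartedSpace (Model m) M]
    (f : M → ℝ) (x : M) : TangentSpace (𝓡 (2 * m)) x →L[ℝ] ℝ :=
  mfderiv (𝓡 (2 * m)) 𝓘(ℝ, ℝ) f x

/-- The differential `φ_*` of a self-map of `M`. -/
def tangentMapAt (m : ℕ) {M : Type*} [TopologicalSpace M] [ChartedSpace (Model m) M]
    (φ : M → M) (x : M) :
    TangentSpace (𝓡 (2 * m)) x →L[ℝ] TangentSpace (𝓡 (2 * m)) (φ x) :=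
  mfderiv (𝓡 (2 * m)) (𝓡 (2 * m)) φ x

/-- `K_ξ = ξ^♯`, the infinitesimal action `d/ds|₀ exp(sξ) • x` of `ξ ∈ 𝔱`. -/
def fundField [MulAction (Torus m) M] (ξ : Fin m → ℝ) (x : M) :
    TangentSpace (𝓡 (2 * m)) x :=
  mfderiv 𝓘(ℝ, ℝ) (𝓡 (2 * m)) (fun s : ℝ => torusExp (s • ξ) • x) 0 (1 : ℝ)

variable [IsManifold (𝓡 (2 * m)) ∞ M]

/-- Smooth vector fields. -/
def SmoothVF (X : (x : M) → TangentSpace (𝓡 (2 * m)) x) : Prop :=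
  ContMDiff (𝓡 (2 * m)) (𝓡 (2 * m)).tangent ∞
    (fun x => (⟨x, X x⟩ : TangentBundle (𝓡 (2 * m)) M))

/-- Smooth sections of `End(TM)`. -/
def SmoothEnd
    (A : (x : M) → TangentSpace (𝓡 (2 * m)) x →L[ℝ] TangentSpace (𝓡 (2 * m)) x) : Prop :=
  ContMDiff (𝓡 (2 * m)) ((𝓡 (2 * m)).prod 𝓘(ℝ, Model m →L[ℝ] Model m)) ∞
    (fun x => TotalSpace.mk' (Model m →L[ℝ] Model m)
      (E := fun y : M => TangentSpace (𝓡 (2 * m)) y →L[ℝ] TangentSpace (𝓡 (2 * m)) y) x (A x))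

/-- Curves of sections of `End(TM)`, smooth jointly in the parameter and the point. -/
def SmoothEndCurve
    (A : ℝ → (x : M) → TangentSpace (𝓡 (2 * m)) x →L[ℝ] TangentSpace (𝓡 (2 * m)) x) : Prop :=
  ContMDiff (𝓘(ℝ, ℝ).prod (𝓡 (2 * m))) ((𝓡 (2 * m)).prod 𝓘(ℝ, Model m →L[ℝ] Model m)) ∞
    (fun p : ℝ × M => TotalSpace.mk' (Model m →L[ℝ] Model m)
      (E := fun y : M => TangentSpace (𝓡 (2 * m)) y →L[ℝ] TangentSpace (𝓡 (2 * m)) y)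
      p.2 (A p.1 p.2))

/-- Integrability of an almost complex structure: its Nijenhuis tensor vanishes. -/
def NijenhuisFree
    (J : (x : M) → TangentSpace (𝓡 (2 * m)) x →L[ℝ] TangentSpace (𝓡 (2 * m)) x) : Prop :=
  ∀ X Y : (x : M) → TangentSpace (𝓡 (2 * m)) x, SmoothVF X → SmoothVF Y → ∀ x,
    VectorField.mlieBracket (𝓡 (2 * m)) (fun y => J y (X y)) (fun y => J y (Y y)) x
      - J x (VectorField.mlieBracket (𝓡 (2 * m)) (fun y => J y (X y)) Y x)
      - J x (VectorField.mlieBracket (𝓡 (2 * m)) X (fun y => J y (Y y)) x)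
      - VectorField.mlieBracket (𝓡 (2 * m)) X Y x = 0

end Fields

/-- A symplectic form: a smooth, alternating, nondegenerate, closed 2-form. -/
structure SymplecticForm (m : ℕ) (M : Type*) [TopologicalSpace M] [ChartedSpace (Model m) M]
    [IsManifold (𝓡 (2 * m)) ∞ M] where
  form : (x : M) →
    TangentSpace (𝓡 (2 * m)) x →L[ℝ] TangentSpace (𝓡 (2 * m)) x →L[ℝ] ℝ
  smooth : ContMDiff (𝓡 (2 * m)) ((𝓡 (2 * m)).prod 𝓘(ℝ, Model m →L[ℝ] Model m →L[ℝ] ℝ)) ∞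
    (fun x => TotalSpace.mk' (Model m →L[ℝ] Model m →L[ℝ] ℝ)
      (E := fun y : M =>
        TangentSpace (𝓡 (2 * m)) y →L[ℝ] TangentSpace (𝓡 (2 * m)) y →L[ℝ] ℝ) x (form x))
  alternating : ∀ x v, form x v v = 0
  nondegenerate : ∀ x v, (∀ w, form x v w = 0) → v = 0
  closed : ∀ X Y Z : (x : M) → TangentSpace (𝓡 (2 * m)) x,
    SmoothVF X → SmoothVF Y → SmoothVF Z → ∀ x,
      dif m (fun y => form y (Y y) (Z y)) x (X x)
        - dif m (fun y => form y (X y) (Z y)) x (Y x)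
        + dif m (fun y => form y (X y) (Y y)) x (Z x)
        - form x (VectorField.mlieBracket (𝓡 (2 * m)) X Y x) (Z x)
        + form x (VectorField.mlieBracket (𝓡 (2 * m)) X Z x) (Y x)
        - form x (VectorField.mlieBracket (𝓡 (2 * m)) Y Z x) (X x) = 0

/-- A symplectic form on the `2m`-manifold `M` for which the given action of the `m`-torus is smooth,
effective and hamiltonian, with its moment map `mom : M → 𝔱*`. Smoothness of `𝕋 × M → M` is
expressed through the covering `𝔱 → 𝕋`. -/
structure ToricStructure (m : ℕ) (M : Type*) [TopologicalSpace M] [ChartedSpace (Model m) M]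
    [IsManifold (𝓡 (2 * m)) ∞ M] [MulAction (Torus m) M] extends SymplecticForm m M where
  smooth_action : ContMDiff (𝓘(ℝ, Fin m → ℝ).prod (𝓡 (2 * m))) (𝓡 (2 * m)) ∞
    (fun p : (Fin m → ℝ) × M => torusExp p.1 • p.2)
  effective : ∀ t : Torus m, (∀ x : M, t • x = x) → t = 1
  form_invariant : ∀ (t : Torus m) (x : M) (v w : TangentSpace (𝓡 (2 * m)) x),
    form (t • x) (tangentMapAt m (fun y : M => t • y) x v)
      (tangentMapAt m (fun y : M => t • y) x w) = form x v w
  mom : M → (Fin m → ℝ) →L[ℝ] ℝ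
  mom_smooth : ∀ ξ, ContMDiff (𝓡 (2 * m)) 𝓘(ℝ, ℝ) ∞ (fun x => mom x ξ)
  mom_invariant : ∀ (t : Torus m) (x : M), mom (t • x) = mom x
  mom_hamiltonian : ∀ ξ x v, form x (fundField ξ x) v = -dif m (fun y => mom y ξ) x v

namespace SymplecticForm

variable {m : ℕ} {M : Type*} [TopologicalSpace M] [ChartedSpace (Model m) M]
  [IsManifold (𝓡 (2 * m)) ∞ M] (σ : SymplecticForm m M)

/-- `grad_ω f = -ω⁻¹ df`, where `ω` is regarded as the isomorphism `v ↦ ω(v, ·)`. -/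
def symplGrad (f : M → ℝ) (x : M) : TangentSpace (𝓡 (2 * m)) x :=
  -(σ.form x).inverse (dif m f x)

/-- The symplectic adjoint: `ω(A v, w) = ω(v, A^{*_ω} w)`. -/
def symplAdjoint
    (A : (x : M) → TangentSpace (𝓡 (2 * m)) x →L[ℝ] TangentSpace (𝓡 (2 * m)) x) (x : M) :
    TangentSpace (𝓡 (2 * m)) x →L[ℝ] TangentSpace (𝓡 (2 * m)) x :=
  (σ.form x).inverse ∘L
    (ContinuousLinearMap.precomp ℝ (A x)) ∘L (σ.form x)

/-- The complex bilinear extension of `ω` to `T^ℂM`. -/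
def formC (x : M) : LinearMap.BilinForm ℂ (ℂ ⊗[ℝ] TangentSpace (𝓡 (2 * m)) x) :=
  LinearMap.BilinForm.baseChange ℂ
    ((ContinuousLinearMap.coeLM ℝ).comp (σ.form x).toLinearMap :
      LinearMap.BilinForm ℝ (TangentSpace (𝓡 (2 * m)) x))

/-- The coefficient of `v_ω = ω^m / m!` in the chart at `x₀`, that is
`v_ω(∂₁, …, ∂_{2m}) = (2^m m!)⁻¹ ∑_s sgn(s) ∏_i ω(∂_{s(2i)}, ∂_{s(2i+1)})`. -/
def volCoeff (x₀ : M) (y : Model m) : ℝ :=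
  let ψ := (chartAt (Model m) x₀).symm
  let e : Fin (2 * m) → TangentSpace (𝓡 (2 * m)) (ψ y) := fun a =>
    mfderiv 𝓘(ℝ, Model m) (𝓡 (2 * m)) ψ y (EuclideanSpace.single a (1 : ℝ) : Model m)
  (2 ^ m * (m.factorial : ℝ))⁻¹ * ∑ s : Equiv.Perm (Fin (2 * m)),
    ((Equiv.Perm.sign s : ℤ) : ℝ) *
      ∏ i : Fin m, σ.form (ψ y) (e (s ⟨2 * i, by omega⟩)) (e (s ⟨2 * i + 1, by omega⟩))

/-- The measure on `M` carried by the chart domain at `x₀` that `v_ω` induces there. -/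
def chartVol [MeasurableSpace M] (x₀ : M) : Measure M :=
  Measure.map (chartAt (Model m) x₀).symm
    ((volume.restrict (chartAt (Model m) x₀).target).withDensity
      (fun y => ENNReal.ofReal |σ.volCoeff x₀ y|))

/-- The measure `v_ω` on `M` (oriented by `ω`): the least measure dominating the measures that
`v_ω` induces on the chart domains. These agree on overlaps, so its restriction to each chart
domain is the one given there. -/
def vol [MeasurableSpace M] : Measure M := ⨆ x₀ : M, σ.chartVol x₀

end SymplecticForm

/-- Complex conjugation on `ℂ ⊗ V`. -/
def conjC (V : Type*) [AddCommGroup V] [Module ℝ V] : (ℂ ⊗[ℝ] V) →ₗ[ℝ] (ℂ ⊗[ℝ] V) :=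
  LinearMap.rTensor V Complex.conjAe.toLinearMap

/-- A field `K = A + iB` of complex endomorphisms of `T^ℂM`, given by its real and imaginary
parts. -/
@[ext] structure CEndo (m : ℕ) (M : Type*) [TopologicalSpace M] [ChartedSpace (Model m) M] where
  re : (x : M) → TangentSpace (𝓡 (2 * m)) x →L[ℝ] TangentSpace (𝓡 (2 * m)) x
  im : (x : M) → TangentSpace (𝓡 (2 * m)) x →L[ℝ] TangentSpace (𝓡 (2 * m)) x

namespace CEndo

variable {m : ℕ} {M : Type*} [TopologicalSpace M] [ChartedSpace (Model m) M]

/-- The endomorphism `A + iB` of `T_x^ℂM`. -/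
def toEnd (K : CEndo m M) (x : M) : Module.End ℂ (ℂ ⊗[ℝ] TangentSpace (𝓡 (2 * m)) x) :=
  (K.re x).toLinearMap.baseChange ℂ + Complex.I • (K.im x).toLinearMap.baseChange ℂ

/-- `φ · K = φ_* K φ_*⁻¹`. -/
def push (φ : Equiv.Perm M) (K : CEndo m M) : CEndo m M where
  re x := (tangentMapAt m φ (φ.symm x)) ∘L K.re (φ.symm x) ∘L (tangentMapAt m φ.symm x)
  im x := (tangentMapAt m φ (φ.symm x)) ∘L K.im (φ.symm x) ∘L (tangentMapAt m φ.symm x)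

/-- `𝕋`-invariance. -/
def Invariant [MulAction (Torus m) M] (K : CEndo m M) : Prop :=
  ∀ t : Torus m, push (MulAction.toPerm t) K = K

/-- `K̇` is the velocity at time `0` of the curve `γ`. -/
def HasVelocity (γ : ℝ → CEndo m M) (K' : CEndo m M) : Prop :=
  ∀ (x : M) (v : TangentSpace (𝓡 (2 * m)) x),
    HasDerivAt (fun s => (γ s).re x v) (K'.re x v) 0 ∧
    HasDerivAt (fun s => (γ s).im x v) (K'.im x v) 0

variable [IsManifold (𝓡 (2 * m)) ∞ M]

def Smooth (K : CEndo m M) : Prop := SmoothEnd K.re ∧ SmoothEnd K.im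

def SmoothCurve (γ : ℝ → CEndo m M) : Prop :=
  SmoothEndCurve (fun s => (γ s).re) ∧ SmoothEndCurve (fun s => (γ s).im)

end CEndo

namespace ToricStructure

variable {m : ℕ} {M : Type*} [TopologicalSpace M] [ChartedSpace (Model m) M]
  [IsManifold (𝓡 (2 * m)) ∞ M] [MulAction (Torus m) M] (T : ToricStructure m M)

/-- The condition `K^{*_ω} = -K̄`. -/
def ConjSkew (K : CEndo m M) : Prop :=
  ∀ (x : M) (U W : ℂ ⊗[ℝ] TangentSpace (𝓡 (2 * m)) x),
    T.formC x (K.toEnd x U) W = -T.formC x U (conjC _ (K.toEnd x (conjC _ W)))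

/-- The space `GAK^𝕋_ω(M)` of `𝕋`-invariant generalized almost Kähler structures of symplectic
type, as complex endomorphisms `K` of `T^ℂM` with `K² = -1`, `K^{*_ω} = -K̄` and
`H_K(U, U) = ω(U, conj (K U)) > 0`. -/
structure GAK (K : CEndo m M) : Prop where
  smooth : K.Smooth
  invariant : K.Invariant
  sq : ∀ x, K.toEnd x * K.toEnd x = -1
  conjSkew : T.ConjSkew K
  pos : ∀ (x : M) (U : ℂ ⊗[ℝ] TangentSpace (𝓡 (2 * m)) x), U ≠ 0 →
    0 < (T.formC x U (conjC _ (K.toEnd x U))).re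

/-- The tangent space of `GAK^𝕋_ω(M)` at `K`. -/
structure GAKTangent (K K' : CEndo m M) : Prop where
  smooth : K'.Smooth
  invariant : K'.Invariant
  conjSkew : T.ConjSkew K'
  anticomm : ∀ x, K'.toEnd x * K.toEnd x + K.toEnd x * K'.toEnd x = 0

/-- The symplectic form `Ω_K(K₁, K₂) = ½ ∫_M tr(K K₁ K₂) v_ω`. -/
def Omega [MeasurableSpace M] (K K₁ K₂ : CEndo m M) : ℂ :=
  (1 / 2) * ∫ x, LinearMap.trace ℂ (ℂ ⊗[ℝ] TangentSpace (𝓡 (2 * m)) x)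
    (K.toEnd x * K₁.toEnd x * K₂.toEnd x) ∂T.vol

/-- The open set `M°` on which the torus acts freely, i.e. the preimage under the moment map of the
interior of the moment polytope. -/
def freeLocus (m : ℕ) (M : Type*) [MulAction (Torus m) M] : Set M :=
  {x | ∀ t : Torus m, t • x = x → t = 1}

/-- `C^∞_{c,0}(M)^𝕋`: smooth `𝕋`-invariant functions of zero mean with support in `M°`. -/
structure CompactZeroMean [MeasurableSpace M] (f : M → ℝ) : Prop where
  smooth : ContMDiff (𝓡 (2 * m)) 𝓘(ℝ, ℝ) ∞ f
  invariant : ∀ (t : Torus m) (x : M), f (t • x) = f x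
  support : tsupport f ⊆ freeLocus m M
  zero_mean : ∫ x, f x ∂T.vol = 0

/-- `Φ` is the flow of `grad_ω f`. -/
def IsHamFlow (f : M → ℝ) (Φ : ℝ → Equiv.Perm M) : Prop :=
  Φ 0 = 1 ∧ ∀ x, IsMIntegralCurve (I := 𝓡 (2 * m)) (fun s => Φ s x) (T.symplGrad f)

/-- `Ham_c^𝕋(M, ω)`: the group generated by the time-one flows of `grad_ω f` for
`f ∈ C^∞_{c,0}(M)^𝕋`. -/
def HamC [MeasurableSpace M] : Subgroup (Equiv.Perm M) :=
  Subgroup.closure {φ | ∃ f Φ, T.CompactZeroMean f ∧ T.IsHamFlow f Φ ∧ φ = Φ 1}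

/-- The action `φ · K = φ_* K φ_*⁻¹` of `Ham_c^𝕋(M, ω)` on `(GAK^𝕋_ω(M), Ω)` is well defined,
symplectic and hamiltonian, and `f ↦ ν f` is its moment map: `ν` takes values in the linear dual of
`C^∞_{c,0}(M)^𝕋`, is equivariant, and each `ν f` is a hamiltonian function for the infinitesimal
action `V^♯` of `V = grad_ω f`, with the sign convention `dν^f = -Ω(V^♯, ·)` matching
`df = -ω(grad_ω f, ·)`. The derivative of `ν f` at `K` in the direction of a tangent vector `K'` is
taken along every smooth curve of invariant endomorphism fields with velocity `K'` at `K`, in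
particular along the curves in `GAK^𝕋_ω(M)`. -/
structure IsHamiltonianAction [MeasurableSpace M] (ν : (M → ℝ) → CEndo m M → ℝ) : Prop where
  act_mem : ∀ φ ∈ T.HamC, ∀ K, T.GAK K → T.GAK (CEndo.push φ K)
  act_one : ∀ K, T.GAK K → CEndo.push 1 K = K
  act_mul : ∀ φ ∈ T.HamC, ∀ ψ ∈ T.HamC, ∀ K, T.GAK K →
    CEndo.push (φ * ψ) K = CEndo.push φ (CEndo.push ψ K)
  act_tangent : ∀ φ ∈ T.HamC, ∀ K K', T.GAK K → T.GAKTangent K K' →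
    T.GAKTangent (CEndo.push φ K) (CEndo.push φ K')
  symplectic : ∀ φ ∈ T.HamC, ∀ K K₁ K₂, T.GAK K → T.GAKTangent K K₁ → T.GAKTangent K K₂ →
    T.Omega (CEndo.push φ K) (CEndo.push φ K₁) (CEndo.push φ K₂) = T.Omega K K₁ K₂
  map_add : ∀ K, T.GAK K → ∀ f g, T.CompactZeroMean f → T.CompactZeroMean g →
    ν (fun x => f x + g x) K = ν f K + ν g K
  map_smul : ∀ K, T.GAK K → ∀ (c : ℝ) (f : M → ℝ), T.CompactZeroMean f →
    ν (fun x => c * f x) K = c * ν f K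
  adjoint_mem : ∀ φ ∈ T.HamC, ∀ f, T.CompactZeroMean f → T.CompactZeroMean (f ∘ φ.symm)
  equivariant : ∀ φ ∈ T.HamC, ∀ f, T.CompactZeroMean f → ∀ K, T.GAK K →
    ν (f ∘ φ.symm) (CEndo.push φ K) = ν f K
  hamiltonian : ∀ f, T.CompactZeroMean f → ∃ Φ, T.IsHamFlow f Φ ∧ (∀ s, Φ s ∈ T.HamC) ∧
    ∀ K, T.GAK K → ∃ V, T.GAKTangent K V ∧ CEndo.HasVelocity (fun s => CEndo.push (Φ s) K) V ∧
      ∀ K', T.GAKTangent K K' → ∀ γ : ℝ → CEndo m M, CEndo.SmoothCurve γ →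
        (∀ s, (γ s).Invariant) → γ 0 = K → CEndo.HasVelocity γ K' →
          HasDerivAt (fun s => (ν f (γ s) : ℂ)) (-T.Omega K V K') 0

section Coordinates

variable (ξ : Module.Basis (Fin m) ℝ (Fin m → ℝ))

/-- The coordinates `μ^i = μ^{ξ_i}` of the moment map in a basis `ξ` of `𝔱`. -/
def momCoord (x : M) : Fin m → ℝ := fun i => T.mom x (ξ i)

/-- The interior of the moment polytope `Δ = μ(M)`, in the coordinates dual to `ξ`. -/
def polytopeInterior : Set (Fin m → ℝ) := interior (Set.range (T.momCoord ξ))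

/-- A vector `E` at `x` with `dμ^j(E) = δ_{ij}`. -/
def momFrame (i : Fin m) (x : M) : TangentSpace (𝓡 (2 * m)) x :=
  Classical.epsilon fun v : TangentSpace (𝓡 (2 * m)) x =>
    ∀ j, dif m (fun y => T.momCoord ξ y j) x v = if j = i then 1 else 0

/-- `∂u/∂μ^i` on `M°` for a `𝕋`-invariant function `u`. Since `du` vanishes on the tangent spaces of
the orbits, which are the common kernels of the `dμ^j`, the choice of the vector `momFrame`
is immaterial, and this is the partial derivative in any momentum-angle coordinates `(μ^j, t^j)`. -/
def momPartial (i : Fin m) (u : M → ℝ) (x : M) : ℝ := dif m u x (T.momFrame ξ i x)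

/-- `Q_{ij} = ω(K K_i, K_j)`, with `K_i = ξ_i^♯`. -/
def Q (K : CEndo m M) (i j : Fin m) (x : M) : ℂ :=
  T.formC x (K.toEnd x ((1 : ℂ) ⊗ₜ[ℝ] fundField (ξ i) x)) ((1 : ℂ) ⊗ₜ[ℝ] fundField (ξ j) x)

/-- `u_GK(K) = ∑_{ij} ∂² Re Q_{ij} / ∂μ^i ∂μ^j`. -/
def uGK (K : CEndo m M) (x : M) : ℝ :=
  ∑ i, ∑ j, T.momPartial ξ i (T.momPartial ξ j (fun y => (T.Q ξ K i j y).re)) x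

/-- `ν^f(K) = -∫_{M°} f u_GK(K) v_ω`. -/
def nu [MeasurableSpace M] (f : M → ℝ) (K : CEndo m M) : ℝ :=
  -∫ x in freeLocus m M, f x * T.uGK ξ K x ∂T.vol

/-- The distribution `𝒦` tangent to the orbits. -/
def orbitDistribution (m : ℕ) {M : Type*} [TopologicalSpace M] [ChartedSpace (Model m) M]
    [MulAction (Torus m) M] (x : M) : Submodule ℝ (TangentSpace (𝓡 (2 * m)) x) :=
  Submodule.span ℝ (Set.range fun ζ : Fin m → ℝ => fundField ζ x)

/-- The class `DGK^𝕋_ω(M)`: `𝕋`-invariant `ω`-tamed almost complex structures `J` with `J` and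
`J^{*_ω}` integrable and `J^{*_ω} 𝒦 = J 𝒦` on `M°`. -/
structure DGK
    (J : (x : M) → TangentSpace (𝓡 (2 * m)) x →L[ℝ] TangentSpace (𝓡 (2 * m)) x) : Prop where
  smooth : SmoothEnd J
  sq : ∀ x v, J x (J x v) = -v
  tamed : ∀ x v, v ≠ 0 → 0 < T.form x v (J x v)
  invariant : ∀ (t : Torus m) (x : M) (v : TangentSpace (𝓡 (2 * m)) x),
    tangentMapAt m (fun y : M => t • y) x (J x v)
      = J (t • x) (tangentMapAt m (fun y : M => t • y) x v)
  integrable : NijenhuisFree J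
  integrable_adjoint : NijenhuisFree (T.symplAdjoint J)
  antidiagonal : ∀ x ∈ freeLocus m M,
    (orbitDistribution m x).map (T.symplAdjoint J x).toLinearMap
      = (orbitDistribution m x).map (J x).toLinearMap

/-- The element `K = A + iB` of `GAK_ω(M)` that corresponds to an `ω`-tamed `J`:
`A = -2 (J - J^{*_ω})⁻¹`, `B = -(J + J^{*_ω}) (J - J^{*_ω})⁻¹`. -/
def ofTamed
    (J : (x : M) → TangentSpace (𝓡 (2 * m)) x →L[ℝ] TangentSpace (𝓡 (2 * m)) x) :
    CEndo m M where
  re x := -((2 : ℝ) • (J x - T.symplAdjoint J x).inverse)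
  im x := -((J x + T.symplAdjoint J x) ∘L (J x - T.symplAdjoint J x).inverse)

/-- The matrix `Ψ` of the anti-diagonal form
`J = ∑ Ψ_{ij} ∂/∂t^i ⊗ dμ^j - ∑ Ψ^{ij} ∂/∂μ^i ⊗ dt^j`: since `∂/∂t^j = K_j`, its inverse has
the entries `Ψ^{ij} = -dμ^i(J K_j)`. -/
def Psi (J : (x : M) → TangentSpace (𝓡 (2 * m)) x →L[ℝ] TangentSpace (𝓡 (2 * m)) x) (x : M) :
    Matrix (Fin m) (Fin m) ℝ :=
  (Matrix.of fun i j =>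
    -dif m (fun y => T.momCoord ξ y i) x (J x (fundField (ξ j) x)))⁻¹

/-- The symmetric part `S` of `Ψ`. -/
def symPsi (J : (x : M) → TangentSpace (𝓡 (2 * m)) x →L[ℝ] TangentSpace (𝓡 (2 * m)) x)
    (x : M) : Matrix (Fin m) (Fin m) ℝ :=
  (1 / 2 : ℝ) • (T.Psi ξ J x + (T.Psi ξ J x).transpose)

/-- Partial derivatives and Hessian on the coordinate space of `𝔱*`. -/
def partialD (i : Fin m) (F : (Fin m → ℝ) → ℝ) (y : Fin m → ℝ) : ℝ :=
  fderiv ℝ F y (Pi.single i 1)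

def hess (τ : (Fin m → ℝ) → ℝ) (y : Fin m → ℝ) : Matrix (Fin m) (Fin m) ℝ :=
  Matrix.of fun i j => partialD i (partialD j τ) y

/-- `τ` is a symplectic potential of `J`: in the momentum-angle coordinates `(μ^j, t^j)` induced by
`J` on `M°`, for which `∂/∂t^j = K_j` and the `E_j = ∂/∂μ^j` span `J𝒦`, the structure `J` has the
anti-diagonal form with `Ψ = Hess τ + C` for a constant antisymmetric matrix `C`. -/
def IsSymplecticPotential
    (J : (x : M) → TangentSpace (𝓡 (2 * m)) x →L[ℝ] TangentSpace (𝓡 (2 * m)) x)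
    (τ : (Fin m → ℝ) → ℝ) : Prop :=
  ContDiffOn ℝ ∞ τ (T.polytopeInterior ξ) ∧
  ∃ C : Matrix (Fin m) (Fin m) ℝ, C.transpose = -C ∧
    ∀ x ∈ freeLocus m M, ∃ E : Fin m → TangentSpace (𝓡 (2 * m)) x,
      (∀ j, E j ∈ (orbitDistribution m x).map (J x).toLinearMap) ∧
      (∀ i j, dif m (fun y => T.momCoord ξ y i) x (E j) = if i = j then 1 else 0) ∧
      (∀ j, J x (E j) = ∑ i, (hess τ (T.momCoord ξ x) + C) i j • fundField (ξ i) x) ∧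
      (∀ j, J x (fundField (ξ j) x) = -∑ i, (hess τ (T.momCoord ξ x) + C)⁻¹ i j • E i)

end Coordinates

end ToricStructure

end ToricGK

end

/-! For invariant `f` supported where the action is free, `df` is a combination of the `dμ^k`. Hence
`grad_ω f = ∑ F_k K_k` with `F_k = ∂f/∂μ^k` constant along orbits, and the flow is explicit: `x ↦
exp(s F(x)) • x` (`isHamFlow_twist`). Such twists form a group under addition of `F`, so every
element of `Ham_c` is one (`exists_twist_of_mem_HamC`).

On an invariant `K` a twist acts by `K ↦ (1 + R) K (1 - R)`, `R = ∑ K_k ⊗ dF_k` (`push_twistPerm`).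
`R` kills the orbit directions and takes values in them, so `R² = 0`; the identity `d(df) = 0` makes
`1 + R` symplectic. Invariance of the space and of `Ω` is then pointwise linear algebra.
Equivariance holds because `f` is unchanged and `R K_i = 0` leaves `Re Q_ij` unchanged.

For the moment map equation, the infinitesimal action is `[R, K]`, and `tr(K [R, K] K') = 2 tr(R
K')` when `K'` anticommutes with `K` (`trace_commutator`). Since `R = ∑ K_i ⊗ d(∂f/∂μ^i)` and `dμ^j
= ω(·, K_j)`, this trace is `2 ∑ f_ij Re Q_ij(K')`, with `f_ij` the second momentum derivatives of
`f` (`trace_twist_mul`). On the other side, two integrations by parts give `ν^f(K) = -∫ ∑ f_ij Re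
Q_ij(K) v_ω` (`GAK.nu_eq`). This is linear in `K` and free of its derivatives, so its differential
is `-Ω([R, K], ·)`.

Integration by parts requires `∫ ∂h/∂μ^i v_ω = 0`. Locally `M` is parametrized by `(θ, b) ↦ exp(θ) •
s(b)` with `s` a section of the moment map. The section need not be Lagrangian, but a shear shows
that the density of `v_ω` is constant anyway (`abs_pf_adapted`). An invariant field `X` with `dμ(X)
= e_i` is there `∂/∂b_i + ∑ α_j K_j` with `α_j` constant along the `K_j`, hence divergence-free; a
partition of unity globalizes this (`MomField.integral_dif`). Positivity of `K` provides such an `X`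
on the whole locally free locus (`GAK.exists_momField`).

For `J` in `DGK`, the equality `J𝒦 = J^{*_ω}𝒦` gives a frame `E_j` of `J𝒦`, dual to the `dμ^i`, with
`(J - J^{*_ω}) E_j = 2 ∑ S_kj K_k`. Inverting this yields `Re Q_ij = -S^{ij}` (`DGK.Q_re_ofTamed`),
which is substituted into `ν`. -/

noncomputable section

open scoped Topology
open Filter Set

namespace ToricGK

set_option linter.unusedSectionVars false

/-! ### Smooth vector fields and endomorphism fields in tangent coordinates -/

section TangentCoordinates

variable {m : ℕ} {M : Type*} [TopologicalSpace M] [ChartedSpace (Model m) M]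
  [IsManifold (𝓡 (2 * m)) ∞ M]

/-- The coordinates of tangent vectors at `x` in the chart at `x₀`. -/
def tc (x₀ x : M) : TangentSpace (𝓡 (2 * m)) x →L[ℝ] Model m :=
  (trivializationAt (Model m) (TangentSpace (𝓡 (2 * m))) x₀).continuousLinearMapAt ℝ x

/-- The tangent vector at `x` with given coordinates in the chart at `x₀`. -/
def tcs (x₀ x : M) : Model m →L[ℝ] TangentSpace (𝓡 (2 * m)) x :=
  (trivializationAt (Model m) (TangentSpace (𝓡 (2 * m))) x₀).symmL ℝ x

lemma tc_tcs {x₀ x : M} (h : x ∈ (chartAt (Model m) x₀).source) (v : Model m) :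
    tc x₀ x (tcs x₀ x v) = v :=
  (trivializationAt (Model m) (TangentSpace (𝓡 (2 * m))) x₀).continuousLinearMapAt_symmL h v

lemma tcs_tc {x₀ x : M} (h : x ∈ (chartAt (Model m) x₀).source)
    (v : TangentSpace (𝓡 (2 * m)) x) : tcs x₀ x (tc x₀ x v) = v :=
  (trivializationAt (Model m) (TangentSpace (𝓡 (2 * m))) x₀).symmL_continuousLinearMapAt h v

/-- The tangent coordinates as an isomorphism. -/
def tcEquiv {x₀ x : M} (h : x ∈ (chartAt (Model m) x₀).source) :
    TangentSpace (𝓡 (2 * m)) x ≃L[ℝ] Model m :=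
  ContinuousLinearEquiv.equivOfInverse (tc x₀ x) (tcs x₀ x) (tcs_tc h) (tc_tcs h)

lemma source_nhds (x₀ : M) : ∀ᶠ x in 𝓝 x₀, x ∈ (chartAt (Model m) x₀).source :=
  (chartAt (Model m) x₀).open_source.mem_nhds (mem_chart_source _ x₀)

/-- Smoothness of a vector field at a point. -/
def SmoothVFAt (X : (x : M) → TangentSpace (𝓡 (2 * m)) x) (x₀ : M) : Prop :=
  ContMDiffAt (𝓡 (2 * m)) (𝓡 (2 * m)).tangent ∞
    (fun x => (⟨x, X x⟩ : TangentBundle (𝓡 (2 * m)) M)) x₀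

lemma smoothVFAt_iff (X : (x : M) → TangentSpace (𝓡 (2 * m)) x) (x₀ : M) :
    SmoothVFAt X x₀ ↔ ContMDiffAt (𝓡 (2 * m)) 𝓘(ℝ, Model m) ∞ (fun x => tc x₀ x (X x)) x₀ := by
  unfold SmoothVFAt
  refine (Bundle.contMDiffAt_section _).trans ?_
  refine Filter.EventuallyEq.contMDiffAt_iff ?_
  filter_upwards [source_nhds (m := m) x₀] with x hx
  exact (Trivialization.continuousLinearMapAt_apply_of_mem ℝ _ hx _).symm

/-- Smoothness of a section of `End(TM)` at a point. -/
def SmoothEndAt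
    (A : (x : M) → TangentSpace (𝓡 (2 * m)) x →L[ℝ] TangentSpace (𝓡 (2 * m)) x) (x₀ : M) : Prop :=
  ContMDiffAt (𝓡 (2 * m)) ((𝓡 (2 * m)).prod 𝓘(ℝ, Model m →L[ℝ] Model m)) ∞
    (fun x => TotalSpace.mk' (Model m →L[ℝ] Model m)
      (E := fun y : M => TangentSpace (𝓡 (2 * m)) y →L[ℝ] TangentSpace (𝓡 (2 * m)) y) x (A x)) x₀

lemma smoothEndAt_iff
    (A : (x : M) → TangentSpace (𝓡 (2 * m)) x →L[ℝ] TangentSpace (𝓡 (2 * m)) x) (x₀ : M) :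
    SmoothEndAt A x₀ ↔ ContMDiffAt (𝓡 (2 * m)) 𝓘(ℝ, Model m →L[ℝ] Model m) ∞
      (fun x => tc x₀ x ∘L A x ∘L tcs x₀ x) x₀ := by
  unfold SmoothEndAt
  rw [contMDiffAt_hom_bundle]
  exact ⟨fun h => h.2, fun h => ⟨contMDiffAt_id, h⟩⟩

lemma SmoothVFAt.form {σ : SymplecticForm m M} {X Y : (x : M) → TangentSpace (𝓡 (2 * m)) x}
    {x₀ : M} (hX : SmoothVFAt X x₀) (hY : SmoothVFAt Y x₀) :
    ContMDiffAt (𝓡 (2 * m)) 𝓘(ℝ, ℝ) ∞ (fun x => σ.form x (X x) (Y x)) x₀ := by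
  have := ContMDiffAt.clm_bundle_apply₂ (F₁ := Model m) (F₂ := Model m)
    (E₁ := TangentSpace (𝓡 (2 * m)) (M := M)) (E₂ := TangentSpace (𝓡 (2 * m)) (M := M)) (F₃ := ℝ)
    (E₃ := Bundle.Trivial M ℝ) (σ.smooth x₀) hX hY
  exact (contMDiffAt_section _).1 this

lemma smoothVFAt_tcs (x₀ : M) (v : Model m) : SmoothVFAt (fun x => tcs x₀ x v) x₀ := by
  rw [smoothVFAt_iff]
  refine (contMDiffAt_const (c := v)).congr_of_eventuallyEq ?_
  filter_upwards [source_nhds (m := m) x₀] with x hx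
  exact tc_tcs hx v

/-- An operator on a finite-dimensional space is a finite sum of rank-one operators built from its
values on a basis. Smoothness of tensor fields can therefore be tested on the local frame `tcs`. -/
lemma contMDiffAt_clm_of_apply {N : Type*} [TopologicalSpace N] {E H : Type*}
    [NormedAddCommGroup E] [NormedSpace ℝ E] [TopologicalSpace H] [ChartedSpace H N]
    {I : ModelWithCorners ℝ E H} {V W : Type*} [NormedAddCommGroup V] [NormedSpace ℝ V]
    [FiniteDimensional ℝ V] [NormedAddCommGroup W] [NormedSpace ℝ W]
    {B : N → V →L[ℝ] W} {x₀ : N} (h : ∀ v, ContMDiffAt I 𝓘(ℝ, W) ∞ (fun x => B x v) x₀) :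
    ContMDiffAt I 𝓘(ℝ, V →L[ℝ] W) ∞ B x₀ := by
  let b := Module.finBasis ℝ V
  have : B = fun x => ∑ i, (ContinuousLinearMap.smulRightL ℝ V W
      (b.coord i).toContinuousLinearMap) (B x (b i)) := by
    funext x
    ext v
    conv_lhs => rw [← b.sum_repr v, map_sum]
    simp
  rw [this]
  exact contMDiffAt_finsetSum fun i _ =>
    (ContinuousLinearMap.contMDiffAt (𝕜 := ℝ) _).comp x₀ (h (b i))

/-- The matrix of the symplectic form in the chart at `x₀`. -/
def coordForm (σ : SymplecticForm m M) (x₀ x : M) : Model m →L[ℝ] Model m →L[ℝ] ℝ :=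
  (ContinuousLinearMap.precomp ℝ (tcs x₀ x)) ∘L (σ.form x) ∘L tcs x₀ x

@[simp] lemma coordForm_apply (σ : SymplecticForm m M) (x₀ x : M) (v w : Model m) :
    coordForm σ x₀ x v w = σ.form x (tcs x₀ x v) (tcs x₀ x w) := rfl

lemma contMDiffAt_coordForm (σ : SymplecticForm m M) (x₀ : M) :
    ContMDiffAt (𝓡 (2 * m)) 𝓘(ℝ, Model m →L[ℝ] Model m →L[ℝ] ℝ) ∞ (coordForm σ x₀) x₀ :=
  contMDiffAt_clm_of_apply fun v => contMDiffAt_clm_of_apply fun w =>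
    (smoothVFAt_tcs x₀ v).form (smoothVFAt_tcs x₀ w)

lemma contMDiffAt_dif {f : M → ℝ} {x₀ : M} (hf : ContMDiffAt (𝓡 (2 * m)) 𝓘(ℝ, ℝ) ∞ f x₀) :
    ContMDiffAt (𝓡 (2 * m)) 𝓘(ℝ, Model m →L[ℝ] ℝ) ∞ (fun x => dif m f x ∘L tcs x₀ x) x₀ := by
  refine (hf.mfderiv_const (m := ∞) (by simp)).congr_of_eventuallyEq ?_
  filter_upwards [source_nhds (m := m) x₀] with x hx
  simp only [inTangentCoordinates, ContinuousLinearMap.inCoordinates,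
    TangentBundle.continuousLinearMapAt_model_space]
  rfl

lemma SmoothVFAt.dif {f : M → ℝ} {X : (x : M) → TangentSpace (𝓡 (2 * m)) x} {x₀ : M}
    (hf : ContMDiffAt (𝓡 (2 * m)) 𝓘(ℝ, ℝ) ∞ f x₀) (hX : SmoothVFAt X x₀) :
    ContMDiffAt (𝓡 (2 * m)) 𝓘(ℝ, ℝ) ∞ (fun x => dif m f x (X x)) x₀ := by
  refine ((contMDiffAt_dif hf).clm_apply ((smoothVFAt_iff _ _).1 hX)).congr_of_eventuallyEq ?_
  filter_upwards [source_nhds (m := m) x₀] with x hx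
  simp [tcs_tc hx]

lemma contMDiffAt_inverse {V W : Type*} [NormedAddCommGroup V] [NormedSpace ℝ V]
    [NormedAddCommGroup W] [NormedSpace ℝ W] [CompleteSpace V]
    {A : M → V →L[ℝ] W} {x₀ : M} (hA : ContMDiffAt (𝓡 (2 * m)) 𝓘(ℝ, V →L[ℝ] W) ∞ A x₀)
    (h : (A x₀).IsInvertible) :
    ContMDiffAt (𝓡 (2 * m)) 𝓘(ℝ, W →L[ℝ] V) ∞ (fun x => (A x).inverse) x₀ := by
  obtain ⟨e, he⟩ := h
  exact (he ▸ contDiffAt_map_inverse e : ContDiffAt ℝ ∞ _ _).contMDiffAt.comp x₀ hA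

section Sections

variable {A B : (x : M) → TangentSpace (𝓡 (2 * m)) x →L[ℝ] TangentSpace (𝓡 (2 * m)) x}
  {X Y : (x : M) → TangentSpace (𝓡 (2 * m)) x} {x₀ : M}

lemma SmoothEndAt.apply (hA : SmoothEndAt A x₀) (hX : SmoothVFAt X x₀) :
    SmoothVFAt (fun x => A x (X x)) x₀ :=
  ContMDiffAt.clm_bundle_apply (F₁ := Model m) (F₂ := Model m)
    (E₁ := TangentSpace (𝓡 (2 * m)) (M := M)) (E₂ := TangentSpace (𝓡 (2 * m)) (M := M)) hA hX

lemma SmoothEndAt.comp (hA : SmoothEndAt A x₀) (hB : SmoothEndAt B x₀) :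
    SmoothEndAt (fun x => A x ∘L B x) x₀ := by
  rw [smoothEndAt_iff] at *
  refine (hA.clm_comp hB).congr_of_eventuallyEq ?_
  filter_upwards [source_nhds (m := m) x₀] with x hx
  ext v : 1
  simp [tcs_tc hx]

lemma SmoothEndAt.add (hA : SmoothEndAt A x₀) (hB : SmoothEndAt B x₀) :
    SmoothEndAt (fun x => A x + B x) x₀ := by
  rw [smoothEndAt_iff] at *
  refine (hA.add hB).congr_of_eventuallyEq (.of_forall fun x => ?_)
  ext v : 1
  simp

lemma SmoothEndAt.const_smul (c : ℝ) (hA : SmoothEndAt A x₀) :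
    SmoothEndAt (fun x => c • A x) x₀ := by
  rw [smoothEndAt_iff] at *
  refine ((contMDiffAt_const (c := c • ContinuousLinearMap.id ℝ (Model m))).clm_comp
    hA).congr_of_eventuallyEq (.of_forall fun x => ?_)
  ext v : 1
  simp

lemma SmoothEndAt.neg (hA : SmoothEndAt A x₀) : SmoothEndAt (fun x => -A x) x₀ := by
  simpa using hA.const_smul (-1)

lemma SmoothEndAt.sub (hA : SmoothEndAt A x₀) (hB : SmoothEndAt B x₀) :
    SmoothEndAt (fun x => A x - B x) x₀ := by
  simpa [sub_eq_add_neg] using hA.add hB.neg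

lemma smoothEndAt_id :
    SmoothEndAt (fun x : M => ContinuousLinearMap.id ℝ (TangentSpace (𝓡 (2 * m)) x)) x₀ := by
  rw [smoothEndAt_iff]
  refine (contMDiffAt_const (c := ContinuousLinearMap.id ℝ (Model m))).congr_of_eventuallyEq ?_
  filter_upwards [source_nhds (m := m) x₀] with x hx
  ext v : 1
  simp [tc_tcs hx]

/-- Tangent coordinates are an isomorphism on the chart domain, so inversion commutes with passing
to coordinates, where it is a smooth map near an invertible operator. -/
lemma SmoothEndAt.inverse (hA : SmoothEndAt A x₀) (h : ∀ x, (A x).IsInvertible) :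
    SmoothEndAt (fun x => (A x).inverse) x₀ := by
  rw [smoothEndAt_iff] at *
  have key : ∀ x (hx : x ∈ (chartAt (Model m) x₀).source),
      tc x₀ x ∘L A x ∘L tcs x₀ x
        = (((tcEquiv hx).symm.trans (h x).choose).trans (tcEquiv hx) : Model m ≃L[ℝ] Model m) := by
    intro x hx
    ext v : 1
    have := congrArg (fun f => f (tcs x₀ x v)) (h x).choose_spec
    change tc x₀ x (A x (tcs x₀ x v)) = tc x₀ x ((h x).choose (tcs x₀ x v))
    rw [← this]; rfl
  refine (contMDiffAt_inverse hA ⟨_, (key x₀ (mem_chart_source _ x₀)).symm⟩).congr_of_eventuallyEq ?_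
  filter_upwards [source_nhds (m := m) x₀] with x hx
  rw [key x hx, ContinuousLinearMap.inverse_equiv]
  conv_lhs => rw [← (h x).choose_spec, ContinuousLinearMap.inverse_equiv]
  rfl

lemma SmoothVFAt.smul {f : M → ℝ} (hf : ContMDiffAt (𝓡 (2 * m)) 𝓘(ℝ, ℝ) ∞ f x₀)
    (hX : SmoothVFAt X x₀) : SmoothVFAt (fun x => f x • X x) x₀ := by
  rw [smoothVFAt_iff] at *
  refine (hf.smul hX).congr_of_eventuallyEq (.of_forall fun x => ?_)
  simp

lemma SmoothVFAt.sum {ι : Type*} (s : Finset ι) {X : ι → (x : M) → TangentSpace (𝓡 (2 * m)) x}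
    (hX : ∀ i ∈ s, SmoothVFAt (X i) x₀) : SmoothVFAt (fun x => ∑ i ∈ s, X i x) x₀ := by
  rw [smoothVFAt_iff]
  refine (contMDiffAt_finsetSum (t := s) (f := fun i x => tc x₀ x (X i x))
    fun i hi => (smoothVFAt_iff _ _).1 (hX i hi)).congr_of_eventuallyEq (.of_forall fun x => ?_)
  simp

lemma SmoothEndAt.of_apply
    (h : ∀ v : Model m, SmoothVFAt (fun x => A x (tcs x₀ x v)) x₀) : SmoothEndAt A x₀ := by
  rw [smoothEndAt_iff]
  exact contMDiffAt_clm_of_apply fun v => (smoothVFAt_iff _ _).1 (h v)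

end Sections

end TangentCoordinates

/-! ### Duality by the symplectic form -/

section Symplectic

variable {m : ℕ} {M : Type*} [TopologicalSpace M] [ChartedSpace (Model m) M]
  [IsManifold (𝓡 (2 * m)) ∞ M]

instance (x : M) : FiniteDimensional ℝ (TangentSpace (𝓡 (2 * m)) x) :=
  inferInstanceAs (FiniteDimensional ℝ (Model m))

instance (x : M) : T2Space (TangentSpace (𝓡 (2 * m)) x) :=
  inferInstanceAs (T2Space (Model m))

lemma finrank_tangentSpace (x : M) : Module.finrank ℝ (TangentSpace (𝓡 (2 * m)) x) = 2 * m := by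
  change Module.finrank ℝ (Model m) = 2 * m
  simp

lemma isInvertible_of_injective_bilin {V : Type*} [AddCommGroup V] [Module ℝ V]
    [TopologicalSpace V] [IsTopologicalAddGroup V] [ContinuousSMul ℝ V] [T2Space V]
    [FiniteDimensional ℝ V] (B : V →L[ℝ] V →L[ℝ] ℝ) (h : Function.Injective B) :
    B.IsInvertible := by
  let e : V ≃ₗ[ℝ] (V →L[ℝ] ℝ) :=
    LinearEquiv.ofInjectiveOfFinrankEq B.toLinearMap h (by
      rw [← (LinearMap.toContinuousLinearMap :
        (V →ₗ[ℝ] ℝ) ≃ₗ[ℝ] (V →L[ℝ] ℝ)).finrank_eq]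
      exact (Subspace.dual_finrank_eq).symm)
  exact ⟨e.toContinuousLinearEquiv, by ext v w; rfl⟩

namespace SymplecticForm

variable (σ : SymplecticForm m M)

lemma skew (x : M) (v w : TangentSpace (𝓡 (2 * m)) x) : σ.form x v w = -σ.form x w v := by
  have h := σ.alternating x (v + w)
  simp only [map_add, add_apply, σ.alternating] at h
  linarith

lemma form_injective (x : M) : Function.Injective (σ.form x) := by
  rw [injective_iff_map_eq_zero]
  intro v hv
  exact σ.nondegenerate x v fun w => by simp [hv]

lemma isInvertible_form (x : M) : (σ.form x).IsInvertible :=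
  isInvertible_of_injective_bilin (σ.form x) (σ.form_injective x)

lemma form_inverse (x : M) (α : TangentSpace (𝓡 (2 * m)) x →L[ℝ] ℝ) :
    σ.form x ((σ.form x).inverse α) = α := by
  obtain ⟨e, he⟩ := σ.isInvertible_form x
  rw [← he, ContinuousLinearMap.inverse_equiv]
  exact e.apply_symm_apply α

lemma form_symplGrad (f : M → ℝ) (x : M) (w : TangentSpace (𝓡 (2 * m)) x) :
    σ.form x (σ.symplGrad f x) w = -dif m f x w := by
  simp [symplGrad, form_inverse]

lemma form_ext {x : M} {v v' : TangentSpace (𝓡 (2 * m)) x}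
    (h : ∀ w, σ.form x v w = σ.form x v' w) : v = v' :=
  σ.form_injective x (ContinuousLinearMap.ext h)

lemma form_ext_right {x : M} {v v' : TangentSpace (𝓡 (2 * m)) x}
    (h : ∀ w, σ.form x w v = σ.form x w v') : v = v' :=
  σ.form_ext fun w => by rw [σ.skew, h, ← σ.skew]

lemma form_symplAdjoint
    (A : (x : M) → TangentSpace (𝓡 (2 * m)) x →L[ℝ] TangentSpace (𝓡 (2 * m)) x) (x : M)
    (v w : TangentSpace (𝓡 (2 * m)) x) :
    σ.form x v (σ.symplAdjoint A x w) = σ.form x (A x v) w := by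
  rw [σ.skew, σ.skew x (A x v)]
  congr 1
  change σ.form x ((σ.form x).inverse ((σ.form x w) ∘L A x)) v = _
  rw [form_inverse]
  rfl

/-- By nondegeneracy, the coordinates of `X` are the inverse matrix of `ω` applied to the pairings
of `X` with the local frame. Gradients, adjoints and fundamental fields, all known through their
`ω`-pairings, are smooth by this test. -/
lemma smoothVFAt_of_form {X : (x : M) → TangentSpace (𝓡 (2 * m)) x} {x₀ : M}
    (h : ∀ v : Model m, ContMDiffAt (𝓡 (2 * m)) 𝓘(ℝ, ℝ) ∞
      (fun x => σ.form x (X x) (tcs x₀ x v)) x₀) : SmoothVFAt X x₀ := by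
  rw [smoothVFAt_iff]
  have h1 : ContMDiffAt (𝓡 (2 * m)) 𝓘(ℝ, Model m →L[ℝ] ℝ) ∞
      (fun x => σ.form x (X x) ∘L tcs x₀ x) x₀ := contMDiffAt_clm_of_apply h
  have hinv : ∀ x (_ : x ∈ (chartAt (Model m) x₀).source), (coordForm σ x₀ x).IsInvertible := by
    intro x hx
    obtain ⟨e, he⟩ := σ.isInvertible_form x
    refine ⟨((tcEquiv hx).symm.trans e).trans
      ((tcEquiv hx).arrowCongr (ContinuousLinearEquiv.refl ℝ ℝ)), ?_⟩
    ext v w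
    have := congrArg (fun f => f (tcs x₀ x v) (tcs x₀ x w)) he
    exact this
  refine ((contMDiffAt_inverse (contMDiffAt_coordForm σ x₀)
    (hinv x₀ (mem_chart_source _ x₀))).clm_apply h1).congr_of_eventuallyEq ?_
  filter_upwards [source_nhds (m := m) x₀] with x hx
  symm
  rw [(hinv x hx).inverse_apply_eq]
  ext w
  simp [tcs_tc hx]

lemma smoothEndAt_symplAdjoint
    {A : (x : M) → TangentSpace (𝓡 (2 * m)) x →L[ℝ] TangentSpace (𝓡 (2 * m)) x} {x₀ : M}
    (hA : SmoothEndAt A x₀) : SmoothEndAt (σ.symplAdjoint A) x₀ := by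
  refine SmoothEndAt.of_apply fun v => σ.smoothVFAt_of_form fun w => ?_
  refine (SmoothVFAt.form (σ := σ) (hA.apply (smoothVFAt_tcs x₀ w))
    (smoothVFAt_tcs x₀ v)).neg.congr_of_eventuallyEq (.of_forall fun x => ?_)
  change σ.form x (σ.symplAdjoint A x (tcs x₀ x v)) (tcs x₀ x w)
    = -(σ.form x (A x (tcs x₀ x w)) (tcs x₀ x v))
  rw [σ.skew, σ.form_symplAdjoint]

lemma symplGrad_smoothVFAt {f : M → ℝ} {x₀ : M}
    (hf : ContMDiffAt (𝓡 (2 * m)) 𝓘(ℝ, ℝ) ∞ f x₀) : SmoothVFAt (σ.symplGrad f) x₀ := by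
  refine σ.smoothVFAt_of_form fun w => ?_
  refine (SmoothVFAt.dif hf (smoothVFAt_tcs x₀ w)).neg.congr_of_eventuallyEq
    (.of_forall fun x => ?_)
  exact σ.form_symplGrad f x _

end SymplecticForm

end Symplectic

/-! ### Vectors `a + ib` of the complexified tangent space -/

section Complexification

variable {V : Type*} [AddCommGroup V] [Module ℝ V]

/-- The vector `a + ib` of the complexification. -/
def cvec (a b : V) : ℂ ⊗[ℝ] V := (1 : ℂ) ⊗ₜ[ℝ] a + Complex.I ⊗ₜ[ℝ] b

lemma exists_cvec (U : ℂ ⊗[ℝ] V) : ∃ a b, U = cvec a b := by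
  induction U using TensorProduct.induction_on with
  | zero => exact ⟨0, 0, by simp [cvec]⟩
  | tmul z v =>
    refine ⟨z.re • v, z.im • v, ?_⟩
    rw [cvec, ← TensorProduct.smul_tmul, ← TensorProduct.smul_tmul, ← TensorProduct.add_tmul]
    congr 1
    apply Complex.ext <;> simp
  | add x y hx hy =>
    obtain ⟨a, b, rfl⟩ := hx
    obtain ⟨c, d, rfl⟩ := hy
    exact ⟨a + c, b + d, by simp only [cvec, TensorProduct.tmul_add]; abel⟩

lemma cvec_eq_iff (a b c d : V) : cvec a b = cvec c d ↔ a = c ∧ b = d := by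
  refine ⟨fun h => ⟨?_, ?_⟩, fun h => by rw [h.1, h.2]⟩
  · simpa [cvec] using congrArg
      ((TensorProduct.lid ℝ V).toLinearMap ∘ₗ LinearMap.rTensor V Complex.reLm) h
  · simpa [cvec] using congrArg
      ((TensorProduct.lid ℝ V).toLinearMap ∘ₗ LinearMap.rTensor V Complex.imLm) h

lemma cvec_eq_zero_iff (a b : V) : cvec a b = 0 ↔ a = 0 ∧ b = 0 := by
  rw [← cvec_eq_iff, show cvec (0 : V) 0 = 0 by simp [cvec]]

lemma conjC_cvec (a b : V) : conjC V (cvec a b) = cvec a (-b) := by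
  simp [conjC, cvec, TensorProduct.neg_tmul, TensorProduct.tmul_neg]

lemma baseChange_cvec (A : V →ₗ[ℝ] V) (a b : V) :
    A.baseChange ℂ (cvec a b) = cvec (A a) (A b) := by
  simp [cvec]

lemma I_smul_cvec (a b : V) : Complex.I • cvec a b = cvec (-b) a := by
  simp only [cvec, smul_add, TensorProduct.smul_tmul', smul_eq_mul, mul_one, Complex.I_mul_I,
    TensorProduct.tmul_neg, TensorProduct.neg_tmul]
  abel

lemma cvec_add (a b c d : V) : cvec a b + cvec c d = cvec (a + c) (b + d) := by
  simp only [cvec, TensorProduct.tmul_add]; abel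

lemma neg_cvec (a b : V) : -cvec a b = cvec (-a) (-b) := by
  simp only [cvec, TensorProduct.tmul_neg]; abel

end Complexification

/-! ### The conditions on `K = A + iB` in terms of `A` and `B` -/

section Fields

variable {m : ℕ} {M : Type*} [TopologicalSpace M] [ChartedSpace (Model m) M]

lemma toEnd_cvec (K : CEndo m M) (x : M) (a b : TangentSpace (𝓡 (2 * m)) x) :
    K.toEnd x (cvec a b) = cvec (K.re x a - K.im x b) (K.re x b + K.im x a) := by
  simp only [CEndo.toEnd, LinearMap.add_apply, LinearMap.smul_apply, baseChange_cvec,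
    I_smul_cvec, cvec_add]
  simp [sub_eq_add_neg]

variable [IsManifold (𝓡 (2 * m)) ∞ M]

lemma formC_cvec (σ : SymplecticForm m M) (x : M) (a b c d : TangentSpace (𝓡 (2 * m)) x) :
    σ.formC x (cvec a b) (cvec c d) = ((σ.form x a c - σ.form x b d : ℝ) : ℂ)
      + ((σ.form x a d + σ.form x b c : ℝ) : ℂ) * Complex.I := by
  simp only [SymplecticForm.formC, cvec, map_add, LinearMap.add_apply,
    LinearMap.BilinForm.baseChange_tmul]
  simp
  ring_nf

namespace ToricStructure

variable [MulAction (Torus m) M] (T : ToricStructure m M)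

/-- Conjugation fixes `A` and reverses `B`, whence the opposite signs. Real vectors suffice for one
direction, complex bilinearity gives the other. -/
lemma conjSkew_iff (K : CEndo m M) : T.ConjSkew K ↔
    (∀ x v w, T.form x (K.re x v) w = -T.form x v (K.re x w)) ∧
    (∀ x v w, T.form x (K.im x v) w = T.form x v (K.im x w)) := by
  constructor
  · intro h
    have key : ∀ x v w, ((T.form x (K.re x v) w : ℝ) : ℂ) + (T.form x (K.im x v) w : ℝ) * Complex.I
        = -((T.form x v (K.re x w) : ℝ) : ℂ) + (T.form x v (K.im x w) : ℝ) * Complex.I := by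
      intro x v w
      have := h x (cvec v 0) (cvec w 0)
      simp only [toEnd_cvec, conjC_cvec, formC_cvec] at this
      simpa [add_comm] using this
    refine ⟨fun x v w => ?_, fun x v w => ?_⟩
    · simpa using congrArg Complex.re (key x v w)
    · simpa using congrArg Complex.im (key x v w)
  · rintro ⟨h1, h2⟩ x U W
    obtain ⟨a, b, rfl⟩ := exists_cvec U
    obtain ⟨c, d, rfl⟩ := exists_cvec W
    simp only [toEnd_cvec, conjC_cvec, formC_cvec, map_add, map_sub, map_neg, add_apply,
      sub_apply, h1, h2]
    push_cast
    ring

lemma toEnd_sq_iff (K : CEndo m M) (x : M) : K.toEnd x * K.toEnd x = -1 ↔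
    ∀ v, K.re x (K.re x v) - K.im x (K.im x v) = -v ∧ K.re x (K.im x v) + K.im x (K.re x v) = 0 := by
  constructor
  · intro h v
    have := LinearMap.congr_fun h (cvec v 0)
    simp only [Module.End.mul_apply, toEnd_cvec, LinearMap.neg_apply, Module.End.one_apply,
      neg_cvec, cvec_eq_iff] at this
    simpa using this
  · intro h
    ext U
    obtain ⟨a, b, hU⟩ := exists_cvec ((1 : ℂ) ⊗ₜ[ℝ] U)
    change K.toEnd x (K.toEnd x ((1 : ℂ) ⊗ₜ[ℝ] U)) = -((1 : ℂ) ⊗ₜ[ℝ] U)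
    rw [hU]
    simp only [toEnd_cvec, neg_cvec, cvec_eq_iff, map_add, map_sub]
    have h1 := h a
    have h2 := h b
    constructor
    · rw [← h1.1, ← sub_eq_zero]
      calc _ = -(K.re x (K.im x b) + K.im x (K.re x b)) := by abel
        _ = 0 := by rw [h2.2, neg_zero]
    · rw [← h2.1, ← sub_eq_zero]
      calc _ = (K.re x (K.im x a) + K.im x (K.re x a)) := by abel
        _ = 0 := h1.2

lemma toEnd_anticomm_iff (K K' : CEndo m M) (x : M) :
    K'.toEnd x * K.toEnd x + K.toEnd x * K'.toEnd x = 0 ↔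
    ∀ v, K'.re x (K.re x v) - K'.im x (K.im x v) + (K.re x (K'.re x v) - K.im x (K'.im x v)) = 0 ∧
      K'.re x (K.im x v) + K'.im x (K.re x v) + (K.re x (K'.im x v) + K.im x (K'.re x v)) = 0 := by
  constructor
  · intro h v
    have := LinearMap.congr_fun h (cvec v 0)
    simp only [Module.End.mul_apply, toEnd_cvec, LinearMap.add_apply, LinearMap.zero_apply,
      cvec_add, cvec_eq_zero_iff] at this
    simpa using this
  · intro h
    ext U
    obtain ⟨a, b, hU⟩ := exists_cvec ((1 : ℂ) ⊗ₜ[ℝ] U)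
    change K'.toEnd x (K.toEnd x ((1 : ℂ) ⊗ₜ[ℝ] U)) + K.toEnd x (K'.toEnd x ((1 : ℂ) ⊗ₜ[ℝ] U)) = 0
    rw [hU]
    simp only [toEnd_cvec, cvec_add, cvec_eq_zero_iff, map_add, map_sub]
    have h1 := h a
    have h2 := h b
    constructor
    · rw [← sub_zero (0 : TangentSpace (𝓡 (2 * m)) x)]
      nth_rw 1 [← h1.1, ← h2.2]
      abel
    · rw [← add_zero (0 : TangentSpace (𝓡 (2 * m)) x)]
      nth_rw 1 [← h2.1, ← h1.2]
      abel

lemma pos_iff (K : CEndo m M) (x : M) :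
    (∀ U : ℂ ⊗[ℝ] TangentSpace (𝓡 (2 * m)) x, U ≠ 0 →
      0 < (T.formC x U (conjC _ (K.toEnd x U))).re) ↔
    ∀ a b, (a ≠ 0 ∨ b ≠ 0) →
      0 < T.form x a (K.re x a - K.im x b) + T.form x b (K.re x b + K.im x a) := by
  have key : ∀ a b, (T.formC x (cvec a b) (conjC _ (K.toEnd x (cvec a b)))).re
      = T.form x a (K.re x a - K.im x b) + T.form x b (K.re x b + K.im x a) := by
    intro a b
    rw [toEnd_cvec, conjC_cvec, formC_cvec]
    simp
    ring
  constructor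
  · intro h a b hab
    rw [← key]
    refine h _ fun h0 => ?_
    rw [cvec_eq_zero_iff] at h0
    tauto
  · intro h U hU
    obtain ⟨a, b, rfl⟩ := exists_cvec U
    rw [key]
    refine h a b ?_
    by_contra hc
    push Not at hc
    exact hU ((cvec_eq_zero_iff a b).2 hc)

/-- The value `Q_{ij} = ω(K K_i, K_j)` has real part `ω(A K_i, K_j)`. -/
lemma Q_re (ξ : Module.Basis (Fin m) ℝ (Fin m → ℝ)) (K : CEndo m M) (i j : Fin m) (x : M) :
    (T.Q ξ K i j x).re = T.form x (K.re x (fundField (ξ i) x)) (fundField (ξ j) x) := by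
  have : ∀ v : TangentSpace (𝓡 (2 * m)) x, (1 : ℂ) ⊗ₜ[ℝ] v = cvec v 0 := fun v => by simp [cvec]
  simp only [Q, this, toEnd_cvec, formC_cvec]
  simp

end ToricStructure

/-- The trace of `K [R, K] L` for endomorphisms `K`, `L` that anticommute, with `K² = -1`. -/
lemma trace_commutator {W : Type*} [AddCommGroup W] [Module ℂ W] (r k k' : Module.End ℂ W)
    (hk : k * k = -1) (hk' : k' * k + k * k' = 0) :
    LinearMap.trace ℂ W (k * (r * k - k * r) * k') = 2 * LinearMap.trace ℂ W (r * k') := by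
  have e : k * (r * k - k * r) * k' = -(k * (r * k' * k)) + r * k' := by
    have h1 : k * k' = -(k' * k) := by rw [eq_neg_iff_add_eq_zero, add_comm]; exact hk'
    calc k * (r * k - k * r) * k' = k * r * (k * k') - (k * k) * r * k' := by noncomm_ring
      _ = -(k * (r * k' * k)) + r * k' := by rw [h1, hk]; noncomm_ring
  -- By cyclicity and `k² = -1`, the term `-k(rk'k)` has the same trace as `rk'`, which accounts for
  -- the factor 2.
  rw [e, map_add, map_neg, LinearMap.trace_mul_comm, mul_assoc, hk]
  simp
  ring

end Fields

/-! ### The exponential map of the torus -/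

section TorusExp

variable {m : ℕ}

@[simp] lemma torusExp_zero : torusExp (0 : Fin m → ℝ) = 1 := by
  ext i; simp [torusExp]

lemma torusExp_add (a b : Fin m → ℝ) : torusExp (a + b) = torusExp a * torusExp b := by
  ext i; simp [torusExp, Circle.exp_add]

lemma torusExp_neg (a : Fin m → ℝ) : torusExp (-a) = (torusExp a)⁻¹ := by
  rw [eq_inv_iff_mul_eq_one, ← torusExp_add]; simp

lemma torusExp_surjective : Function.Surjective (torusExp : (Fin m → ℝ) → Torus m) := fun t =>
  ⟨fun i => Complex.arg (t i), by funext i; exact Circle.exp_arg (t i)⟩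

end TorusExp

/-! ### The infinitesimal action -/

namespace ToricStructure

variable {m : ℕ} {M : Type*} [TopologicalSpace M] [ChartedSpace (Model m) M]
  [IsManifold (𝓡 (2 * m)) ∞ M] [MulAction (Torus m) M]

lemma contMDiff_smul (T : ToricStructure m M) (t : Torus m) : ContMDiff (𝓡 (2 * m))
    (𝓡 (2 * m)) ∞ (fun x : M => t • x) := by
  obtain ⟨θ, rfl⟩ := torusExp_surjective t
  exact T.smooth_action.comp (contMDiff_const.prodMk contMDiff_id)

lemma contMDiff_orbit (T : ToricStructure m M) (x : M) :
    ContMDiff 𝓘(ℝ, Fin m → ℝ) (𝓡 (2 * m)) ∞ (fun θ : Fin m → ℝ => torusExp θ • x) :=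
  T.smooth_action.comp (contMDiff_id.prodMk contMDiff_const)

/-- The infinitesimal action at `x` as a linear map `𝔱 → T_xM`. -/
def fundMap (x : M) : (Fin m → ℝ) →L[ℝ] TangentSpace (𝓡 (2 * m)) x :=
  mfderiv 𝓘(ℝ, Fin m → ℝ) (𝓡 (2 * m)) (fun θ : Fin m → ℝ => torusExp θ • x) 0

lemma mdifferentiableAt_orbit (T : ToricStructure m M) (x : M) (θ : Fin m → ℝ) :
    MDifferentiableAt 𝓘(ℝ, Fin m → ℝ) (𝓡 (2 * m)) (fun θ : Fin m → ℝ => torusExp θ • x) θ :=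
  (T.contMDiff_orbit x).mdifferentiable (by simp) θ

lemma mdifferentiableAt_smul (T : ToricStructure m M) (t : Torus m) (x : M) :
    MDifferentiableAt (𝓡 (2 * m)) (𝓡 (2 * m)) (fun x : M => t • x) x :=
  (T.contMDiff_smul t).mdifferentiable (by simp) x

lemma fundMap_apply (T : ToricStructure m M) (x : M) (ζ : Fin m → ℝ) :
    fundMap x ζ = fundField ζ x := by
  have h1 : HasMFDerivAt 𝓘(ℝ, ℝ) 𝓘(ℝ, Fin m → ℝ) (fun s : ℝ => s • ζ) 0
      ((1 : ℝ →L[ℝ] ℝ).smulRight ζ) :=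
    ((1 : ℝ →L[ℝ] ℝ).smulRight ζ).hasMFDerivAt
  have h2 := mfderiv_comp_of_eq (T.mdifferentiableAt_orbit x 0) h1.mdifferentiableAt (zero_smul ℝ ζ)
  have h3 := congrArg (fun A => A (1 : ℝ)) h2
  simp only [h1.mfderiv] at h3
  unfold fundField
  refine Eq.trans ?_ h3.symm
  change _ = (mfderiv 𝓘(ℝ, Fin m → ℝ) (𝓡 (2 * m)) (fun θ : Fin m → ℝ => torusExp θ • x)
    ((0 : ℝ) • ζ) : (Fin m → ℝ) →L[ℝ] Model m) ((1 : ℝ) • ζ)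
  rw [zero_smul, one_smul]
  rfl

lemma mfderiv_orbit (T : ToricStructure m M) (x : M) (θ η : Fin m → ℝ) :
    mfderiv 𝓘(ℝ, Fin m → ℝ) (𝓡 (2 * m)) (fun θ : Fin m → ℝ => torusExp θ • x) θ η
      = fundMap (torusExp θ • x) η := by
  have e : (fun θ' : Fin m → ℝ => torusExp θ' • x)
      = (fun θ' : Fin m → ℝ => torusExp θ' • (torusExp θ • x)) ∘ (fun θ' => θ' - θ) := by
    funext θ'
    simp only [Function.comp, smul_smul, ← torusExp_add, sub_add_cancel]
  have h1 : HasMFDerivAt 𝓘(ℝ, Fin m → ℝ) 𝓘(ℝ, Fin m → ℝ) (fun θ' : Fin m → ℝ => θ' - θ) θ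
      (ContinuousLinearMap.id ℝ _) := ((hasFDerivAt_id θ).sub_const θ).hasMFDerivAt
  have h2 := mfderiv_comp_of_eq (T.mdifferentiableAt_orbit (torusExp θ • x) 0)
    h1.mdifferentiableAt (sub_self θ)
  rw [← e, h1.mfderiv] at h2
  have h3 := congrArg (fun A => A η) h2
  refine h3.trans ?_
  change (mfderiv 𝓘(ℝ, Fin m → ℝ) (𝓡 (2 * m)) (fun θ' : Fin m → ℝ => torusExp θ' • (torusExp θ • x))
    (θ - θ) : (Fin m → ℝ) →L[ℝ] Model m) η = _
  rw [sub_self]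
  rfl

lemma tangentMap_smul_smul (T : ToricStructure m M) (s t : Torus m) (x : M)
    (v : TangentSpace (𝓡 (2 * m)) x) :
    tangentMapAt m (fun y : M => (s * t) • y) x v
      = tangentMapAt m (fun y : M => s • y) (t • x) (tangentMapAt m (fun y : M => t • y) x v) := by
  have e : (fun y : M => (s * t) • y) = (fun y : M => s • y) ∘ (fun y : M => t • y) := by
    funext y; simp [mul_smul]
  unfold tangentMapAt
  rw [e]
  exact mfderiv_comp_apply x (T.mdifferentiableAt_smul s _) (T.mdifferentiableAt_smul t x) v

lemma tangentMap_one (x : M) (v : TangentSpace (𝓡 (2 * m)) x) :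
    tangentMapAt m (fun y : M => (1 : Torus m) • y) x v = v := by
  have e : (fun y : M => (1 : Torus m) • y) = id := by funext y; simp
  unfold tangentMapAt
  rw [e]
  exact congrArg (fun A => A v) (mfderiv_id (I := 𝓡 (2 * m)) (x := x))

/-- Since the torus is abelian, translation by `t` commutes with `exp(θ)` and carries orbit curves
to orbit curves with the same generator. -/
lemma tangentMap_fundMap (T : ToricStructure m M) (t : Torus m) (x : M) (ζ : Fin m → ℝ) :
    tangentMapAt m (fun y : M => t • y) x (fundMap x ζ) = fundMap (t • x) ζ := by
  have e : (fun θ : Fin m → ℝ => torusExp θ • (t • x))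
      = (fun y : M => t • y) ∘ (fun θ : Fin m → ℝ => torusExp θ • x) := by
    funext θ
    simp only [Function.comp, smul_smul, mul_comm]
  have h0 : torusExp (0 : Fin m → ℝ) • x = x := by simp
  have h := mfderiv_comp_of_eq (T.mdifferentiableAt_smul t x) (T.mdifferentiableAt_orbit x 0) h0
  rw [← e] at h
  have h3 := congrArg (fun A => A ζ) h
  refine Eq.trans ?_ h3.symm
  change _ = (mfderiv (𝓡 (2 * m)) (𝓡 (2 * m)) (fun y : M => t • y) (torusExp (0 : Fin m → ℝ) • x) :
    Model m →L[ℝ] Model m) _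
  rw [h0]
  rfl

/-- The differential of a moving torus element acting on a moving point. -/
lemma hasMFDerivAt_moving (T : ToricStructure m M) {E N : Type*} [NormedAddCommGroup E]
    [NormedSpace ℝ E] {H : Type*}
    [TopologicalSpace H] {I : ModelWithCorners ℝ E H} [TopologicalSpace N] [ChartedSpace H N]
    {F : N → Fin m → ℝ} {b : N → M} {n : N}
    {F' : TangentSpace I n →L[ℝ] (Fin m → ℝ)}
    {b' : TangentSpace I n →L[ℝ] TangentSpace (𝓡 (2 * m)) (b n)}
    (hF : HasMFDerivAt I 𝓘(ℝ, Fin m → ℝ) F n F') (hb : HasMFDerivAt I (𝓡 (2 * m)) b n b') :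
    HasMFDerivAt I (𝓡 (2 * m)) (fun y => torusExp (F y) • b y) n
      (fundMap (torusExp (F n) • b n) ∘L F'
        + tangentMapAt m (fun y : M => torusExp (F n) • y) (b n) ∘L b') := by
  have hact : MDifferentiableAt (𝓘(ℝ, Fin m → ℝ).prod (𝓡 (2 * m))) (𝓡 (2 * m))
      (fun p : (Fin m → ℝ) × M => torusExp p.1 • p.2) (F n, b n) :=
    T.smooth_action.mdifferentiable (by simp) _
  have h := hact.hasMFDerivAt.comp n (hF.prodMk hb)
  have key : ∀ v : TangentSpace I n,
      (fundMap (torusExp (F n) • b n) ∘L F'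
        + tangentMapAt m (fun y : M => torusExp (F n) • y) (b n) ∘L b') v
      = (mfderiv (𝓘(ℝ, Fin m → ℝ).prod (𝓡 (2 * m))) (𝓡 (2 * m))
          (fun p : (Fin m → ℝ) × M => torusExp p.1 • p.2) (F n, b n) ∘L F'.prod b') v := by
    intro v
    refine Eq.trans ?_ (mfderiv_prod_eq_add_apply hact
      (v := ((F' v, b' v) : (Fin m → ℝ) × Model m))).symm
    exact congrArg₂ (fun a b : Model m => a + b) (T.mfderiv_orbit (b n) (F n) (F' v)).symm rfl
  rw [ContinuousLinearMap.ext key]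
  exact h

end ToricStructure

/-! ### Invariant functions and the locally free locus -/

namespace ToricStructure

variable {m : ℕ} {M : Type*} [TopologicalSpace M] [ChartedSpace (Model m) M]
  [IsManifold (𝓡 (2 * m)) ∞ M] [MulAction (Torus m) M]

/-- `𝕋`-invariance of a function. -/
def InvFun (m : ℕ) {M : Type*} [MulAction (Torus m) M] {α : Type*} (u : M → α) : Prop :=
  ∀ (t : Torus m) (x : M), u (t • x) = u x

lemma dif_smul (T : ToricStructure m M) {u : M → ℝ} {x : M} (t : Torus m)
    (hu : ∀ᶠ y in 𝓝 x, u (t • y) = u y)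
    (hd : MDifferentiableAt (𝓡 (2 * m)) 𝓘(ℝ, ℝ) u (t • x)) (v : TangentSpace (𝓡 (2 * m)) x) :
    dif m u (t • x) (tangentMapAt m (fun y : M => t • y) x v) = dif m u x v := by
  have := mfderiv_comp_apply x hd (T.mdifferentiableAt_smul t x) v
  have e : u ∘ (fun y : M => t • y) =ᶠ[𝓝 x] u := hu
  rw [e.mfderiv_eq] at this
  exact this.symm

lemma dif_fundMap (T : ToricStructure m M) {u : M → ℝ} {x : M}
    (hu : ∀ t : Torus m, u (t • x) = u x) (hd : MDifferentiableAt (𝓡 (2 * m)) 𝓘(ℝ, ℝ) u x) (ζ : Fin m → ℝ) :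
    dif m u x (fundMap x ζ) = 0 := by
  have h0 : torusExp (0 : Fin m → ℝ) • x = x := by simp
  have h := mfderiv_comp_of_eq hd (T.mdifferentiableAt_orbit x 0) h0
  rw [show u ∘ (fun θ : Fin m → ℝ => torusExp θ • x) = fun _ => u x from
    funext fun y => hu _] at h
  have h3 := congrArg (fun A => A ζ) h
  have h4 : (mfderiv 𝓘(ℝ, Fin m → ℝ) 𝓘(ℝ, ℝ) (fun _ : Fin m → ℝ => u x) 0) ζ = (0 : ℝ) :=
    congrArg (fun A : (Fin m → ℝ) →L[ℝ] ℝ => A ζ)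
      (mfderiv_const (I := 𝓘(ℝ, Fin m → ℝ)) (I' := 𝓘(ℝ, ℝ)) (c := u x) (x := (0 : Fin m → ℝ)))
  refine Eq.trans ?_ (h3.symm.trans h4)
  change _ = (mfderiv (𝓡 (2 * m)) 𝓘(ℝ, ℝ) u (torusExp (0 : Fin m → ℝ) • x) :
    Model m →L[ℝ] ℝ) _
  rw [h0]
  rfl

lemma form_fundMap (T : ToricStructure m M) (ζ : Fin m → ℝ) (x : M)
    (v : TangentSpace (𝓡 (2 * m)) x) :
    T.form x (fundMap x ζ) v = -dif m (fun y => T.mom y ζ) x v := by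
  rw [T.fundMap_apply, T.mom_hamiltonian]

lemma mdifferentiableAt_mom (T : ToricStructure m M) (ζ : Fin m → ℝ) (x : M) :
    MDifferentiableAt (𝓡 (2 * m)) 𝓘(ℝ, ℝ) (fun y => T.mom y ζ) x :=
  (T.mom_smooth ζ).mdifferentiable (by simp) x

lemma invFun_mom (T : ToricStructure m M) (ζ : Fin m → ℝ) : InvFun m (fun y => T.mom y ζ) :=
  fun t x => by
  simp [T.mom_invariant]

/-- Orbits are isotropic because the moment map is constant on them. This kills the terms quadratic
in `R` in all later computations with `ω`. -/
lemma form_fundMap_fundMap (T : ToricStructure m M) (ζ η : Fin m → ℝ) (x : M) :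
    T.form x (fundMap x ζ) (fundMap x η) = 0 := by
  rw [T.form_fundMap, T.dif_fundMap (fun t => T.invFun_mom ζ t x) (T.mdifferentiableAt_mom ζ x), neg_zero]

/-- Read off from `ω(K_ζ, ·) = -dμ^ζ` and smoothness of the moment map, rather than from the action
map. -/
lemma smoothVFAt_fundMap (T : ToricStructure m M) (ζ : Fin m → ℝ) (x₀ : M) :
    SmoothVFAt (fun x => fundMap x ζ) x₀ := by
  refine T.smoothVFAt_of_form fun v => ?_
  refine (SmoothVFAt.dif (T.mom_smooth ζ x₀) (smoothVFAt_tcs x₀ v)).neg.congr_of_eventuallyEq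
    (.of_forall fun x => T.form_fundMap ζ x _)

lemma isMIntegralCurve_orbit (T : ToricStructure m M) (ζ : Fin m → ℝ) (x : M) :
    IsMIntegralCurve (I := 𝓡 (2 * m)) (fun s : ℝ => torusExp (s • ζ) • x)
      (fun y => fundMap y ζ) := by
  intro s
  have h1 : HasMFDerivAt 𝓘(ℝ, ℝ) 𝓘(ℝ, Fin m → ℝ) (fun s : ℝ => s • ζ) s
      ((1 : ℝ →L[ℝ] ℝ).smulRight ζ) := ((1 : ℝ →L[ℝ] ℝ).smulRight ζ).hasMFDerivAt
  have h2 := T.hasMFDerivAt_moving h1 (hasMFDerivAt_const (I' := 𝓡 (2 * m)) x s)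
  refine h2.congr_mfderiv (ContinuousLinearMap.ext fun (r : ℝ) => ?_)
  change fundMap (torusExp (s • ζ) • x) (r • ζ) + tangentMapAt m _ x 0
    = r • fundMap (torusExp (s • ζ) • x) ζ
  rw [map_zero, add_zero, map_smul]

/-- The set of points at which the action is locally free. -/
def locFree (m : ℕ) (M : Type*) [TopologicalSpace M] [ChartedSpace (Model m) M]
    [MulAction (Torus m) M] : Set M := {x | Function.Injective (fundMap (m := m) x)}

lemma torusExp_smul_eq_one {ζ : Fin m → ℝ} (h : ∀ s : ℝ, torusExp (s • ζ) = 1) : ζ = 0 := by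
  funext i
  by_contra hi
  -- At this time the `i`-th angle equals `π`, which is not a multiple of `2π`.
  have := congrFun (h (Real.pi / ζ i)) i
  simp only [torusExp, Pi.smul_apply, smul_eq_mul, Pi.one_apply] at this
  rw [div_mul_cancel₀ _ hi, Circle.exp_eq_one] at this
  obtain ⟨n, hn⟩ := this
  have hpi := Real.pi_pos
  have h2 : (1 : ℝ) = n * 2 := by
    have : Real.pi * 1 = Real.pi * (n * 2) := by linarith
    exact mul_left_cancel₀ hpi.ne' this
  have h3 : (1 : ℤ) = n * 2 := by exact_mod_cast h2
  omega

/-- If `K_ζ` vanishes at `x`, the constant curve and `s ↦ exp(sζ) • x` are integral curves with the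
same initial point. Uniqueness puts the one-parameter group in the stabilizer. The locally free
locus replaces the free one in the analysis because its openness is plain linear independence. -/
lemma freeLocus_subset_locFree (T : ToricStructure m M) [T2Space M] :
    freeLocus m M ⊆ locFree m M := by
  intro x hx
  refine (injective_iff_map_eq_zero (fundMap x)).2 fun ζ hζ => ?_
  have h1 := T.isMIntegralCurve_orbit ζ x
  have h2 : IsMIntegralCurve (I := 𝓡 (2 * m)) (fun _ : ℝ => x) (fun y => fundMap y ζ) := by
    intro s
    refine (hasMFDerivAt_const (I' := 𝓡 (2 * m)) x s).congr_mfderiv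
      (ContinuousLinearMap.ext fun (r : ℝ) => ?_)
    change (0 : TangentSpace (𝓡 (2 * m)) x) = r • fundMap x ζ
    rw [hζ, smul_zero]
  have hv : ContMDiff (𝓡 (2 * m)) (𝓡 (2 * m)).tangent 1
      (fun x => (⟨x, fundMap x ζ⟩ : TangentBundle (𝓡 (2 * m)) M)) :=
    fun x => (T.smoothVFAt_fundMap ζ x).of_le (by simp)
  have h3 := isMIntegralCurve_Ioo_eq_of_contMDiff_boundaryless (t₀ := 0) hv h1 h2 (by simp)
  exact torusExp_smul_eq_one fun s => hx _ (congrFun h3 s)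

lemma smul_mem_locFree_iff (T : ToricStructure m M) (t : Torus m) (x : M) :
    t • x ∈ locFree m M ↔ x ∈ locFree m M := by
  have key : ∀ (t : Torus m) (x : M), t • x ∈ locFree m M → x ∈ locFree m M := by
    intro t x h a b hab
    apply h
    rw [← T.tangentMap_fundMap, ← T.tangentMap_fundMap, hab]
  refine ⟨key t x, fun h => key t⁻¹ _ ?_⟩
  rwa [inv_smul_smul]

lemma isOpen_locFree (T : ToricStructure m M) : IsOpen (locFree m M) := by
  rw [isOpen_iff_mem_nhds]
  intro x₀ hx₀
  let b := Pi.basisFun ℝ (Fin m)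
  have hc : ContinuousAt (fun x => fun i => tc x₀ x (fundMap x (b i))) x₀ :=
    continuousAt_pi.2 fun i => ((smoothVFAt_iff _ _).1 (T.smoothVFAt_fundMap (b i) x₀)).continuousAt
  have hmem : x₀ ∈ (chartAt (Model m) x₀).source := mem_chart_source _ x₀
  have h0 : LinearIndependent ℝ (fun i => tc x₀ x₀ (fundMap x₀ (b i))) := by
    have := b.linearIndependent.map' ((tcEquiv hmem).toLinearMap ∘ₗ (fundMap x₀).toLinearMap)
      (LinearMap.ker_eq_bot.2 ((tcEquiv hmem).injective.comp hx₀))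
    exact this
  filter_upwards [hc.eventually h0.eventually, source_nhds (m := m) x₀] with x hx hs
  refine (injective_iff_map_eq_zero (fundMap x)).2 fun ζ hζ => ?_
  have : ∑ i, ζ i • tc x₀ x (fundMap x (b i)) = 0 := by
    rw [← map_zero (tc x₀ x), ← hζ]
    conv_rhs => rw [← b.sum_repr ζ]
    simp only [map_sum, map_smul]
    rfl
  exact funext (Fintype.linearIndependent_iff.1 hx ζ this)

end ToricStructure

/-! ### Smoothness of the inverse matrix, by Cramer's rule -/

section MatrixInverse

variable {N : Type*} [TopologicalSpace N] {E H : Type*}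
  [NormedAddCommGroup E] [NormedSpace ℝ E] [TopologicalSpace H] [ChartedSpace H N]
  {I : ModelWithCorners ℝ E H} {n : ℕ}

lemma contMDiffAt_det {G : N → Matrix (Fin n) (Fin n) ℝ} {x₀ : N}
    (h : ∀ i j, ContMDiffAt I 𝓘(ℝ, ℝ) ∞ (fun x => G x i j) x₀) :
    ContMDiffAt I 𝓘(ℝ, ℝ) ∞ (fun x => (G x).det) x₀ := by
  simp only [Matrix.det_apply']
  exact contMDiffAt_finsetSum fun σ _ => contMDiffAt_const.mul
    (contMDiffAt_finsetProd fun i _ => h _ _)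

lemma contMDiffAt_matrix_inv {G : N → Matrix (Fin n) (Fin n) ℝ} {x₀ : N}
    (h : ∀ i j, ContMDiffAt I 𝓘(ℝ, ℝ) ∞ (fun x => G x i j) x₀) (h0 : (G x₀).det ≠ 0)
    (i j : Fin n) : ContMDiffAt I 𝓘(ℝ, ℝ) ∞ (fun x => (G x)⁻¹ i j) x₀ := by
  have e : (fun x => (G x)⁻¹ i j)
      = fun x => (G x).det⁻¹ * ((G x).updateRow j (Pi.single i 1)).det := by
    funext x
    rw [Matrix.inv_def, Matrix.smul_apply, Matrix.adjugate_apply, Ring.inverse_eq_inv',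
      smul_eq_mul]
  rw [e]
  refine ContMDiffAt.mul ?_ (contMDiffAt_det fun k l => ?_)
  · exact ((contDiffAt_inv ℝ h0).contMDiffAt).comp x₀ (contMDiffAt_det h)
  · simp only [Matrix.updateRow_apply]
    split_ifs
    · exact contMDiffAt_const
    · exact h k l

end MatrixInverse

namespace ToricStructure

variable {m : ℕ} {M : Type*} [TopologicalSpace M] [ChartedSpace (Model m) M]
  [IsManifold (𝓡 (2 * m)) ∞ M] [MulAction (Torus m) M]

/-! ### Derivatives along the moment coordinates -/

section MomentCoordinates

/-- The differential of the moment map in the coordinates given by `ξ`. -/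
def dmu (T : ToricStructure m M) (ξ : Module.Basis (Fin m) ℝ (Fin m → ℝ)) (x : M) :
    TangentSpace (𝓡 (2 * m)) x →L[ℝ] (Fin m → ℝ) :=
  ContinuousLinearMap.pi fun i => dif m (fun y => T.momCoord ξ y i) x

variable (T : ToricStructure m M) (ξ : Module.Basis (Fin m) ℝ (Fin m → ℝ))

@[simp] lemma dmu_apply (x : M) (v : TangentSpace (𝓡 (2 * m)) x) (i : Fin m) :
    T.dmu ξ x v i = dif m (fun y => T.momCoord ξ y i) x v := rfl

lemma form_fundMap_basis (i : Fin m) (x : M) (v : TangentSpace (𝓡 (2 * m)) x) :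
    T.form x (fundMap x (ξ i)) v = -T.dmu ξ x v i := T.form_fundMap (ξ i) x v

lemma form_fundMap_sum (ζ : Fin m → ℝ) (x : M) (v : TangentSpace (𝓡 (2 * m)) x) :
    T.form x (fundMap x ζ) v = -∑ i, ξ.repr ζ i * T.dmu ξ x v i := by
  conv_lhs => rw [← ξ.sum_repr ζ]
  simp only [map_sum, map_smul, sum_apply, smul_apply, smul_eq_mul,
    form_fundMap_basis, mul_neg, Finset.sum_neg_distrib]

/-- By duality: a functional `φ` vanishing on the image of `dμ` yields `∑ φ_i K_i` with zero
`ω`-pairing against every vector. This sum vanishes by nondegeneracy, and then `φ = 0` by local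
freeness. -/
lemma dmu_surjective {x : M} (hx : x ∈ locFree m M) : Function.Surjective (T.dmu ξ x) := by
  have : Function.Injective (T.dmu ξ x).toLinearMap.dualMap := by
    rw [injective_iff_map_eq_zero]
    intro φ hφ
    have h0 : fundMap x (∑ i, φ (Pi.single i 1) • ξ i) = 0 := by
      refine T.nondegenerate x _ fun w => ?_
      rw [T.form_fundMap_sum ξ, neg_eq_zero]
      have h1 : φ (T.dmu ξ x w) = 0 := LinearMap.congr_fun hφ w
      rw [← h1]
      conv_rhs => rw [← (Pi.basisFun ℝ (Fin m)).sum_repr (T.dmu ξ x w), map_sum]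
      refine Finset.sum_congr rfl fun i _ => ?_
      simp [Finsupp.single_apply, mul_comm]
    have h2 : ∑ i, φ (Pi.single i 1) • ξ i = 0 := hx (by rw [h0, map_zero])
    have h3 := Fintype.linearIndependent_iff.1 ξ.linearIndependent _ h2
    refine (Pi.basisFun ℝ (Fin m)).ext fun i => ?_
    simpa using h3 i
  exact LinearMap.dualMap_injective_iff.1 this

lemma dmu_fundMap (x : M) (ζ : Fin m → ℝ) : T.dmu ξ x (fundMap x ζ) = 0 := by
  funext i
  exact T.dif_fundMap (fun t => T.invFun_mom (ξ i) t x) (T.mdifferentiableAt_mom (ξ i) x) ζ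

/-- The orbit tangent space lies in `ker dμ`, and both have dimension `m` since `dim M = 2m` and
`dμ` is onto. -/
lemma exists_fundMap_of_dmu_eq_zero {x : M} (hx : x ∈ locFree m M)
    {v : TangentSpace (𝓡 (2 * m)) x} (hv : T.dmu ξ x v = 0) : ∃ ζ : Fin m → ℝ, fundMap x ζ = v := by
  have hle : LinearMap.range (fundMap (m := m) x).toLinearMap ≤ LinearMap.ker (T.dmu ξ x).toLinearMap := by
    rintro _ ⟨ζ, rfl⟩
    exact T.dmu_fundMap ξ x ζ
  have h1 : Module.finrank ℝ (LinearMap.range (fundMap (m := m) x).toLinearMap) = m := by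
    rw [LinearMap.finrank_range_of_inj hx]; simp
  have h2 : Module.finrank ℝ (LinearMap.ker (T.dmu ξ x).toLinearMap) = m := by
    have h3 := LinearMap.finrank_range_add_finrank_ker (T.dmu ξ x).toLinearMap
    rw [LinearMap.range_eq_top.2 (T.dmu_surjective ξ hx), finrank_top, finrank_tangentSpace] at h3
    simp at h3
    omega
  have := Submodule.eq_of_le_of_finrank_eq hle (h1.trans h2.symm)
  have hv' : v ∈ LinearMap.ker (T.dmu ξ x).toLinearMap := hv
  rw [← this] at hv'
  exact hv'

lemma momFrame_spec {x : M} (hx : x ∈ locFree m M) (i : Fin m) :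
    T.dmu ξ x (T.momFrame ξ i x) = Pi.single i 1 := by
  obtain ⟨v, hv⟩ := T.dmu_surjective ξ hx (Pi.single i 1)
  have h : ∀ j, dif m (fun y => T.momCoord ξ y j) x (T.momFrame ξ i x) = if j = i then 1 else 0 :=
    Classical.epsilon_spec (p := fun v : TangentSpace (𝓡 (2 * m)) x =>
      ∀ j, dif m (fun y => T.momCoord ξ y j) x v = if j = i then 1 else 0)
      ⟨v, fun j => by rw [← dmu_apply, hv, Pi.single_apply]⟩
  funext j
  rw [dmu_apply, h, Pi.single_apply]

/-- Subtracting from `v` its momentum components along `momFrame` leaves a vector tangent to the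
orbit, which `du` annihilates. -/
lemma dif_eq_sum {x : M} (hx : x ∈ locFree m M) {u : M → ℝ}
    (hu : ∀ t : Torus m, u (t • x) = u x) (hd : MDifferentiableAt (𝓡 (2 * m)) 𝓘(ℝ, ℝ) u x)
    (v : TangentSpace (𝓡 (2 * m)) x) :
    dif m u x v = ∑ i, T.momPartial ξ i u x * T.dmu ξ x v i := by
  have h0 : T.dmu ξ x (v - ∑ i, T.dmu ξ x v i • T.momFrame ξ i x) = 0 := by
    simp only [map_sub, map_sum, map_smul, T.momFrame_spec ξ hx]
    funext j
    simp [Pi.single_apply]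
  obtain ⟨ζ, hζ⟩ := T.exists_fundMap_of_dmu_eq_zero ξ hx h0
  have h1 := T.dif_fundMap hu hd ζ
  rw [hζ, map_sub, map_sum, sub_eq_zero] at h1
  rw [h1]
  simp [momPartial, mul_comm]

lemma dif_eq_momPartial {x : M} (hx : x ∈ locFree m M) {u : M → ℝ}
    (hu : ∀ t : Torus m, u (t • x) = u x) (hd : MDifferentiableAt (𝓡 (2 * m)) 𝓘(ℝ, ℝ) u x)
    {v : TangentSpace (𝓡 (2 * m)) x} {i : Fin m} (hv : T.dmu ξ x v = Pi.single i 1) :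
    dif m u x v = T.momPartial ξ i u x := by
  rw [T.dif_eq_sum ξ hx hu hd, hv]
  simp [Pi.single_apply]

/-- Smooth invariant functions on the locally free locus. -/
structure SmoothInv (m : ℕ) {M : Type*} [TopologicalSpace M] [ChartedSpace (Model m) M]
    [MulAction (Torus m) M] (u : M → ℝ) : Prop where
  smooth : ∀ x ∈ locFree m M, ContMDiffAt (𝓡 (2 * m)) 𝓘(ℝ, ℝ) ∞ u x
  inv : ∀ x ∈ locFree m M, ∀ t : Torus m, u (t • x) = u x

lemma SmoothInv.mdiff {u : M → ℝ} (hu : SmoothInv m u) {x : M} (hx : x ∈ locFree m M) :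
    MDifferentiableAt (𝓡 (2 * m)) 𝓘(ℝ, ℝ) u x := (hu.smooth x hx).mdifferentiableAt (by simp)

lemma contMDiffAt_momCoord (i : Fin m) (x₀ : M) :
    ContMDiffAt (𝓡 (2 * m)) 𝓘(ℝ, ℝ) ∞ (fun y => T.momCoord ξ y i) x₀ := T.mom_smooth (ξ i) x₀

lemma SmoothInv.momPartial {u : M → ℝ} (hu : SmoothInv m u) (j : Fin m) :
    SmoothInv m (T.momPartial ξ j u) := by
  refine ⟨fun x₀ hx₀ => ?_, fun x hx t => ?_⟩
  · have hmem : x₀ ∈ (chartAt (Model m) x₀).source := mem_chart_source _ x₀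
    -- `momFrame` is chosen pointwise and need not vary smoothly. Its coordinates are frozen at
    -- `x₀`, and the partial derivatives are recovered by inverting the matrix `G` of `dμ` on this
    -- frozen frame, which is the identity at `x₀`.
    let a : Fin m → Model m := fun l => tc x₀ x₀ (T.momFrame ξ l x₀)
    let G : M → Matrix (Fin m) (Fin m) ℝ := fun x => Matrix.of fun k l =>
      T.dmu ξ x (tcs x₀ x (a l)) k
    have hG : ∀ k l, ContMDiffAt (𝓡 (2 * m)) 𝓘(ℝ, ℝ) ∞ (fun x => G x k l) x₀ := fun k l =>
      SmoothVFAt.dif (T.contMDiffAt_momCoord ξ k x₀) (smoothVFAt_tcs x₀ (a l))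
    have hG0 : G x₀ = 1 := by
      ext k l
      change T.dmu ξ x₀ (tcs x₀ x₀ (tc x₀ x₀ (T.momFrame ξ l x₀))) k = _
      rw [tcs_tc hmem, T.momFrame_spec ξ hx₀, Matrix.one_apply, Pi.single_apply]
    have hdet : (G x₀).det ≠ 0 := by rw [hG0]; simp
    have hev : ∀ᶠ x in 𝓝 x₀, (G x).det ≠ 0 := (contMDiffAt_det hG).continuousAt.eventually_ne hdet
    have hsm : ContMDiffAt (𝓡 (2 * m)) 𝓘(ℝ, ℝ) ∞
        (fun x => ∑ l, dif m u x (tcs x₀ x (a l)) * (G x)⁻¹ l j) x₀ :=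
      contMDiffAt_finsetSum fun l _ => (SmoothVFAt.dif (hu.smooth x₀ hx₀)
        (smoothVFAt_tcs x₀ (a l))).mul (contMDiffAt_matrix_inv hG hdet l j)
    refine hsm.congr_of_eventuallyEq ?_
    filter_upwards [hev, T.isOpen_locFree.mem_nhds hx₀] with x hx hxL
    have h1 : ∀ l, dif m u x (tcs x₀ x (a l)) = ∑ k, T.momPartial ξ k u x * G x k l := fun l =>
      T.dif_eq_sum ξ hxL (hu.inv x hxL) (hu.mdiff hxL) _
    have h2 : ∑ l, (∑ k, T.momPartial ξ k u x * G x k l) * (G x)⁻¹ l j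
        = ∑ k, T.momPartial ξ k u x * (G x * (G x)⁻¹) k j := by
      simp only [Finset.sum_mul, Matrix.mul_apply, Finset.mul_sum]
      rw [Finset.sum_comm]
      simp only [mul_assoc]
    simp only [h1]
    rw [h2, Matrix.mul_nonsing_inv _ (isUnit_iff_ne_zero.2 hx)]
    simp [Matrix.one_apply]
  · have htx : t • x ∈ locFree m M := (T.smul_mem_locFree_iff t x).2 hx
    have hnhds : ∀ᶠ y in 𝓝 x, y ∈ locFree m M := T.isOpen_locFree.mem_nhds hx
    have h1 : T.dmu ξ (t • x) (tangentMapAt m (fun y : M => t • y) x (T.momFrame ξ j x))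
        = Pi.single j 1 := by
      rw [← T.momFrame_spec ξ hx j]
      funext i
      exact T.dif_smul t (.of_forall fun y => T.invFun_mom (ξ i) t y)
        (T.mdifferentiableAt_mom (ξ i) _) _
    rw [← T.dif_eq_momPartial ξ htx (fun s => hu.inv _ htx s) (hu.mdiff htx) h1,
      T.dif_smul t (hnhds.mono fun y hy => hu.inv y hy t) (hu.mdiff htx)]
    rfl

/-- Smooth invariant functions with support in the locally free locus. -/
structure Adm (m : ℕ) {M : Type*} [TopologicalSpace M] [ChartedSpace (Model m) M]
    [MulAction (Torus m) M] (f : M → ℝ) : Prop where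
  smooth : ContMDiff (𝓡 (2 * m)) 𝓘(ℝ, ℝ) ∞ f
  inv : InvFun m f
  supp : tsupport f ⊆ locFree m M

lemma Adm.smoothInv {f : M → ℝ} (hf : Adm m f) : SmoothInv m f :=
  ⟨fun x _ => hf.smooth x, fun x _ t => hf.inv t x⟩

lemma dif_eq_zero_of_notMem {f : M → ℝ} {x : M} (hx : x ∉ tsupport f) : dif m f x = 0 := by
  have h : f =ᶠ[𝓝 x] fun _ => 0 := notMem_tsupport_iff_eventuallyEq.1 hx
  unfold dif
  rw [h.mfderiv_eq]
  exact mfderiv_const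

lemma momPartial_eq_zero_of_notMem {f : M → ℝ} {x : M} (hx : x ∉ tsupport f) (i : Fin m) :
    T.momPartial ξ i f x = 0 := by
  rw [ToricStructure.momPartial, dif_eq_zero_of_notMem hx]; rfl

lemma tsupport_momPartial_subset (f : M → ℝ) (i : Fin m) :
    tsupport (T.momPartial ξ i f) ⊆ tsupport f := by
  refine closure_minimal (fun x hx => ?_) (isClosed_tsupport f)
  by_contra h
  exact hx (T.momPartial_eq_zero_of_notMem ξ h i)

lemma Adm.smul_mem_tsupport (T : ToricStructure m M) {f : M → ℝ} (hf : Adm m f) (t : Torus m)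
    {x : M}
    (hx : t • x ∈ tsupport f) : x ∈ tsupport f := by
  by_contra h
  rw [notMem_tsupport_iff_eventuallyEq] at h
  have hc : Tendsto (fun y : M => t⁻¹ • y) (𝓝 (t • x)) (𝓝 x) := by
    have := (T.contMDiff_smul t⁻¹).continuous.tendsto (t • x)
    rwa [inv_smul_smul] at this
  refine (notMem_tsupport_iff_eventuallyEq.2 ?_) hx
  filter_upwards [hc.eventually h] with y hy
  exact (hf.inv t⁻¹ y).symm.trans hy

lemma Adm.momPartial {f : M → ℝ} (hf : Adm m f) (i : Fin m) : Adm m (T.momPartial ξ i f) := by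
  have hs := SmoothInv.momPartial T ξ hf.smoothInv i
  refine ⟨fun x => ?_, fun t x => ?_, (T.tsupport_momPartial_subset ξ f i).trans hf.supp⟩
  · by_cases hx : x ∈ tsupport f
    · exact hs.smooth x (hf.supp hx)
    · refine (contMDiffAt_const (c := (0 : ℝ))).congr_of_eventuallyEq ?_
      filter_upwards [(isClosed_tsupport f).isOpen_compl.mem_nhds hx] with y hy
      exact T.momPartial_eq_zero_of_notMem ξ hy i
  · by_cases hx : x ∈ tsupport f
    · exact hs.inv x (hf.supp hx) t
    · have hx' : t • x ∉ tsupport f := fun h => hx (hf.smul_mem_tsupport T t h)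
      rw [T.momPartial_eq_zero_of_notMem ξ hx, T.momPartial_eq_zero_of_notMem ξ hx']

lemma Adm.dif_eq_sum {f : M → ℝ} (hf : Adm m f) (x : M) (v : TangentSpace (𝓡 (2 * m)) x) :
    dif m f x v = ∑ i, T.momPartial ξ i f x * T.dmu ξ x v i := by
  by_cases hx : x ∈ tsupport f
  · exact T.dif_eq_sum ξ (hf.supp hx) (fun t => hf.inv t x) (hf.smooth.mdifferentiable (by simp) x) v
  · simp [T.momPartial_eq_zero_of_notMem ξ hx, dif_eq_zero_of_notMem hx]

/-- The `𝔱`-valued function whose infinitesimal action is the hamiltonian field of `f`. -/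
def tgrad (f : M → ℝ) (x : M) : Fin m → ℝ := ∑ i, T.momPartial ξ i f x • ξ i

/-- Both fields pair with `ω` to `-df`, as `df = ∑ (∂f/∂μ^k) dμ^k`. Hamiltonian motion thus becomes
motion along orbits. -/
lemma Adm.symplGrad_eq {f : M → ℝ} (hf : Adm m f) (x : M) :
    T.symplGrad f x = fundMap x (T.tgrad ξ f x) := by
  refine T.form_ext fun w => ?_
  rw [T.form_symplGrad, T.form_fundMap_sum ξ, hf.dif_eq_sum T ξ]
  simp [tgrad, Finsupp.single_apply]

end MomentCoordinates

end ToricStructure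

/-! ### The identity `d(df) = 0` in a chart -/

section Closed

variable {m : ℕ} {M : Type*} [TopologicalSpace M] [ChartedSpace (Model m) M]
  [IsManifold (𝓡 (2 * m)) ∞ M]

lemma contMDiffOn_chart_symm' (x₀ : M) : ContMDiffOn 𝓘(ℝ, Model m) (𝓡 (2 * m)) ∞
    (chartAt (Model m) x₀).symm (chartAt (Model m) x₀).target := contMDiffOn_chart_symm

lemma contMDiffAt_chart_symm (x₀ : M) {y : Model m} (hy : y ∈ (chartAt (Model m) x₀).target) :
    ContMDiffAt 𝓘(ℝ, Model m) (𝓡 (2 * m)) ∞ (chartAt (Model m) x₀).symm y :=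
  (contMDiffOn_chart_symm' x₀).contMDiffAt ((chartAt (Model m) x₀).open_target.mem_nhds hy)

lemma contMDiffAt_chart {x₀ x : M} (hx : x ∈ (chartAt (Model m) x₀).source) :
    ContMDiffAt (𝓡 (2 * m)) 𝓘(ℝ, Model m) ∞ (chartAt (Model m) x₀) x :=
  (contMDiffOn_chart (I := 𝓡 (2 * m))).contMDiffAt
    ((chartAt (Model m) x₀).open_source.mem_nhds hx)

/-- A function read in the chart at `x₀`. -/
lemma contDiffAt_chart_symm {f : M → ℝ} {x₀ : M} {y : Model m}
    (hy : y ∈ (chartAt (Model m) x₀).target)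
    (hf : ContMDiffAt (𝓡 (2 * m)) 𝓘(ℝ, ℝ) ∞ f ((chartAt (Model m) x₀).symm y)) :
    ContDiffAt ℝ ∞ (f ∘ (chartAt (Model m) x₀).symm) y :=
  (hf.comp y (contMDiffAt_chart_symm x₀ hy)).contDiffAt

lemma fderiv_chart_symm {f : M → ℝ} {x₀ : M} {y : Model m}
    (hy : y ∈ (chartAt (Model m) x₀).target)
    (hf : MDifferentiableAt (𝓡 (2 * m)) 𝓘(ℝ, ℝ) f ((chartAt (Model m) x₀).symm y)) (v : Model m) :
    fderiv ℝ (f ∘ (chartAt (Model m) x₀).symm) y v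
      = dif m f ((chartAt (Model m) x₀).symm y)
        (mfderiv 𝓘(ℝ, Model m) (𝓡 (2 * m)) (chartAt (Model m) x₀).symm y v) := by
  rw [← mfderiv_eq_fderiv]
  exact mfderiv_comp_apply y hf ((contMDiffAt_chart_symm x₀ hy).mdifferentiableAt (by simp)) v

lemma mfderiv_chart_symm_surjective {x₀ x : M} (hx : x ∈ (chartAt (Model m) x₀).source)
    (v : TangentSpace (𝓡 (2 * m)) x) :
    ∃ w : Model m, mfderiv 𝓘(ℝ, Model m) (𝓡 (2 * m)) (chartAt (Model m) x₀).symm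
      (chartAt (Model m) x₀ x) w = v := by
  have e : (chartAt (Model m) x₀).symm ∘ chartAt (Model m) x₀ =ᶠ[𝓝 x] id :=
    (chartAt (Model m) x₀).eventually_left_inverse hx
  have h1 := mfderiv_comp x
    ((contMDiffAt_chart_symm x₀ ((chartAt (Model m) x₀).map_source hx)).mdifferentiableAt (by simp))
    ((contMDiffAt_chart hx).mdifferentiableAt (by simp))
  rw [e.mfderiv_eq, mfderiv_id] at h1
  exact ⟨mfderiv (𝓡 (2 * m)) 𝓘(ℝ, Model m) (chartAt (Model m) x₀) x v,
    (congrArg (fun A : Model m →L[ℝ] Model m => A v) h1).symm⟩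

/-- If `df = ∑ g_i dh_i`, then `∑ dg_i ∧ dh_i = 0`. -/
lemma sum_dif_wedge_symm {ι : Type*} [Fintype ι] {f : M → ℝ} {g h : ι → M → ℝ}
    (hf : ContMDiff (𝓡 (2 * m)) 𝓘(ℝ, ℝ) ∞ f)
    (hg : ∀ i, ContMDiff (𝓡 (2 * m)) 𝓘(ℝ, ℝ) ∞ (g i))
    (hh : ∀ i, ContMDiff (𝓡 (2 * m)) 𝓘(ℝ, ℝ) ∞ (h i))
    (hd : ∀ x v, dif m f x v = ∑ i, g i x * dif m (h i) x v) (x : M)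
    (v w : TangentSpace (𝓡 (2 * m)) x) :
    ∑ i, dif m (g i) x v * dif m (h i) x w = ∑ i, dif m (g i) x w * dif m (h i) x v := by
  set c := chartAt (Model m) x with hc
  have hx : x ∈ c.source := mem_chart_source _ x
  have hy : c x ∈ c.target := c.map_source hx
  have hxx : c.symm (c x) = x := c.left_inv hx
  obtain ⟨v', hv'⟩ := mfderiv_chart_symm_surjective hx v
  obtain ⟨w', hw'⟩ := mfderiv_chart_symm_surjective hx w
  have md : ∀ {u : M → ℝ}, ContMDiff (𝓡 (2 * m)) 𝓘(ℝ, ℝ) ∞ u → ∀ z,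
      MDifferentiableAt (𝓡 (2 * m)) 𝓘(ℝ, ℝ) u z := fun hu z => hu.mdifferentiable (by simp) z
  have hat : ∀ {u : M → ℝ}, ContMDiff (𝓡 (2 * m)) 𝓘(ℝ, ℝ) ∞ u → ∀ a : Model m,
      fderiv ℝ (u ∘ c.symm) (c x) a
        = dif m u x (mfderiv 𝓘(ℝ, Model m) (𝓡 (2 * m)) c.symm (c x) a) := by
    intro u hu a
    have := fderiv_chart_symm hy (md hu _) a
    rw [this]
    change (dif m u (c.symm (c x)) : Model m →L[ℝ] ℝ) _ = (dif m u x : Model m →L[ℝ] ℝ) _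
    rw [hxx]
  have cd : ∀ {u : M → ℝ}, ContMDiff (𝓡 (2 * m)) 𝓘(ℝ, ℝ) ∞ u →
      ContDiffAt ℝ ∞ (u ∘ c.symm) (c x) := fun hu => contDiffAt_chart_symm hy (hu _)
  have cdf : ∀ {u : M → ℝ}, ContMDiff (𝓡 (2 * m)) 𝓘(ℝ, ℝ) ∞ u →
      DifferentiableAt ℝ (fderiv ℝ (u ∘ c.symm)) (c x) := fun hu =>
    ((cd hu).fderiv_right (m := ∞) (by simp)).differentiableAt (by simp)
  have symm2 : ∀ {u : M → ℝ}, ContMDiff (𝓡 (2 * m)) 𝓘(ℝ, ℝ) ∞ u → ∀ a b : Model m,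
      fderiv ℝ (fderiv ℝ (u ∘ c.symm)) (c x) a b = fderiv ℝ (fderiv ℝ (u ∘ c.symm)) (c x) b a :=
    fun hu a b => ((cd hu).isSymmSndFDerivAt (by simp; exact WithTop.coe_le_coe.2 (le_top : (2 : ℕ∞) ≤ ⊤))) a b
  have heq : fderiv ℝ (f ∘ c.symm) =ᶠ[𝓝 (c x)]
      fun y => ∑ i, (g i ∘ c.symm) y • fderiv ℝ (h i ∘ c.symm) y := by
    filter_upwards [c.open_target.mem_nhds hy] with y hyt
    ext a
    rw [fderiv_chart_symm hyt (md hf _), hd]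
    simp only [sum_apply, smul_apply, smul_eq_mul]
    refine Finset.sum_congr rfl fun i _ => ?_
    rw [fderiv_chart_symm hyt (md (hh i) _)]
    rfl
  have hder : ∀ a b : Model m, fderiv ℝ (fderiv ℝ (f ∘ c.symm)) (c x) a b
      = ∑ i, ((g i ∘ c.symm) (c x) * fderiv ℝ (fderiv ℝ (h i ∘ c.symm)) (c x) a b
        + fderiv ℝ (g i ∘ c.symm) (c x) a * fderiv ℝ (h i ∘ c.symm) (c x) b) := by
    intro a b
    have H : HasFDerivAt (fun y => ∑ i, (g i ∘ c.symm) y • fderiv ℝ (h i ∘ c.symm) y) _ (c x) :=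
      HasFDerivAt.fun_sum fun i (_ : i ∈ Finset.univ) =>
        (((cd (hg i)).differentiableAt (by simp)).hasFDerivAt).fun_smul (cdf (hh i)).hasFDerivAt
    rw [heq.fderiv_eq, H.fderiv]
    simp
  -- Antisymmetrizing in the two directions cancels the second derivatives of `f` and of the `h_i`,
  -- leaving only the products of first derivatives.
  have h1 := hder v' w'
  rw [symm2 hf, hder w' v'] at h1
  simp only [Finset.sum_add_distrib, symm2 (hh _) w' v', add_right_inj] at h1
  have ev : ∀ {u : M → ℝ}, ContMDiff (𝓡 (2 * m)) 𝓘(ℝ, ℝ) ∞ u →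
      fderiv ℝ (u ∘ c.symm) (c x) v' = dif m u x v := fun hu =>
    (hat hu v').trans (congrArg (dif m _ x) hv')
  have ew : ∀ {u : M → ℝ}, ContMDiff (𝓡 (2 * m)) 𝓘(ℝ, ℝ) ∞ u →
      fderiv ℝ (u ∘ c.symm) (c x) w' = dif m u x w := fun hu =>
    (hat hu w').trans (congrArg (dif m _ x) hw')
  simp only [ev (hg _), ev (hh _), ew (hg _), ew (hh _)] at h1
  exact h1.symm

end Closed

namespace ToricStructure

variable {m : ℕ} {M : Type*} [TopologicalSpace M] [ChartedSpace (Model m) M]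
  [IsManifold (𝓡 (2 * m)) ∞ M] [MulAction (Torus m) M]

/-! ### Invariant endomorphism fields and push-forward -/

section Invariance

/-- `𝕋`-invariance of a section of `End(TM)`. -/
def EndInv
    (A : (x : M) → TangentSpace (𝓡 (2 * m)) x →L[ℝ] TangentSpace (𝓡 (2 * m)) x) : Prop :=
  ∀ (t : Torus m) (x : M) (v : TangentSpace (𝓡 (2 * m)) x),
    A (t • x) (tangentMapAt m (fun y : M => t • y) x v)
      = tangentMapAt m (fun y : M => t • y) x (A x v)

/-- The push-forward of a section of `End(TM)`. -/
def pushEnd (φ : Equiv.Perm M)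
    (A : (x : M) → TangentSpace (𝓡 (2 * m)) x →L[ℝ] TangentSpace (𝓡 (2 * m)) x) (x : M) :
    TangentSpace (𝓡 (2 * m)) x →L[ℝ] TangentSpace (𝓡 (2 * m)) x :=
  (tangentMapAt m φ (φ.symm x)) ∘L A (φ.symm x) ∘L (tangentMapAt m φ.symm x)

lemma push_eq_iff (φ : Equiv.Perm M) (K L : CEndo m M) : CEndo.push φ K = L ↔
    (∀ x, pushEnd φ K.re x = L.re x) ∧ (∀ x, pushEnd φ K.im x = L.im x) := by
  rw [CEndo.ext_iff, funext_iff, funext_iff]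
  rfl

lemma tangentMap_inv_smul (T : ToricStructure m M) (t : Torus m) (x : M)
    (v : TangentSpace (𝓡 (2 * m)) x) :
    tangentMapAt m (fun y : M => t⁻¹ • y) (t • x) (tangentMapAt m (fun y : M => t • y) x v)
      = (v : Model m) := by
  rw [← T.tangentMap_smul_smul, inv_mul_cancel]
  exact tangentMap_one x v

lemma tangentMap_smul_inv (T : ToricStructure m M) (t : Torus m) (x : M)
    (v : TangentSpace (𝓡 (2 * m)) x) :
    tangentMapAt m (fun y : M => t • y) (t⁻¹ • x) (tangentMapAt m (fun y : M => t⁻¹ • y) x v)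
      = (v : Model m) := by
  rw [← T.tangentMap_smul_smul, mul_inv_cancel]
  exact tangentMap_one x v

lemma endInv_iff_pushEnd (T : ToricStructure m M)
    (A : (x : M) → TangentSpace (𝓡 (2 * m)) x →L[ℝ] TangentSpace (𝓡 (2 * m)) x) :
    EndInv A ↔ ∀ (t : Torus m) (x : M), pushEnd (MulAction.toPerm t) A x = A x := by
  constructor
  · intro h t x
    ext v : 1
    change tangentMapAt m (fun y : M => t • y) (t⁻¹ • x)
      (A (t⁻¹ • x) (tangentMapAt m (fun y : M => t⁻¹ • y) x v)) = _
    rw [h t⁻¹ x v]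
    exact T.tangentMap_smul_inv t x (A x v)
  · intro h t x v
    have key : ∀ y : M, y = t • x → ∀ w : Model m, (A (t⁻¹ • y) : Model m →L[ℝ] Model m) w
        = (A x : Model m →L[ℝ] Model m) w := by
      rintro y rfl w
      rw [inv_smul_smul]
    have h1 : tangentMapAt m (fun y : M => t • y) (t⁻¹ • t • x)
      (A (t⁻¹ • t • x) (tangentMapAt m (fun y : M => t⁻¹ • y) (t • x)
        (tangentMapAt m (fun y : M => t • y) x v))) = A (t • x) _ :=
      congrArg (fun B : Model m →L[ℝ] Model m => B (tangentMapAt m (fun y : M => t • y) x v))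
        (h t (t • x))
    rw [← h1]
    rw [T.tangentMap_inv_smul t x v]
    change (tangentMapAt m (fun y : M => t • y) (t⁻¹ • t • x) : Model m →L[ℝ] Model m)
      ((A (t⁻¹ • t • x) : Model m →L[ℝ] Model m) v) = _
    rw [inv_smul_smul]

lemma invariant_iff (T : ToricStructure m M) (K : CEndo m M) :
    K.Invariant ↔ EndInv K.re ∧ EndInv K.im := by
  unfold CEndo.Invariant
  simp only [push_eq_iff, T.endInv_iff_pushEnd, forall_and]

end Invariance

/-! ### Twists `x ↦ exp(F(x)) • x` and their differentials -/

section Twist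

variable (T : ToricStructure m M)

/-- The endomorphism `R = ∑ K_i ⊗ dF_i` attached to a `𝔱`-valued function `F`. -/
def twistEnd (F : M → Fin m → ℝ) (x : M) :
    TangentSpace (𝓡 (2 * m)) x →L[ℝ] TangentSpace (𝓡 (2 * m)) x :=
  fundMap x ∘L ContinuousLinearMap.pi fun i => dif m (fun y => F y i) x

/-- Smooth invariant `𝔱`-valued functions `F` for which `x ↦ exp(F(x)) • x` is symplectic. -/
structure Twist (F : M → Fin m → ℝ) : Prop where
  smooth : ∀ i, ContMDiff (𝓡 (2 * m)) 𝓘(ℝ, ℝ) ∞ (fun y => F y i)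
  inv : InvFun m F
  symm : ∀ x v w, T.form x (twistEnd F x v) w = T.form x (twistEnd F x w) v

/-- The permutation `x ↦ exp(F(x)) • x`. -/
def twistPerm (F : M → Fin m → ℝ) (hF : InvFun m F) : Equiv.Perm M where
  toFun x := torusExp (F x) • x
  invFun x := torusExp (-F x) • x
  left_inv x := by beta_reduce; rw [hF (torusExp (F x)) x, smul_smul, ← torusExp_add]; simp
  right_inv x := by beta_reduce; rw [hF (torusExp (-F x)) x, smul_smul, ← torusExp_add]; simp

variable {T} {F : M → Fin m → ℝ}

lemma hasMFDerivAt_pi (hF : ∀ i, ContMDiff (𝓡 (2 * m)) 𝓘(ℝ, ℝ) ∞ (fun y => F y i)) (x : M) :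
    HasMFDerivAt (𝓡 (2 * m)) 𝓘(ℝ, Fin m → ℝ) F x
      (ContinuousLinearMap.pi fun i => dif m (fun y => F y i) x) := by
  have hs : ContMDiff (𝓡 (2 * m)) 𝓘(ℝ, Fin m → ℝ) ∞ F := contMDiff_pi_space.2 hF
  have h1 := (hs.mdifferentiable (by simp) x).hasMFDerivAt
  refine h1.congr_mfderiv ?_
  refine ContinuousLinearMap.ext fun v => funext fun i => ?_
  have h2 := ((ContinuousLinearMap.proj (R := ℝ) (φ := fun _ : Fin m => ℝ) i).hasMFDerivAt
    (x := F x)).comp x h1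
  exact (congrArg (fun B : Model m →L[ℝ] ℝ => B v) h2.mfderiv).symm

/-- With `t = exp(F(x))`, variation of the point contributes `t_*` and variation of the torus
element contributes the fundamental vector of `dF` at `t • x`. The latter is `t_* ∘ R`, because
fundamental fields are invariant. -/
lemma hasMFDerivAt_twist (T : ToricStructure m M)
    (hF : ∀ i, ContMDiff (𝓡 (2 * m)) 𝓘(ℝ, ℝ) ∞ (fun y => F y i)) (x : M) :
    HasMFDerivAt (𝓡 (2 * m)) (𝓡 (2 * m)) (fun y => torusExp (F y) • y) x
      (tangentMapAt m (fun y : M => torusExp (F x) • y) x ∘L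
        (ContinuousLinearMap.id ℝ _ + twistEnd F x)) := by
  refine (T.hasMFDerivAt_moving (hasMFDerivAt_pi hF x)
    (hasMFDerivAt_id (I := 𝓡 (2 * m)) x)).congr_mfderiv (ContinuousLinearMap.ext fun v => ?_)
  change fundMap (torusExp (F x) • x) _ + tangentMapAt m _ x v
    = tangentMapAt m (fun y : M => torusExp (F x) • y) x (v + twistEnd F x v)
  rw [map_add, add_comm]
  congr 1
  exact (T.tangentMap_fundMap _ _ _).symm

lemma dif_apply_fundMap (T : ToricStructure m M)
    (hF : ∀ i, ContMDiff (𝓡 (2 * m)) 𝓘(ℝ, ℝ) ∞ (fun y => F y i)) (hi : InvFun m F) (i : Fin m)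
    (x : M) (ζ : Fin m → ℝ) : dif m (fun y => F y i) x (fundMap x ζ) = 0 :=
  T.dif_fundMap (fun t => by rw [hi]) ((hF i).mdifferentiable (by simp) x) ζ

/-- `F` is constant along orbits. As `R` takes values in the orbit directions, this also gives `R² =
0`, and the product of any two such endomorphisms vanishes. -/
lemma twistEnd_fundMap (T : ToricStructure m M)
    (hF : ∀ i, ContMDiff (𝓡 (2 * m)) 𝓘(ℝ, ℝ) ∞ (fun y => F y i)) (hi : InvFun m F) (x : M)
    (ζ : Fin m → ℝ) : twistEnd F x (fundMap x ζ) = 0 := by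
  have : (ContinuousLinearMap.pi fun i => dif m (fun y => F y i) x) (fundMap x ζ) = 0 := by
    funext i
    exact dif_apply_fundMap T hF hi i x ζ
  simp only [twistEnd, ContinuousLinearMap.comp_apply, this, map_zero]

lemma twistEnd_twistEnd (T : ToricStructure m M)
    (hF : ∀ i, ContMDiff (𝓡 (2 * m)) 𝓘(ℝ, ℝ) ∞ (fun y => F y i)) (hi : InvFun m F) (x : M)
    (v : TangentSpace (𝓡 (2 * m)) x) : twistEnd F x (twistEnd F x v) = 0 :=
  twistEnd_fundMap T hF hi x _

lemma endInv_twistEnd (T : ToricStructure m M)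
    (hF : ∀ i, ContMDiff (𝓡 (2 * m)) 𝓘(ℝ, ℝ) ∞ (fun y => F y i)) (hi : InvFun m F) :
    EndInv (twistEnd F) := by
  intro t x v
  simp only [twistEnd, ContinuousLinearMap.comp_apply, T.tangentMap_fundMap]
  congr 1
  funext i
  exact T.dif_smul t (.of_forall fun y => by rw [hi]) ((hF i).mdifferentiable (by simp) _) v

lemma smoothEndAt_twistEnd (T : ToricStructure m M)
    (hF : ∀ i, ContMDiff (𝓡 (2 * m)) 𝓘(ℝ, ℝ) ∞ (fun y => F y i)) (x₀ : M) :
    SmoothEndAt (twistEnd F) x₀ := by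
  refine SmoothEndAt.of_apply fun v => ?_
  have : (fun x => twistEnd F x (tcs x₀ x v)) = fun x =>
      ∑ i, dif m (fun y => F y i) x (tcs x₀ x v) • fundMap x (Pi.single i 1) := by
    funext x
    simp only [twistEnd, ContinuousLinearMap.comp_apply]
    conv_lhs => rw [pi_eq_sum_univ' ((ContinuousLinearMap.pi fun i => dif m (fun y => F y i) x)
      (tcs x₀ x v)), map_sum]
    simp
  rw [this]
  exact SmoothVFAt.sum _ fun i _ => SmoothVFAt.smul
    (SmoothVFAt.dif (hF i x₀) (smoothVFAt_tcs x₀ v)) (T.smoothVFAt_fundMap _ x₀)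

lemma twistEnd_neg (x : M)
    (hF : ∀ i, ContMDiff (𝓡 (2 * m)) 𝓘(ℝ, ℝ) ∞ (fun y => F y i)) :
    twistEnd (fun y => -F y) x = -twistEnd F x := by
  have : ∀ i, dif m (fun y => (-F y) i) x = -dif m (fun y => F y i) x := fun i =>
    ((hF i).mdifferentiable (by simp) x).hasMFDerivAt.neg.mfderiv
  ext v : 1
  simp only [twistEnd, ContinuousLinearMap.comp_apply, neg_apply, ← map_neg]
  congr 1
  funext i
  exact (congrArg (fun B : Model m →L[ℝ] ℝ => B v) (this i)).trans
    (map_neg (dif m (fun y => F y i) x) v).symm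

lemma twistEnd_add {G : M → Fin m → ℝ} (x : M)
    (hF : ∀ i, ContMDiff (𝓡 (2 * m)) 𝓘(ℝ, ℝ) ∞ (fun y => F y i))
    (hG : ∀ i, ContMDiff (𝓡 (2 * m)) 𝓘(ℝ, ℝ) ∞ (fun y => G y i)) :
    twistEnd (fun y => F y + G y) x = twistEnd F x + twistEnd G x := by
  have : ∀ i, dif m (fun y => (F y + G y) i) x = dif m (fun y => F y i) x + dif m (fun y => G y i) x :=
    fun i => (((hF i).mdifferentiable (by simp) x).hasMFDerivAt.add
      ((hG i).mdifferentiable (by simp) x).hasMFDerivAt).mfderiv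
  ext v : 1
  simp only [twistEnd, ContinuousLinearMap.comp_apply, add_apply, ← map_add]
  congr 1
  funext i
  exact congrArg (fun B : Model m →L[ℝ] ℝ => B v) (this i)

lemma twistEnd_smul (c : ℝ) (x : M)
    (hF : ∀ i, ContMDiff (𝓡 (2 * m)) 𝓘(ℝ, ℝ) ∞ (fun y => F y i)) :
    twistEnd (fun y => c • F y) x = c • twistEnd F x := by
  have : ∀ i, dif m (fun y => (c • F y) i) x = c • dif m (fun y => F y i) x := fun i =>
    (((hF i).mdifferentiable (by simp) x).hasMFDerivAt.const_smul c).mfderiv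
  ext v : 1
  simp only [twistEnd, ContinuousLinearMap.comp_apply, smul_apply, ← map_smul]
  congr 1
  funext i
  exact (congrArg (fun B : Model m →L[ℝ] ℝ => B v) (this i)).trans
    (map_smul (dif m (fun y => F y i) x) c v).symm

/-- The push-forward of an invariant section of `End(TM)` by `x ↦ exp(F(x)) • x`. -/
lemma pushEnd_twistPerm (T : ToricStructure m M)
    (hF : ∀ i, ContMDiff (𝓡 (2 * m)) 𝓘(ℝ, ℝ) ∞ (fun y => F y i)) (hi : InvFun m F)
    {A : (x : M) → TangentSpace (𝓡 (2 * m)) x →L[ℝ] TangentSpace (𝓡 (2 * m)) x}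
    (hA : EndInv A) (y : M) :
    pushEnd (twistPerm F hi) A y = (ContinuousLinearMap.id ℝ _ + twistEnd F y) ∘L A y ∘L
      (ContinuousLinearMap.id ℝ _ - twistEnd F y) := by
  ext w : 1
  set t := torusExp (F y) with ht
  have hFn : ∀ i, ContMDiff (𝓡 (2 * m)) 𝓘(ℝ, ℝ) ∞ (fun z => (-F z) i) := fun i => (hF i).neg
  have hs : torusExp (-F y) = t⁻¹ := torusExp_neg _
  have h1 : tangentMapAt m (twistPerm F hi).symm y w
      = tangentMapAt m (fun z : M => t⁻¹ • z) y (w - twistEnd F y w) := by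
    have := (hasMFDerivAt_twist T hFn y).mfderiv
    refine (congrArg (fun B : Model m →L[ℝ] Model m => B w) this).trans ?_
    rw [hs, twistEnd_neg y hF, sub_eq_add_neg]
    rfl
  have h2 : ∀ u : TangentSpace (𝓡 (2 * m)) (t⁻¹ • y), tangentMapAt m (twistPerm F hi) (t⁻¹ • y) u
      = (tangentMapAt m (fun z : M => t • z) (t⁻¹ • y) (u + twistEnd F (t⁻¹ • y) u) : Model m) := by
    intro u
    have := (hasMFDerivAt_twist T hF (t⁻¹ • y)).mfderiv
    refine (congrArg (fun B : Model m →L[ℝ] Model m => B u) this).trans ?_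
    rw [hi, ← ht]
    rfl
  have hp : (twistPerm F hi).symm y = t⁻¹ • y := by rw [← hs]; rfl
  have hgoal : pushEnd (twistPerm F hi) A y w = (tangentMapAt m (twistPerm F hi) (t⁻¹ • y) :
      Model m →L[ℝ] Model m) ((A (t⁻¹ • y) : Model m →L[ℝ] Model m)
        (tangentMapAt m (twistPerm F hi).symm y w)) := by
    rw [← hp]; rfl
  rw [hgoal, h1]
  -- Invariance of `A` and of `R` moves both past the translation by `t⁻¹`, which then cancels
  -- against the one by `t`.
  have h3 := hA t⁻¹ y (w - twistEnd F y w)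
  have h4 := endInv_twistEnd T hF hi t⁻¹ y (A y (w - twistEnd F y w))
  refine (congrArg (tangentMapAt m (twistPerm F hi) (t⁻¹ • y) : Model m →L[ℝ] Model m) h3).trans ?_
  refine (h2 _).trans ?_
  rw [h4, ← map_add]
  exact T.tangentMap_smul_inv t y _

end Twist

end ToricStructure

namespace ToricStructure

variable {m : ℕ} {M : Type*} [TopologicalSpace M] [ChartedSpace (Model m) M]
  [IsManifold (𝓡 (2 * m)) ∞ M] [MulAction (Torus m) M]

/-! ### The group of twists acting by conjugation with `1 + R` -/

section TwistGroup

variable {T : ToricStructure m M} {F G : M → Fin m → ℝ}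

/-- Invariance gives `F(exp(G(x)) • x) = F(x)`, so composing twists adds the exponents. -/
lemma twistPerm_mul (hF : InvFun m F) (hG : InvFun m G) (hFG : InvFun m (fun x => F x + G x)) :
    twistPerm F hF * twistPerm G hG = twistPerm (fun x => F x + G x) hFG := by
  ext x
  change torusExp (F (torusExp (G x) • x)) • torusExp (G x) • x = torusExp (F x + G x) • x
  rw [hF, smul_smul, torusExp_add]

lemma twistPerm_inv (hF : InvFun m F) (hF' : InvFun m (fun x => -F x)) :
    (twistPerm F hF)⁻¹ = twistPerm (fun x => -F x) hF' := by
  ext x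
  rfl

lemma InvFun.neg (hF : InvFun m F) : InvFun m (fun x => -F x) := fun t x => by simp only [hF t x]

lemma InvFun.add (hF : InvFun m F) (hG : InvFun m G) : InvFun m (fun x => F x + G x) :=
  fun t x => by simp only [hF t x, hG t x]

lemma InvFun.const_smul (c : ℝ) (hF : InvFun m F) : InvFun m (fun x => c • F x) :=
  fun t x => by simp only [hF t x]

lemma Twist.add (hF : T.Twist F) (hG : T.Twist G) : T.Twist (fun x => F x + G x) := by
  refine ⟨fun i => (hF.smooth i).add (hG.smooth i), hF.inv.add hG.inv, fun x v w => ?_⟩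
  simp only [twistEnd_add x hF.smooth hG.smooth, add_apply, map_add, hF.symm x v w, hG.symm x v w]

lemma Twist.neg (hF : T.Twist F) : T.Twist (fun x => -F x) := by
  refine ⟨fun i => (hF.smooth i).neg, hF.inv.neg, fun x v w => ?_⟩
  simp only [twistEnd_neg x hF.smooth, neg_apply, map_neg, hF.symm x v w]

lemma Twist.const_smul (c : ℝ) (hF : T.Twist F) : T.Twist (fun x => c • F x) := by
  refine ⟨fun i => contMDiff_const.mul (hF.smooth i), hF.inv.const_smul c, fun x v w => ?_⟩
  simp only [twistEnd_smul c x hF.smooth, smul_apply, map_smul, hF.symm x v w]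

lemma Twist.form_twistEnd (hF : T.Twist F) (x : M) (v w : TangentSpace (𝓡 (2 * m)) x) :
    T.form x (twistEnd F x v) w = -T.form x v (twistEnd F x w) := by
  rw [hF.symm, T.skew]

/-- The cross terms cancel because `R` is `ω`-skew, and the quadratic term vanishes because orbits
are isotropic. -/
lemma Twist.form_conj (hF : T.Twist F) (x : M) (v w : TangentSpace (𝓡 (2 * m)) x) :
    T.form x (v + twistEnd F x v) (w + twistEnd F x w) = T.form x v w := by
  have : T.form x (twistEnd F x v) (twistEnd F x w) = 0 := T.form_fundMap_fundMap _ _ x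
  simp only [map_add, add_apply, this, hF.form_twistEnd x v w]
  ring

lemma Twist.sq (hF : T.Twist F) (x : M) (v : TangentSpace (𝓡 (2 * m)) x) :
    twistEnd F x (twistEnd F x v) = 0 := twistEnd_twistEnd T hF.smooth hF.inv x v

/-- The conjugate `(1 + R) K (1 - R)`, `R = ∑ K_i ⊗ dF_i`. -/
def twistConj (F : M → Fin m → ℝ)
    (A : (x : M) → TangentSpace (𝓡 (2 * m)) x →L[ℝ] TangentSpace (𝓡 (2 * m)) x) (x : M) :
    TangentSpace (𝓡 (2 * m)) x →L[ℝ] TangentSpace (𝓡 (2 * m)) x :=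
  (ContinuousLinearMap.id ℝ _ + twistEnd F x) ∘L A x ∘L
      (ContinuousLinearMap.id ℝ _ - twistEnd F x)

lemma twistConj_apply
    (A : (x : M) → TangentSpace (𝓡 (2 * m)) x →L[ℝ] TangentSpace (𝓡 (2 * m)) x) (x : M)
    (v : TangentSpace (𝓡 (2 * m)) x) :
    twistConj F A x v = A x (v - twistEnd F x v) + twistEnd F x (A x (v - twistEnd F x v)) := rfl

lemma push_twistPerm (hF : T.Twist F) {K : CEndo m M} (hK : K.Invariant) :
    CEndo.push (twistPerm F hF.inv) K = ⟨twistConj F K.re, twistConj F K.im⟩ := by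
  rw [T.invariant_iff] at hK
  rw [push_eq_iff]
  exact ⟨fun x => pushEnd_twistPerm T hF.smooth hF.inv hK.1 x,
    fun x => pushEnd_twistPerm T hF.smooth hF.inv hK.2 x⟩

/-- The inverse `1 - R` of `1 + R`. -/
lemma Twist.sub_apply (hF : T.Twist F) (x : M) (u : TangentSpace (𝓡 (2 * m)) x) :
    (u + twistEnd F x u) - twistEnd F x (u + twistEnd F x u) = u := by
  rw [map_add, hF.sq, add_zero, add_sub_cancel_right]

lemma Twist.add_apply' (hF : T.Twist F) (x : M) (u : TangentSpace (𝓡 (2 * m)) x) :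
    (u - twistEnd F x u) + twistEnd F x (u - twistEnd F x u) = u := by
  rw [map_sub, hF.sq, sub_zero, sub_add_cancel]

lemma Twist.twistConj_comp (hF : T.Twist F)
    (A B : (x : M) → TangentSpace (𝓡 (2 * m)) x →L[ℝ] TangentSpace (𝓡 (2 * m)) x) (x : M)
    (v : TangentSpace (𝓡 (2 * m)) x) :
    twistConj F A x (twistConj F B x v) = twistConj F (fun y => A y ∘L B y) x v := by
  rw [twistConj_apply B, twistConj_apply A, hF.sub_apply]
  rfl

lemma Twist.smooth_twistConj (hF : T.Twist F)
    {A : (x : M) → TangentSpace (𝓡 (2 * m)) x →L[ℝ] TangentSpace (𝓡 (2 * m)) x}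
    (hA : SmoothEnd A) : SmoothEnd (twistConj F A) := fun x =>
  (smoothEndAt_id.add (smoothEndAt_twistEnd T hF.smooth x)).comp
    (SmoothEndAt.comp (hA x) (smoothEndAt_id.sub (smoothEndAt_twistEnd T hF.smooth x)))

lemma EndInv.comp {A B : (x : M) → TangentSpace (𝓡 (2 * m)) x →L[ℝ] TangentSpace (𝓡 (2 * m)) x}
    (hA : EndInv A) (hB : EndInv B) : EndInv (fun x => A x ∘L B x) := fun t x v => by
  simp only [ContinuousLinearMap.comp_apply, hB t x v, hA t x]

lemma EndInv.add {A B : (x : M) → TangentSpace (𝓡 (2 * m)) x →L[ℝ] TangentSpace (𝓡 (2 * m)) x}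
    (hA : EndInv A) (hB : EndInv B) : EndInv (fun x => A x + B x) := fun t x v => by
  simp only [add_apply, hB t x v, hA t x v, map_add]

lemma EndInv.sub {A B : (x : M) → TangentSpace (𝓡 (2 * m)) x →L[ℝ] TangentSpace (𝓡 (2 * m)) x}
    (hA : EndInv A) (hB : EndInv B) : EndInv (fun x => A x - B x) := fun t x v => by
  simp only [sub_apply, hB t x v, hA t x v, map_sub]

lemma endInv_id :
    EndInv (fun x : M => ContinuousLinearMap.id ℝ (TangentSpace (𝓡 (2 * m)) x)) :=
  fun _ _ _ => rfl

lemma Twist.endInv_twistConj (hF : T.Twist F)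
    {A : (x : M) → TangentSpace (𝓡 (2 * m)) x →L[ℝ] TangentSpace (𝓡 (2 * m)) x}
    (hA : EndInv A) : EndInv (twistConj F A) :=
  (endInv_id.add (endInv_twistEnd T hF.smooth hF.inv)).comp
    (hA.comp (endInv_id.sub (endInv_twistEnd T hF.smooth hF.inv)))

lemma Twist.form_twistConj_left (hF : T.Twist F)
    (A : (x : M) → TangentSpace (𝓡 (2 * m)) x →L[ℝ] TangentSpace (𝓡 (2 * m)) x) (x : M)
    (v w : TangentSpace (𝓡 (2 * m)) x) :
    T.form x (twistConj F A x v) w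
      = T.form x (A x (v - twistEnd F x v)) (w - twistEnd F x w) := by
  rw [twistConj_apply]
  conv_lhs => rw [← hF.add_apply' x w]
  rw [hF.form_conj]

lemma Twist.form_twistConj_right (hF : T.Twist F)
    (A : (x : M) → TangentSpace (𝓡 (2 * m)) x →L[ℝ] TangentSpace (𝓡 (2 * m)) x) (x : M)
    (v w : TangentSpace (𝓡 (2 * m)) x) :
    T.form x v (twistConj F A x w)
      = T.form x (v - twistEnd F x v) (A x (w - twistEnd F x w)) := by
  rw [T.skew, hF.form_twistConj_left, ← T.skew]

lemma Twist.conjSkew (hF : T.Twist F) {K : CEndo m M} (hK : T.ConjSkew K) :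
    T.ConjSkew ⟨twistConj F K.re, twistConj F K.im⟩ := by
  rw [conjSkew_iff] at *
  refine ⟨fun x v w => ?_, fun x v w => ?_⟩
  · rw [hF.form_twistConj_left, hF.form_twistConj_right, hK.1]
  · rw [hF.form_twistConj_left, hF.form_twistConj_right, hK.2]

/-- Conjugation by the symplectic real automorphism `1 + R`, with inverse `1 - R`, respects each
algebraic condition; positivity at `(a, b)` becomes positivity of `K` at `((1 - R) a, (1 - R) b)`.
-/
lemma Twist.gak (hF : T.Twist F) {K : CEndo m M} (hK : T.GAK K) :
    T.GAK (CEndo.push (twistPerm F hF.inv) K) := by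
  rw [push_twistPerm hF hK.invariant]
  have hi := (T.invariant_iff K).1 hK.invariant
  refine ⟨⟨hF.smooth_twistConj hK.smooth.1, hF.smooth_twistConj hK.smooth.2⟩,
    (T.invariant_iff _).2 ⟨hF.endInv_twistConj hi.1, hF.endInv_twistConj hi.2⟩, fun x => ?_,
    hF.conjSkew hK.conjSkew, fun x => (T.pos_iff _ x).2 fun a b hab => ?_⟩
  · rw [toEnd_sq_iff]
    intro v
    have h := (toEnd_sq_iff K x).1 (hK.sq x) (v - twistEnd F x v)
    simp only [hF.twistConj_comp]
    simp only [twistConj_apply, ContinuousLinearMap.comp_apply]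
    constructor
    · rw [add_sub_add_comm, ← map_sub, h.1, map_neg, ← neg_add, hF.add_apply']
    · rw [add_add_add_comm, ← map_add, h.2, map_zero, add_zero]
  · have h := (T.pos_iff K x).1 (hK.pos x) (a - twistEnd F x a) (b - twistEnd F x b) (by
      contrapose! hab
      refine ⟨?_, ?_⟩
      · rw [← hF.add_apply' x a, hab.1, map_zero, add_zero]
      · rw [← hF.add_apply' x b, hab.2, map_zero, add_zero])
    simp only [map_sub, map_add, hF.form_twistConj_right] at h ⊢
    exact h

lemma Twist.gakTangent (hF : T.Twist F) {K K' : CEndo m M} (hK : T.GAK K)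
    (hK' : T.GAKTangent K K') :
    T.GAKTangent (CEndo.push (twistPerm F hF.inv) K) (CEndo.push (twistPerm F hF.inv) K') := by
  rw [push_twistPerm hF hK.invariant, push_twistPerm hF hK'.invariant]
  have hi := (T.invariant_iff K').1 hK'.invariant
  refine ⟨⟨hF.smooth_twistConj hK'.smooth.1, hF.smooth_twistConj hK'.smooth.2⟩,
    (T.invariant_iff _).2 ⟨hF.endInv_twistConj hi.1, hF.endInv_twistConj hi.2⟩,
    hF.conjSkew hK'.conjSkew, fun x => ?_⟩
  rw [toEnd_anticomm_iff]
  intro v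
  have h := (toEnd_anticomm_iff K K' x).1 (hK'.anticomm x) (v - twistEnd F x v)
  simp only [hF.twistConj_comp]
  simp only [twistConj_apply, ContinuousLinearMap.comp_apply]
  have e1 := congrArg (fun u => u + twistEnd F x u) h.1
  have e2 := congrArg (fun u => u + twistEnd F x u) h.2
  simp only [map_add (twistEnd F x), map_sub (twistEnd F x), map_zero, add_zero] at e1 e2
  constructor
  · rw [← e1]
    abel
  · rw [← e2]
    abel

lemma toEnd_twistConj (F : M → Fin m → ℝ) (K : CEndo m M) (x : M) :
    (⟨twistConj F K.re, twistConj F K.im⟩ : CEndo m M).toEnd x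
      = (1 + (twistEnd F x).toLinearMap.baseChange ℂ) * K.toEnd x
        * (1 - (twistEnd F x).toLinearMap.baseChange ℂ) := by
  ext v
  change _ = (1 + (twistEnd F x).toLinearMap.baseChange ℂ) (K.toEnd x
    ((1 - (twistEnd F x).toLinearMap.baseChange ℂ) ((1 : ℂ) ⊗ₜ[ℝ] v)))
  have : (1 : ℂ) ⊗ₜ[ℝ] v = cvec v 0 := by simp [cvec]
  change (CEndo.toEnd (⟨twistConj F K.re, twistConj F K.im⟩ : CEndo m M) x) ((1 : ℂ) ⊗ₜ[ℝ] v) = _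
  rw [this]
  simp only [LinearMap.add_apply, Module.End.one_apply, sub_eq_add_neg, toEnd_cvec, map_zero,
    neg_zero, add_zero, zero_add]
  simp [twistConj_apply, sub_eq_add_neg]
  have hb : ∀ a b, (LinearMap.baseChange ℂ (twistEnd F x).toLinearMap) (cvec a b)
      = cvec (twistEnd F x a) (twistEnd F x b) := fun a b => baseChange_cvec _ a b
  rw [hb, toEnd_cvec, toEnd_cvec, hb, hb]
  simp [cvec_add, neg_cvec]

lemma Twist.trace_twistConj (hF : T.Twist F) (K K₁ K₂ : CEndo m M) (x : M) :
    LinearMap.trace ℂ (ℂ ⊗[ℝ] TangentSpace (𝓡 (2 * m)) x)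
      ((⟨twistConj F K.re, twistConj F K.im⟩ : CEndo m M).toEnd x
        * (⟨twistConj F K₁.re, twistConj F K₁.im⟩ : CEndo m M).toEnd x
        * (⟨twistConj F K₂.re, twistConj F K₂.im⟩ : CEndo m M).toEnd x)
    = LinearMap.trace ℂ (ℂ ⊗[ℝ] TangentSpace (𝓡 (2 * m)) x)
      (K.toEnd x * K₁.toEnd x * K₂.toEnd x) := by
  simp only [toEnd_twistConj]
  set r := (twistEnd F x).toLinearMap.baseChange ℂ with hr
  have hrr : r * r = 0 := by
    rw [hr, Module.End.mul_eq_comp, ← LinearMap.baseChange_comp]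
    have : (twistEnd F x).toLinearMap ∘ₗ (twistEnd F x).toLinearMap = 0 :=
      LinearMap.ext fun v => hF.sq x v
    rw [this, LinearMap.baseChange_zero]
  have h1 : (1 - r) * (1 + r) = 1 := by
    have : (1 - r) * (1 + r) = 1 - r * r := by
      simp only [sub_mul, mul_add, mul_one, one_mul]
      abel
    rw [this, hrr, sub_zero]
  have h2 : (1 + r) * K.toEnd x * (1 - r) * ((1 + r) * K₁.toEnd x * (1 - r))
      * ((1 + r) * K₂.toEnd x * (1 - r))
      = (1 + r) * (K.toEnd x * ((1 - r) * (1 + r)) * K₁.toEnd x * ((1 - r) * (1 + r)) * K₂.toEnd x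
        * (1 - r)) := by noncomm_ring
  rw [h2, h1, LinearMap.trace_mul_comm]
  simp only [mul_one]
  rw [mul_assoc _ (1 - r) (1 + r), h1, mul_one]

/-- Moving `1 + R` across `ω` leaves `1 - R` on both arguments, and `R K_i = 0`. This is the reason
for equivariance of `ν`. -/
lemma Twist.Q_re_twistConj (hF : T.Twist F) (ξ : Module.Basis (Fin m) ℝ (Fin m → ℝ))
    (K : CEndo m M) (i j : Fin m) (x : M) :
    (T.Q ξ ⟨twistConj F K.re, twistConj F K.im⟩ i j x).re = (T.Q ξ K i j x).re := by
  simp only [Q_re, hF.form_twistConj_left, ← T.fundMap_apply,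
    twistEnd_fundMap T hF.smooth hF.inv, sub_zero]

end TwistGroup

/-! ### Hamiltonian flows are twists -/

section HamFlow

variable (T : ToricStructure m M) (ξ : Module.Basis (Fin m) ℝ (Fin m → ℝ))

lemma twistEnd_tgrad {f : M → ℝ} (hf : Adm m f) (x : M) (v : TangentSpace (𝓡 (2 * m)) x) :
    twistEnd (T.tgrad ξ f) x v = ∑ k, dif m (T.momPartial ξ k f) x v • fundMap x (ξ k) := by
  have h : ∀ i, dif m (fun y => T.tgrad ξ f y i) x
      = ∑ k, ξ k i • dif m (T.momPartial ξ k f) x := by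
    intro i
    have e : (fun y => T.tgrad ξ f y i) = ∑ k, ξ k i • T.momPartial ξ k f := by
      funext y
      simp [tgrad, mul_comm]
    rw [e]
    exact (HasMFDerivAt.sum fun k (_ : k ∈ Finset.univ) =>
      (((hf.momPartial T ξ k).smooth.mdifferentiable (by simp) x).hasMFDerivAt.const_smul
        (ξ k i))).mfderiv
  simp only [twistEnd, ContinuousLinearMap.comp_apply, ← map_smul, ← map_sum]
  congr 1
  funext i
  have := congrArg (fun B : Model m →L[ℝ] ℝ => B v) (h i)
  refine this.trans ?_
  have e := sum_apply Finset.univ (fun k => ξ k i • (dif m (T.momPartial ξ k f) x : Model m →L[ℝ] ℝ)) v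
  refine e.trans ?_
  simp [mul_comm]

lemma tgrad_smooth {f : M → ℝ} (hf : Adm m f) (i : Fin m) :
    ContMDiff (𝓡 (2 * m)) 𝓘(ℝ, ℝ) ∞ (fun y => T.tgrad ξ f y i) := by
  have e : (fun y => T.tgrad ξ f y i) = fun y => ∑ k, T.momPartial ξ k f y * ξ k i := by
    funext y
    simp [tgrad]
  rw [e]
  exact contMDiff_finsetSum fun k _ => (hf.momPartial T ξ k).smooth.mul contMDiff_const

/-- Here `ω(Rv, w) = -∑ d(∂f/∂μ^k)(v) dμ^k(w)`, and its symmetry in `v`, `w` is `d(df) = 0` applied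
to `df = ∑ (∂f/∂μ^k) dμ^k`. -/
lemma twist_tgrad {f : M → ℝ} (hf : Adm m f) : T.Twist (T.tgrad ξ f) := by
  refine ⟨T.tgrad_smooth ξ hf, fun t x => ?_, fun x v w => ?_⟩
  · simp only [tgrad, (hf.momPartial T ξ _).inv t x]
  · simp only [T.twistEnd_tgrad ξ hf, map_sum, map_smul, sum_apply, smul_apply, smul_eq_mul,
      T.form_fundMap_basis, mul_neg, Finset.sum_neg_distrib, neg_inj]
    exact sum_dif_wedge_symm hf.smooth (fun i => (hf.momPartial T ξ i).smooth)
      (fun i x => T.contMDiffAt_momCoord ξ i x) (hf.dif_eq_sum T ξ) x v w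

/-- The generator `F` keeps its value along the orbit, so the one-parameter curve of `F(x)` through
`x` stays tangent to `grad_ω f`. -/
lemma isHamFlow_twist {f : M → ℝ} (hf : Adm m f) :
    T.IsHamFlow f (fun s => twistPerm (fun x => s • T.tgrad ξ f x)
      ((T.twist_tgrad ξ hf).inv.const_smul s)) := by
  refine ⟨by ext x; simp [twistPerm], fun x s => ?_⟩
  have h := T.isMIntegralCurve_orbit (T.tgrad ξ f x) x s
  refine h.congr_mfderiv ?_
  have : T.symplGrad f (torusExp (s • T.tgrad ξ f x) • x)
      = fundMap (torusExp (s • T.tgrad ξ f x) • x) (T.tgrad ξ f x) := by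
    rw [hf.symplGrad_eq T ξ, (T.twist_tgrad ξ hf).inv]
  exact congrArg _ this.symm

/-- Uniqueness of integral curves. It is needed because the generators of `HamC` are given by an
arbitrary flow of `grad_ω f`. -/
lemma IsHamFlow.eq_twist [T2Space M] {f : M → ℝ} (hf : Adm m f) {Φ : ℝ → Equiv.Perm M}
    (hΦ : T.IsHamFlow f Φ) (s : ℝ) :
    Φ s = twistPerm (fun x => s • T.tgrad ξ f x) ((T.twist_tgrad ξ hf).inv.const_smul s) := by
  ext x
  have hv : ContMDiff (𝓡 (2 * m)) (𝓡 (2 * m)).tangent 1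
      (fun x => (⟨x, T.symplGrad f x⟩ : TangentBundle (𝓡 (2 * m)) M)) :=
    fun x => (T.symplGrad_smoothVFAt (hf.smooth x)).of_le (by simp)
  have h2 := T.isHamFlow_twist ξ hf
  have := isMIntegralCurve_Ioo_eq_of_contMDiff_boundaryless (t₀ := 0) hv (hΦ.2 x) (h2.2 x) (by
    rw [hΦ.1, h2.1])
  exact congrFun this s

lemma CompactZeroMean.adm [T2Space M] [MeasurableSpace M] {T : ToricStructure m M} {f : M → ℝ}
    (hf : T.CompactZeroMean f) : Adm m f :=
  ⟨hf.smooth, hf.invariant, hf.support.trans T.freeLocus_subset_locFree⟩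

/-- The generators are twists, and twists are closed under composition and inversion. Every
statement about the group is checked on twists through this lemma. -/
lemma exists_twist_of_mem_HamC [T2Space M] [MeasurableSpace M] {φ : Equiv.Perm M}
    (hφ : φ ∈ T.HamC) : ∃ F, ∃ hF : T.Twist F, φ = twistPerm F hF.inv := by
  let ξ := Pi.basisFun ℝ (Fin m)
  induction hφ using Subgroup.closure_induction with
  | mem φ h =>
    obtain ⟨f, Φ, hf, hΦ, rfl⟩ := h
    exact ⟨_, (T.twist_tgrad ξ hf.adm).const_smul 1, hΦ.eq_twist T ξ hf.adm 1⟩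
  | one =>
    refine ⟨fun _ => 0, ⟨fun i => contMDiff_const, fun t x => rfl, fun x v w => ?_⟩, ?_⟩
    · have : ∀ v, twistEnd (fun _ : M => (0 : Fin m → ℝ)) x v = 0 := by
        intro v
        have h0 : (ContinuousLinearMap.pi fun i => dif m (fun y => (0 : Fin m → ℝ) i) x) v = 0 := by
          funext i
          exact congrArg (fun B : Model m →L[ℝ] ℝ => B v)
            (mfderiv_const (I := 𝓡 (2 * m)) (I' := 𝓘(ℝ, ℝ)) (c := (0 : ℝ)) (x := x))
        simp only [twistEnd, ContinuousLinearMap.comp_apply, h0, map_zero]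
      simp only [this, map_zero, zero_apply]
    · ext x; simp [twistPerm]
  | mul φ ψ _ _ h1 h2 =>
    obtain ⟨F, hF, rfl⟩ := h1
    obtain ⟨G, hG, rfl⟩ := h2
    exact ⟨_, hF.add hG, twistPerm_mul _ _ _⟩
  | inv φ _ h1 =>
    obtain ⟨F, hF, rfl⟩ := h1
    exact ⟨_, hF.neg, twistPerm_inv _ _⟩

end HamFlow

end ToricStructure

/-! ### The top power of a two-form and its behaviour under linear maps -/

section Pfaffian

variable {m : ℕ} {V : Type*} [AddCommGroup V] [Module ℝ V]

/-- Each index lies in exactly one pair `(2k, 2k+1)`, so altering one vector affects a single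
factor; parity decides which of its two arguments. Multilinearity of the product follows. -/
lemma prod_pairs_update (g : V → V → ℝ) (v : Fin (2 * m) → V) (a : Fin (2 * m)) :
    ∃ c : ℝ, ∃ w : V,
      (∀ z, (∏ i : Fin m, g (Function.update v a z ⟨2 * i, by omega⟩)
        (Function.update v a z ⟨2 * i + 1, by omega⟩)) = g z w * c) ∨
      (∀ z, (∏ i : Fin m, g (Function.update v a z ⟨2 * i, by omega⟩)
        (Function.update v a z ⟨2 * i + 1, by omega⟩)) = g w z * c) := by
  obtain ⟨k, hk⟩ := Nat.even_or_odd' a.1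
  have hkm : k < m := by omega
  have hrest : ∀ z, ∏ i ∈ Finset.univ.erase (⟨k, hkm⟩ : Fin m),
      g (Function.update v a z ⟨2 * i, by omega⟩) (Function.update v a z ⟨2 * i + 1, by omega⟩)
      = ∏ i ∈ Finset.univ.erase (⟨k, hkm⟩ : Fin m),
        g (v ⟨2 * i, by omega⟩) (v ⟨2 * i + 1, by omega⟩) := by
    intro z
    refine Finset.prod_congr rfl fun i hi => ?_
    have : i.1 ≠ k := fun h => (Finset.mem_erase.1 hi).1 (Fin.ext h)
    rw [Function.update_of_ne (by simp [Fin.ext_iff]; omega),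
      Function.update_of_ne (by simp [Fin.ext_iff]; omega)]
  rcases hk with hk | hk
  · refine ⟨∏ i ∈ Finset.univ.erase (⟨k, hkm⟩ : Fin m),
      g (v ⟨2 * i, by omega⟩) (v ⟨2 * i + 1, by omega⟩), v ⟨2 * k + 1, by omega⟩, Or.inl fun z => ?_⟩
    rw [← Finset.mul_prod_erase _ _ (Finset.mem_univ (⟨k, hkm⟩ : Fin m)), hrest,
      show (⟨2 * k, by omega⟩ : Fin (2 * m)) = a from Fin.ext hk.symm,
      Function.update_self, Function.update_of_ne (by simp [Fin.ext_iff]; omega)]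
  · refine ⟨∏ i ∈ Finset.univ.erase (⟨k, hkm⟩ : Fin m),
      g (v ⟨2 * i, by omega⟩) (v ⟨2 * i + 1, by omega⟩), v ⟨2 * k, by omega⟩, Or.inr fun z => ?_⟩
    rw [← Finset.mul_prod_erase _ _ (Finset.mem_univ (⟨k, hkm⟩ : Fin m)), hrest,
      show (⟨2 * k + 1, by omega⟩ : Fin (2 * m)) = a from Fin.ext hk.symm,
      Function.update_self, Function.update_of_ne (by simp [Fin.ext_iff]; omega)]

/-- The multilinear map `v ↦ ∏ B(v_{2i}, v_{2i+1})`. -/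
def pairProd (B : V →ₗ[ℝ] V →ₗ[ℝ] ℝ) : MultilinearMap ℝ (fun _ : Fin (2 * m) => V) ℝ where
  toFun v := ∏ i : Fin m, B (v ⟨2 * i, by omega⟩) (v ⟨2 * i + 1, by omega⟩)
  map_update_add' := by
    intro hdec v a x y
    cases Subsingleton.elim hdec (instDecidableEqFin (2 * m))
    obtain ⟨c, w, h | h⟩ := prod_pairs_update (fun x y => B x y) v a
    · simp only [h, map_add, LinearMap.add_apply, add_mul]
    · simp only [h, map_add, add_mul]
  map_update_smul' := by
    intro hdec v a r x
    cases Subsingleton.elim hdec (instDecidableEqFin (2 * m))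
    obtain ⟨c, w, h | h⟩ := prod_pairs_update (fun x y => B x y) v a
    · simp only [h, map_smul, LinearMap.smul_apply, smul_eq_mul, mul_assoc]
    · simp only [h, map_smul, smul_eq_mul, mul_assoc]

/-- `ω^m / m!` evaluated on `2m` vectors, in terms of the values `B a b = ω(e_a, e_b)`. -/
def pf (B : Fin (2 * m) → Fin (2 * m) → ℝ) : ℝ :=
  (2 ^ m * (m.factorial : ℝ))⁻¹ * ∑ s : Equiv.Perm (Fin (2 * m)),
    ((Equiv.Perm.sign s : ℤ) : ℝ) *
      ∏ i : Fin m, B (s ⟨2 * i, by omega⟩) (s ⟨2 * i + 1, by omega⟩)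

lemma pf_eq_alternatization (B : V →ₗ[ℝ] V →ₗ[ℝ] ℝ) (e : Fin (2 * m) → V) :
    pf (fun a b => B (e a) (e b))
      = (2 ^ m * (m.factorial : ℝ))⁻¹ * MultilinearMap.alternatization (pairProd (m := m) B) e := by
  rw [pf, MultilinearMap.alternatization_apply]
  congr 1
  refine Finset.sum_congr rfl fun s _ => ?_
  rw [Units.smul_def, zsmul_eq_mul]
  rfl

/-- The standard basis of the model. -/
abbrev stdVec (a : Fin (2 * m)) : Model m := EuclideanSpace.single a (1 : ℝ)

/-- After alternatization this is a form of top degree on a `2m`-dimensional space, hence a multiple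
of the determinant. -/
lemma pf_comp (B : Model m →ₗ[ℝ] Model m →ₗ[ℝ] ℝ) (P : Model m →ₗ[ℝ] Model m) :
    pf (fun a b => B (P (stdVec a)) (P (stdVec b)))
      = LinearMap.det P * pf (fun a b => B (stdVec a) (stdVec b)) := by
  let b := (EuclideanSpace.basisFun (Fin (2 * m)) ℝ).toBasis
  have hb : ∀ a, b a = stdVec a := fun a => by simp [b, stdVec]
  rw [pf_eq_alternatization B (fun a => P (stdVec a)), pf_eq_alternatization B]
  set A := MultilinearMap.alternatization (pairProd (m := m) B)
  have h := A.eq_smul_basis_det b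
  have h1 : A (fun a => P (stdVec a)) = A b * b.det (P ∘ b) := by
    conv_lhs => rw [h]
    simp only [AlternatingMap.smul_apply, smul_eq_mul]
    congr 2
    funext a
    simp [hb]
  have h2 : A (fun a => stdVec a) = A b := by
    congr 1
    funext a
    exact (hb a).symm
  rw [h1, h2, b.det_comp, b.det_self]
  ring

/-- The pull-back of a bilinear form. -/
def pullBilin (B : Model m →L[ℝ] Model m →L[ℝ] ℝ) (L : Model m →L[ℝ] Model m) :
    Model m →ₗ[ℝ] Model m →ₗ[ℝ] ℝ :=
  LinearMap.mk₂ ℝ (fun v w => B (L v) (L w)) (by simp) (by simp) (by simp) (by simp)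

end Pfaffian

/-! ### The Liouville measure in arbitrary smooth parametrizations -/

section Volume

variable {m : ℕ} {M : Type*} [TopologicalSpace M] [ChartedSpace (Model m) M]
  [IsManifold (𝓡 (2 * m)) ∞ M] (σ : SymplecticForm m M)

/-- A smooth parametrization of an open subset of `M`. -/
structure SmoothParam (ψ : OpenPartialHomeomorph (Model m) M) : Prop where
  smooth : ContMDiffOn 𝓘(ℝ, Model m) (𝓡 (2 * m)) ∞ ψ ψ.source
  smooth_symm : ContMDiffOn (𝓡 (2 * m)) 𝓘(ℝ, Model m) ∞ ψ.symm ψ.target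

lemma smoothParam_chart (x₀ : M) : SmoothParam (m := m) (chartAt (Model m) x₀).symm :=
  ⟨contMDiffOn_chart_symm' x₀, contMDiffOn_chart (I := 𝓡 (2 * m))⟩

/-- The coefficient of `v_ω` in a parametrization. -/
def paramCoeff (ψ : OpenPartialHomeomorph (Model m) M) (y : Model m) : ℝ :=
  pf fun a b => σ.form (ψ y) (mfderiv 𝓘(ℝ, Model m) (𝓡 (2 * m)) ψ y (stdVec a))
    (mfderiv 𝓘(ℝ, Model m) (𝓡 (2 * m)) ψ y (stdVec b))

/-- The measure that `v_ω` induces on the target of a parametrization. -/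
def paramVol [MeasurableSpace M] (ψ : OpenPartialHomeomorph (Model m) M) : Measure M :=
  Measure.map ψ ((volume.restrict ψ.source).withDensity
    (fun y => ENNReal.ofReal |paramCoeff σ ψ y|))

lemma chartVol_eq [MeasurableSpace M] (x₀ : M) :
    σ.chartVol x₀ = paramVol σ (chartAt (Model m) x₀).symm := rfl

lemma SmoothParam.contMDiffAt {ψ : OpenPartialHomeomorph (Model m) M} (h : SmoothParam ψ)
    {y : Model m} (hy : y ∈ ψ.source) : ContMDiffAt 𝓘(ℝ, Model m) (𝓡 (2 * m)) ∞ ψ y :=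
  h.smooth.contMDiffAt (ψ.open_source.mem_nhds hy)

lemma SmoothParam.contMDiffAt_symm {ψ : OpenPartialHomeomorph (Model m) M} (h : SmoothParam ψ)
    {x : M} (hx : x ∈ ψ.target) : ContMDiffAt (𝓡 (2 * m)) 𝓘(ℝ, Model m) ∞ ψ.symm x :=
  h.smooth_symm.contMDiffAt (ψ.open_target.mem_nhds hx)

section Transition

variable {ψ ψ' : OpenPartialHomeomorph (Model m) M} (h : SmoothParam ψ) (h' : SmoothParam ψ')

lemma SmoothParam.differentiableAt_transition (h : SmoothParam ψ) (h' : SmoothParam ψ')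
    {y : Model m} (hy : y ∈ ψ.source) (hy' : ψ y ∈ ψ'.target) :
    DifferentiableAt ℝ (ψ'.symm ∘ ψ) y :=
  (((h'.contMDiffAt_symm hy').comp y (h.contMDiffAt hy)).contDiffAt).differentiableAt (by simp)

/-- Near `y` one has `ψ = ψ' ∘ κ`, so the frame of `ψ` is the frame of `ψ'` transformed by `dκ`, and
a top form scales by the determinant. -/
lemma paramCoeff_transition (h : SmoothParam ψ) (h' : SmoothParam ψ')
    {y : Model m} (hy : y ∈ ψ.source) (hy' : ψ y ∈ ψ'.target) :
    paramCoeff σ ψ y = (fderiv ℝ (ψ'.symm ∘ ψ) y).det * paramCoeff σ ψ' ((ψ'.symm ∘ ψ) y) := by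
  set κ := ψ'.symm ∘ ψ with hκ
  have hκy : κ y ∈ ψ'.source := ψ'.map_target hy'
  have hev : ψ' ∘ κ =ᶠ[𝓝 y] ψ := by
    have : ψ.source ∩ ψ ⁻¹' ψ'.target ∈ 𝓝 y :=
      (ψ.isOpen_inter_preimage ψ'.open_target).mem_nhds ⟨hy, hy'⟩
    filter_upwards [this] with z hz
    exact ψ'.right_inv hz.2
  have hpt : ψ' (κ y) = ψ y := ψ'.right_inv hy'
  have hd : HasMFDerivAt 𝓘(ℝ, Model m) (𝓡 (2 * m)) ψ y
      ((mfderiv 𝓘(ℝ, Model m) (𝓡 (2 * m)) ψ' (κ y) : Model m →L[ℝ] Model m)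
        ∘L (fderiv ℝ κ y : Model m →L[ℝ] Model m)) := by
    have h1 := ((h'.contMDiffAt hκy).mdifferentiableAt (by simp)).hasMFDerivAt
    have h2 := (h.differentiableAt_transition h' hy hy').hasFDerivAt.hasMFDerivAt
    exact (h1.comp y h2).congr_of_eventuallyEq hev.symm
  have hd' := hd.mfderiv
  let B : Model m →ₗ[ℝ] Model m →ₗ[ℝ] ℝ :=
    pullBilin (σ.form (ψ y)) (mfderiv 𝓘(ℝ, Model m) (𝓡 (2 * m)) ψ' (κ y))
  have e1 : paramCoeff σ ψ y
      = pf (fun a b => B ((fderiv ℝ κ y).toLinearMap (stdVec a))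
        ((fderiv ℝ κ y).toLinearMap (stdVec b))) := by
    unfold paramCoeff
    rw [hd']
    rfl
  have e2 : paramCoeff σ ψ' (κ y) = pf (fun a b => B (stdVec a) (stdVec b)) := by
    unfold paramCoeff
    rw [hpt]
    rfl
  rw [e1, e2, pf_comp]

end Transition

variable [MeasurableSpace M] [BorelSpace M]

lemma aemeasurable_param (ψ : OpenPartialHomeomorph (Model m) M) (g : Model m → ENNReal) :
    AEMeasurable ψ ((volume.restrict ψ.source).withDensity g) :=
  (ψ.continuousOn.aemeasurable ψ.open_source.measurableSet).mono_ac
    (withDensity_absolutelyContinuous _ _)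

lemma paramVol_apply (ψ : OpenPartialHomeomorph (Model m) M) {A : Set M} (hA : MeasurableSet A) :
    paramVol σ ψ A = ∫⁻ y in ψ.source ∩ ψ ⁻¹' A, ENNReal.ofReal |paramCoeff σ ψ y| := by
  rw [paramVol, Measure.map_apply_of_aemeasurable (aemeasurable_param ψ _) hA, withDensity_apply',
    Measure.restrict_restrict' ψ.open_source.measurableSet, inter_comm]

lemma measurableSet_param (ψ : OpenPartialHomeomorph (Model m) M) {A : Set M}
    (hA : MeasurableSet A) : MeasurableSet (ψ.source ∩ ψ ⁻¹' A) := by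
  have hm : Measurable (ψ.source.domRestrict ψ) :=
    (continuousOn_iff_continuous_domRestrict.1 ψ.continuousOn).measurable
  have := (hm hA)
  have h2 := (MeasurableEmbedding.subtype_coe ψ.open_source.measurableSet).measurableSet_image.2 this
  convert h2 using 1
  ext y
  simp [Set.domRestrict, and_comm]

/-- The Jacobian from the change of variables is exactly the factor relating the two coefficients.
-/
lemma paramVol_eq {ψ ψ' : OpenPartialHomeomorph (Model m) M} (h : SmoothParam ψ)
    (h' : SmoothParam ψ') {A : Set M} (hA : MeasurableSet A) (hs : A ⊆ ψ.target)
    (hs' : A ⊆ ψ'.target) : paramVol σ ψ A = paramVol σ ψ' A := by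
  rw [paramVol_apply σ ψ hA, paramVol_apply σ ψ' hA]
  have him : (ψ'.symm ∘ ψ) '' (ψ.source ∩ ψ ⁻¹' A) = ψ'.source ∩ ψ' ⁻¹' A := by
    ext z
    constructor
    · rintro ⟨y, ⟨hy, hyA⟩, rfl⟩
      exact ⟨ψ'.map_target (hs' hyA), by
        simpa [ψ'.right_inv (hs' hyA)] using hyA⟩
    · rintro ⟨hz, hzA⟩
      exact ⟨ψ.symm (ψ' z), ⟨ψ.map_target (hs hzA), by
        simpa [ψ.right_inv (hs hzA)] using hzA⟩, by
        simp [ψ.right_inv (hs hzA), ψ'.left_inv hz]⟩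
  rw [← him, lintegral_image_eq_lintegral_abs_det_fderiv_mul volume (measurableSet_param ψ hA)
    (f' := fderiv ℝ (ψ'.symm ∘ ψ)) (fun y hy =>
      (h.differentiableAt_transition h' hy.1 (hs' hy.2)).hasFDerivAt.hasFDerivWithinAt)]
  · refine setLIntegral_congr_fun (measurableSet_param ψ hA) fun y hy => ?_
    rw [paramCoeff_transition σ h h' hy.1 (hs' hy.2), abs_mul,
      ENNReal.ofReal_mul (abs_nonneg _)]
  · intro y hy z hz hyz
    exact ψ.injOn hy.1 hz.1 (ψ'.symm.injOn (hs' hy.2) (hs' hz.2) hyz)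

lemma paramVol_inter_target (ψ : OpenPartialHomeomorph (Model m) M) {A : Set M}
    (hA : MeasurableSet A) : paramVol σ ψ (A ∩ ψ.target) = paramVol σ ψ A := by
  rw [paramVol_apply σ ψ hA, paramVol_apply σ ψ (hA.inter ψ.open_target.measurableSet)]
  congr 2
  ext y
  simp only [mem_inter_iff, mem_preimage]
  exact ⟨fun h => ⟨h.1, h.2.1⟩, fun h => ⟨h.1, h.2, ψ.map_source h.1⟩⟩

variable [CompactSpace M]

/-- Indexed by `ℕ` so that the cover can be made disjoint by `disjointed`. -/
lemma exists_chart_cover (m : ℕ) (M : Type*) [TopologicalSpace M] [ChartedSpace (Model m) M]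
    [CompactSpace M] [Nonempty M] :
    ∃ c : ℕ → M, ⋃ n, (chartAt (Model m) (c n)).source = univ := by
  obtain ⟨t, ht⟩ := isCompact_univ.elim_finite_subcover (fun x : M => (chartAt (Model m) x).source)
    (fun x => (chartAt (Model m) x).open_source)
    (fun x _ => mem_iUnion.2 ⟨x, mem_chart_source _ x⟩)
  have hne : (t : Set M).Nonempty := by
    obtain ⟨x⟩ := ‹Nonempty M›
    obtain ⟨y, hy, -⟩ := mem_iUnion₂.1 (ht (mem_univ x))
    exact ⟨y, hy⟩
  obtain ⟨c, hc⟩ := (t.countable_toSet).exists_eq_range hne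
  refine ⟨c, eq_univ_of_univ_subset (ht.trans ?_)⟩
  intro x hx
  obtain ⟨y, hy, hxy⟩ := mem_iUnion₂.1 hx
  have : y ∈ range c := hc ▸ (Finset.mem_coe.2 hy)
  obtain ⟨n, rfl⟩ := this
  exact mem_iUnion.2 ⟨n, hxy⟩

/-- The measure `v_ω` is the one that it induces on each parametrized open set. -/
lemma vol_apply [Nonempty M] {ψ : OpenPartialHomeomorph (Model m) M} (h : SmoothParam ψ) {A : Set M}
    (hA : MeasurableSet A) (hs : A ⊆ ψ.target) : σ.vol A = paramVol σ ψ A := by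
  obtain ⟨c, hc⟩ := exists_chart_cover m M
  set D := disjointed (fun n => (chartAt (Model m) (c n)).source) with hD
  have hDm : ∀ n, MeasurableSet (D n) := fun n =>
    MeasurableSet.disjointed (fun k => (chartAt (Model m) (c k)).open_source.measurableSet) n
  have hDs : ∀ n, D n ⊆ (chartAt (Model m) (c n)).source := fun n => disjointed_subset _ n
  have hDu : ⋃ n, D n = univ := by rw [hD, iUnion_disjointed, hc]
  have hDd : Pairwise (Function.onFun Disjoint D) := disjoint_disjointed _
  have hsplit : ∀ (μ : Measure M) {B : Set M}, MeasurableSet B → μ B = ∑' n, μ (B ∩ D n) := by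
    intro μ B hB
    rw [← measure_iUnion (fun i j hij => (hDd hij).mono inter_subset_right inter_subset_right)
      (fun n => hB.inter (hDm n)), ← inter_iUnion, hDu, inter_univ]
  -- `G` glues the chart measures along a disjoint partition. By compatibility it agrees with every
  -- parametrization, hence dominates all chart measures; each piece is bounded by the supremum, so
  -- `G` equals `vol`.
  set G := Measure.sum fun n => (paramVol σ (chartAt (Model m) (c n)).symm).restrict (D n) with hG
  have hGA : ∀ {ψ : OpenPartialHomeomorph (Model m) M}, SmoothParam ψ → ∀ {B : Set M},
      MeasurableSet B → B ⊆ ψ.target → G B = paramVol σ ψ B := by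
    intro ψ h B hB hs
    rw [hG, Measure.sum_apply _ hB, hsplit (paramVol σ ψ) hB]
    refine tsum_congr fun n => ?_
    rw [Measure.restrict_apply hB]
    exact paramVol_eq σ (smoothParam_chart (c n)) h (hB.inter (hDm n))
      (inter_subset_right.trans (hDs n)) (inter_subset_left.trans hs)
  have hle : σ.vol ≤ G := by
    refine iSup_le fun x₀ => Measure.le_iff.2 fun B hB => ?_
    rw [chartVol_eq, ← paramVol_inter_target σ _ hB,
      ← hGA (smoothParam_chart x₀) (hB.inter (OpenPartialHomeomorph.open_target _).measurableSet)
        inter_subset_right]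
    exact measure_mono inter_subset_left
  have hge : G ≤ σ.vol := by
    refine Measure.le_iff.2 fun B hB => ?_
    rw [hG, Measure.sum_apply _ hB, hsplit σ.vol hB]
    refine ENNReal.tsum_le_tsum fun n => ?_
    rw [Measure.restrict_apply hB, ← chartVol_eq]
    exact Measure.le_iff'.1 (le_iSup (fun x₀ => σ.chartVol x₀) (c n)) _
  rw [le_antisymm hle hge, hGA h hA hs]

lemma vol_restrict [Nonempty M] {ψ : OpenPartialHomeomorph (Model m) M} (h : SmoothParam ψ) :
    σ.vol.restrict ψ.target = paramVol σ ψ := by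
  refine Measure.ext fun A hA => ?_
  rw [Measure.restrict_apply hA,
    vol_apply σ h (hA.inter ψ.open_target.measurableSet) inter_subset_right,
    paramVol_inter_target σ ψ hA]

lemma tcs_eq_mfderiv {x₀ x : M} (hx : x ∈ (chartAt (Model m) x₀).source) (v : Model m) :
    tcs x₀ x v = mfderiv 𝓘(ℝ, Model m) (𝓡 (2 * m)) (chartAt (Model m) x₀).symm
      (chartAt (Model m) x₀ x) v := by
  have h := TangentBundle.symmL_trivializationAt (I := 𝓡 (2 * m)) hx
  have h' := congrArg (fun B : Model m →L[ℝ] Model m => B v) h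
  refine h'.trans ?_
  have : Set.range (𝓡 (2 * m)) = univ := by simp
  rw [this]
  change (mfderivWithin 𝓘(ℝ, Model m) (𝓡 (2 * m)) (chartAt (Model m) x₀).symm univ
    (chartAt (Model m) x₀ x) : Model m →L[ℝ] Model m) v = _
  rw [mfderivWithin_univ]

lemma continuousAt_paramCoeff (x : M) :
    ContinuousAt (paramCoeff σ (chartAt (Model m) x).symm) (chartAt (Model m) x x) := by
  set φ := chartAt (Model m) x with hφ
  have hsrc : φ x ∈ φ.target := φ.map_source (mem_chart_source _ x)
  have hc : ContinuousAt (fun y => pf (fun a b => coordForm σ x (φ.symm y) (stdVec a) (stdVec b)))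
      (φ x) := by
    have h0 : ContinuousAt φ.symm (φ x) := φ.symm.continuousAt hsrc
    have h1 : ContinuousAt (coordForm σ x) (φ.symm (φ x)) := by
      rw [φ.left_inv (mem_chart_source _ x)]
      exact (contMDiffAt_coordForm σ x).continuousAt
    have h2 : ContinuousAt (fun y => coordForm σ x (φ.symm y)) (φ x) := h1.comp h0
    have h3 : ∀ a b : Fin (2 * m), ContinuousAt
        (fun y => coordForm σ x (φ.symm y) (stdVec a) (stdVec b)) (φ x) := fun a b =>
      (h2.clm_apply continuousAt_const).clm_apply continuousAt_const
    unfold pf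
    exact continuousAt_const.mul (tendsto_finsetSum _ fun s _ => continuousAt_const.mul
      (tendsto_finsetProd _ fun i _ => h3 _ _))
  refine hc.congr ?_
  filter_upwards [φ.open_target.mem_nhds hsrc] with y hy
  unfold paramCoeff
  have : ∀ a : Fin (2 * m), tcs x (φ.symm y) (stdVec a)
      = mfderiv 𝓘(ℝ, Model m) (𝓡 (2 * m)) φ.symm y (stdVec a) := by
    intro a
    rw [tcs_eq_mfderiv (φ.map_target hy), ← hφ]
    exact congrArg (fun z => (mfderiv 𝓘(ℝ, Model m) (𝓡 (2 * m)) φ.symm z :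
      Model m →L[ℝ] Model m) (stdVec a)) (φ.right_inv hy)
  simp only [coordForm_apply, this]

lemma isFiniteMeasure_vol [Nonempty M] : IsFiniteMeasure σ.vol := by
  have : IsLocallyFiniteMeasure σ.vol := by
    refine ⟨fun x => ?_⟩
    set φ := chartAt (Model m) x with hφ
    have hsrc : φ x ∈ φ.target := φ.map_source (mem_chart_source _ x)
    obtain ⟨C, hC⟩ : ∃ C, ∀ᶠ y in 𝓝 (φ x), |paramCoeff σ φ.symm y| < C :=
      ⟨_, ((continuousAt_paramCoeff σ x).abs).eventually_lt_const (lt_add_one _)⟩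
    obtain ⟨r, hr, hball⟩ := Metric.mem_nhds_iff.1 hC
    have ho : IsOpen (φ.source ∩ φ ⁻¹' Metric.ball (φ x) r) :=
      φ.isOpen_inter_preimage Metric.isOpen_ball
    refine ⟨_, ho.mem_nhds ⟨mem_chart_source _ x, Metric.mem_ball_self hr⟩, ?_⟩
    rw [vol_apply σ (smoothParam_chart x) ho.measurableSet inter_subset_left,
      paramVol_apply σ _ ho.measurableSet]
    have hsub : (chartAt (Model m) x).symm.source ∩
        (chartAt (Model m) x).symm ⁻¹' (φ.source ∩ φ ⁻¹' Metric.ball (φ x) r)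
        ⊆ Metric.ball (φ x) r := by
      rintro y ⟨hy, -, hy2⟩
      have : φ (φ.symm y) = y := φ.right_inv hy
      simpa [← hφ, this] using hy2
    refine lt_of_le_of_lt (lintegral_mono_set hsub) ?_
    refine lt_of_le_of_lt (setLIntegral_mono' (g := fun _ => ENNReal.ofReal C)
      Metric.isOpen_ball.measurableSet fun y hy => ENNReal.ofReal_le_ofReal (hball hy).le) ?_
    rw [setLIntegral_const]
    exact ENNReal.mul_lt_top ENNReal.ofReal_lt_top measure_ball_lt_top
  exact CompactSpace.isFiniteMeasure

end Volume

/-! ### The smooth inverse function theorem -/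

section InverseFunction

variable {E F : Type*} [NormedAddCommGroup E] [NormedSpace ℝ E] [CompleteSpace E]
  [NormedAddCommGroup F] [NormedSpace ℝ F]

/-- The inverse function theorem, with smoothness on the whole domain of the local inverse. -/
lemma exists_smooth_localInverse {f : E → F} {U : Set E} (hU : IsOpen U) (hf : ContDiffOn ℝ ∞ f U)
    {a : E} (ha : a ∈ U) (hinv : (fderiv ℝ f a).IsInvertible) :
    ∃ Φ : OpenPartialHomeomorph E F, a ∈ Φ.source ∧ Φ.source ⊆ U ∧ (∀ y, Φ y = f y) ∧
      ContDiffOn ℝ ∞ Φ.symm Φ.target := by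
  obtain ⟨e, he⟩ := hinv
  have hfa : ContDiffAt ℝ ∞ f a := hf.contDiffAt (hU.mem_nhds ha)
  have hd : HasFDerivAt f (e : E →L[ℝ] F) a := he ▸ (hfa.differentiableAt (by simp)).hasFDerivAt
  -- Restricting to points with invertible derivative makes the local inverse smooth on its whole
  -- domain and not only at the image of `a`.
  set W := U ∩ (fderiv ℝ f) ⁻¹' (range ((↑) : (E ≃L[ℝ] F) → E →L[ℝ] F)) with hW
  have hWo : IsOpen W := (hf.continuousOn_fderiv_of_isOpen hU (by simp)).isOpen_inter_preimage hU
    ContinuousLinearEquiv.isOpen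
  refine ⟨(hfa.toOpenPartialHomeomorph f hd (by simp)).restrOpen W hWo,
    ⟨hfa.mem_toOpenPartialHomeomorph_source hd (by simp), ha, ⟨e, he⟩⟩,
    fun y hy => hy.2.1, fun y => rfl, ?_⟩
  intro z hz
  set Φ := (hfa.toOpenPartialHomeomorph f hd (by simp)).restrOpen W hWo
  have hs : Φ.symm z ∈ Φ.source := Φ.map_target hz
  obtain ⟨e', he'⟩ := hs.2.2
  have hfz : ContDiffAt ℝ ∞ f (Φ.symm z) := hf.contDiffAt (hU.mem_nhds hs.2.1)
  exact (Φ.contDiffAt_symm (f₀' := e') hz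
    (he' ▸ (hfz.differentiableAt (by simp)).hasFDerivAt) hfz).contDiffWithinAt

end InverseFunction

/-- A splitting of the model into an angular and a momentum part. -/
def splitModel (m : ℕ) : Model m ≃L[ℝ] (Fin m → ℝ) × (Fin m → ℝ) :=
  ContinuousLinearEquiv.ofFinrankEq (by simp; ring)

/-! ### Local parametrizations adapted to the moment map -/

namespace ToricStructure

variable {m : ℕ} {M : Type*} [TopologicalSpace M] [ChartedSpace (Model m) M]
  [IsManifold (𝓡 (2 * m)) ∞ M] [MulAction (Torus m) M]
  (T : ToricStructure m M) (ξ : Module.Basis (Fin m) ℝ (Fin m → ℝ))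

lemma dmu_mfderiv {ψ : Model m → M} {y : Model m}
    (hd : MDifferentiableAt 𝓘(ℝ, Model m) (𝓡 (2 * m)) ψ y)
    (hm : ∀ᶠ z in 𝓝 y, T.momCoord ξ (ψ z) = (splitModel m z).2) (v : Model m) :
    T.dmu ξ (ψ y) (mfderiv 𝓘(ℝ, Model m) (𝓡 (2 * m)) ψ y v) = (splitModel m v).2 := by
  funext i
  have h1 := mfderiv_comp_apply y (T.mdifferentiableAt_mom (ξ i) (ψ y)) hd v
  have h2 : HasFDerivAt ((fun x => T.mom x (ξ i)) ∘ ψ)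
      ((ContinuousLinearMap.proj i ∘L ContinuousLinearMap.snd ℝ (Fin m → ℝ) (Fin m → ℝ)) ∘L
        (splitModel m : Model m →L[ℝ] (Fin m → ℝ) × (Fin m → ℝ))) y := by
    refine (ContinuousLinearMap.hasFDerivAt _).congr_of_eventuallyEq ?_
    filter_upwards [hm] with z hz
    exact congrFun hz i
  rw [h2.hasMFDerivAt.mfderiv] at h1
  exact h1.symm

lemma mfderiv_fundMap (T : ToricStructure m M) {ψ : Model m → M} {y : Model m}
    (hd : MDifferentiableAt 𝓘(ℝ, Model m) (𝓡 (2 * m)) ψ y) {θ : Fin m → ℝ}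
    (ht : ∀ᶠ s : ℝ in 𝓝 0, ψ (y + s • (splitModel m).symm (θ, 0)) = torusExp (s • θ) • ψ y) :
    mfderiv 𝓘(ℝ, Model m) (𝓡 (2 * m)) ψ y ((splitModel m).symm (θ, 0)) = fundMap (ψ y) θ := by
  set v := (splitModel m).symm (θ, 0)
  have hl : HasDerivAt (fun s : ℝ => y + s • v) v 0 := by
    simpa using ((hasDerivAt_id (0 : ℝ)).smul_const v).const_add y
  have hl' : HasMFDerivAt 𝓘(ℝ, ℝ) 𝓘(ℝ, Model m) (fun s : ℝ => y + s • v) 0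
    (ContinuousLinearMap.toSpanSingleton ℝ v) := hl.hasFDerivAt.hasMFDerivAt
  have h0 : y + (0 : ℝ) • v = y := by simp
  have h1 := HasMFDerivAt.comp (0 : ℝ) (g := ψ) (by rw [h0]; exact hd.hasMFDerivAt) hl'
  have h2 := (T.isMIntegralCurve_orbit θ (ψ y) 0)
  have h3 := h2.congr_of_eventuallyEq ht
  have h4 := hasMFDerivAt_unique h1 h3
  have h5 := congrArg (fun B : ℝ →L[ℝ] Model m => B 1) h4
  have e : (torusExp ((0 : ℝ) • θ) • ψ y) = ψ y := by simp
  have h6 : (fundMap (torusExp ((0 : ℝ) • θ) • ψ y) θ : Model m) = fundMap (ψ y) θ := by rw [e]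
  have h7 : mfderiv 𝓘(ℝ, Model m) (𝓡 (2 * m)) ψ y ((1 : ℝ) • v)
      = ((1 : ℝ) • fundMap (torusExp ((0 : ℝ) • θ) • ψ y) θ : Model m) := h5
  rw [one_smul] at h7
  refine h7.trans ?_
  rw [one_smul]
  exact h6

/-- Parametrizations `(θ, b) ↦ exp(θ) • s(b)` with `μ(s(b)) = b`. -/
structure AdaptedParam (ψ : OpenPartialHomeomorph (Model m) M) : Prop where
  param : SmoothParam ψ
  target_subset : ψ.target ⊆ locFree m M
  trans : ∀ y ∈ ψ.source, ∀ θ : Fin m → ℝ, y + (splitModel m).symm (θ, 0) ∈ ψ.source →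
    ψ (y + (splitModel m).symm (θ, 0)) = torusExp θ • ψ y
  mom : ∀ y ∈ ψ.source, T.momCoord ξ (ψ y) = (splitModel m y).2

/-- In a chart, `ℓ` is the affine map through `x₀` whose linear part is a right inverse of `dμ`.
Then `μ ∘ ℓ` has identity derivative at `b₀`, and composing `ℓ` with its local inverse gives the
section. -/
lemma exists_section {x₀ : M} (hx₀ : x₀ ∈ locFree m M) :
    ∃ (B : Set (Fin m → ℝ)) (s : (Fin m → ℝ) → M), IsOpen B ∧ T.momCoord ξ x₀ ∈ B ∧
      ContMDiffOn 𝓘(ℝ, Fin m → ℝ) (𝓡 (2 * m)) ∞ s B ∧ s (T.momCoord ξ x₀) = x₀ ∧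
      ∀ b ∈ B, T.momCoord ξ (s b) = b := by
  set c := chartAt (Model m) x₀ with hc
  set b₀ := T.momCoord ξ x₀ with hb₀
  have hsrc : x₀ ∈ c.source := mem_chart_source _ x₀
  have htgt : c x₀ ∈ c.target := c.map_source hsrc
  have hcx : c.symm (c x₀) = x₀ := c.left_inv hsrc
  let μ : Model m → Fin m → ℝ := fun y => T.momCoord ξ (c.symm y)
  have hμ : ContDiffOn ℝ ∞ μ c.target := contDiffOn_pi.2 fun i y hy =>
    (contDiffAt_chart_symm (x₀ := x₀) hy (T.contMDiffAt_momCoord ξ i _)).contDiffWithinAt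
  have hμd : DifferentiableAt ℝ μ (c x₀) :=
    (hμ.contDiffAt (c.open_target.mem_nhds htgt)).differentiableAt (by simp)
  have hsurj : Function.Surjective (fderiv ℝ μ (c x₀)) := by
    intro t
    obtain ⟨v, hv⟩ := T.dmu_surjective ξ hx₀ t
    obtain ⟨w, hw⟩ := mfderiv_chart_symm_surjective hsrc v
    refine ⟨w, ?_⟩
    funext i
    have h0 : fderiv ℝ μ (c x₀) w i = fderiv ℝ (fun y => μ y i) (c x₀) w := by
      rw [fderiv_apply hμd]
      rfl
    rw [h0]
    have h1 := fderiv_chart_symm (f := fun x => T.momCoord ξ x i) htgt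
      (T.mdifferentiableAt_mom (ξ i) _) w
    refine h1.trans ?_
    have h2 : ∀ (z : M) (u : Model m), z = x₀ →
        (dif m (fun x => T.momCoord ξ x i) z : Model m →L[ℝ] ℝ) u
        = (dif m (fun x => T.momCoord ξ x i) x₀ : Model m →L[ℝ] ℝ) u := by
      rintro z u rfl
      rfl
    refine (h2 _ _ hcx).trans ?_
    rw [← hv]
    exact congrArg (dif m (fun x => T.momCoord ξ x i) x₀ : Model m →L[ℝ] ℝ) hw
  obtain ⟨R₀, hR₀⟩ := (fderiv ℝ μ (c x₀)).toLinearMap.exists_rightInverse_of_surjective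
    (LinearMap.range_eq_top.2 hsurj)
  let R : (Fin m → ℝ) →L[ℝ] Model m := R₀.toContinuousLinearMap
  let ℓ : (Fin m → ℝ) → Model m := fun b => c x₀ + R (b - b₀)
  have hℓ : ContDiff ℝ ∞ ℓ := contDiff_const.add (R.contDiff.comp (contDiff_id.sub contDiff_const))
  have hℓ0 : ℓ b₀ = c x₀ := by simp [ℓ]
  have hℓd : HasFDerivAt ℓ R b₀ :=
    (R.hasFDerivAt.comp b₀ ((hasFDerivAt_id b₀).sub_const b₀)).const_add _
  obtain ⟨Φ, h1, h2, h3, h4⟩ := exists_smooth_localInverse (f := μ ∘ ℓ) (U := ℓ ⁻¹' c.target)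
    (c.open_target.preimage hℓ.continuous) (hμ.comp hℓ.contDiffOn fun b hb => hb)
    (a := b₀) (by simpa [hℓ0] using htgt) (by
      have hd : HasFDerivAt (μ ∘ ℓ) ((fderiv ℝ μ (c x₀)) ∘L R) b₀ := by
        refine HasFDerivAt.comp b₀ ?_ hℓd
        rw [hℓ0]
        exact hμd.hasFDerivAt
      rw [hd.fderiv]
      refine ⟨ContinuousLinearEquiv.refl ℝ _, ?_⟩
      ext1 t
      exact (LinearMap.congr_fun hR₀ t).symm)
  have hΦb : Φ b₀ = b₀ := by
    rw [h3, Function.comp_apply, hℓ0]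
    simp only [μ, hcx, hb₀]
  have hsymm : Φ.symm b₀ = b₀ := by
    conv_lhs => rw [← hΦb]
    exact Φ.left_inv h1
  refine ⟨Φ.target, fun b => c.symm (ℓ (Φ.symm b)), Φ.open_target, ?_, ?_, ?_, ?_⟩
  · rw [← hΦb]
    exact Φ.map_source h1
  · have hin : ContMDiffOn 𝓘(ℝ, Fin m → ℝ) 𝓘(ℝ, Model m) ∞ (fun b => ℓ (Φ.symm b)) Φ.target :=
      (hℓ.comp_contDiffOn h4).contMDiffOn
    exact (contMDiffOn_chart_symm' x₀).comp hin fun b hb => h2 (Φ.map_target hb)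
  · simp only [hsymm, hℓ0, hcx]
  · intro b hb
    have := Φ.right_inv hb
    rw [h3] at this
    exact this

/-- The inverse function theorem for `(θ, b) ↦ exp(θ) • s(b)`. A kernel vector of the derivative at
`(0, b₀)` has no momentum component, since `μ` reads off `b`. It is therefore angular, and local
freeness forces it to vanish. -/
lemma exists_adaptedParam {x₀ : M} (hx₀ : x₀ ∈ locFree m M) :
    ∃ ψ : OpenPartialHomeomorph (Model m) M, T.AdaptedParam ξ ψ ∧ x₀ ∈ ψ.target := by
  obtain ⟨B, s, hB, hb₀, hs, hs₀, hsm⟩ := T.exists_section ξ hx₀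
  set Λ := splitModel m with hΛ
  set c := chartAt (Model m) x₀ with hc
  set b₀ := T.momCoord ξ x₀
  have hsrc : x₀ ∈ c.source := mem_chart_source _ x₀
  let ψ₀ : Model m → M := fun y => torusExp (Λ y).1 • s (Λ y).2
  let U₀ : Set (Model m) := {y | (Λ y).2 ∈ B}
  have hU₀ : IsOpen U₀ := hB.preimage (continuous_snd.comp Λ.continuous)
  have h1 : ContMDiff 𝓘(ℝ, Model m) 𝓘(ℝ, Fin m → ℝ) ∞ (fun y : Model m => (Λ y).1) :=
    (contDiff_fst.comp Λ.contDiff).contMDiff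
  have h2 : ContMDiff 𝓘(ℝ, Model m) 𝓘(ℝ, Fin m → ℝ) ∞ (fun y : Model m => (Λ y).2) :=
    (contDiff_snd.comp Λ.contDiff).contMDiff
  have hψ₀ : ContMDiffOn 𝓘(ℝ, Model m) (𝓡 (2 * m)) ∞ ψ₀ U₀ :=
    T.smooth_action.comp_contMDiffOn
      (h1.contMDiffOn.prodMk (hs.comp h2.contMDiffOn fun y hy => hy))
  let a : Model m := Λ.symm (0, b₀)
  have ha₀ : a ∈ U₀ := by simpa [a, U₀] using hb₀
  have hψa : ψ₀ a = x₀ := by simp [ψ₀, a, hs₀]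
  let U := U₀ ∩ ψ₀ ⁻¹' (c.source ∩ locFree m M)
  have hU : IsOpen U := hψ₀.continuousOn.isOpen_inter_preimage hU₀
    (c.open_source.inter T.isOpen_locFree)
  have haU : a ∈ U := ⟨ha₀, by rw [mem_preimage, hψa]; exact ⟨hsrc, hx₀⟩⟩
  have hf : ContDiffOn ℝ ∞ (c ∘ ψ₀) U := by
    have : ContMDiffOn 𝓘(ℝ, Model m) 𝓘(ℝ, Model m) ∞ (c ∘ ψ₀) U :=
      (contMDiffOn_chart (I := 𝓡 (2 * m))).comp (hψ₀.mono inter_subset_left) fun y hy => hy.2.1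
    exact contMDiffOn_iff_contDiffOn.1 this
  have hinj : Function.Injective (fderiv ℝ (c ∘ ψ₀) a) := by
    rw [injective_iff_map_eq_zero]
    intro v hv
    have hda : MDifferentiableAt 𝓘(ℝ, Model m) (𝓡 (2 * m)) ψ₀ a :=
      (hψ₀.contMDiffAt (hU₀.mem_nhds ha₀)).mdifferentiableAt (by simp)
    have hev : c.symm ∘ (c ∘ ψ₀) =ᶠ[𝓝 a] ψ₀ := by
      filter_upwards [hU.mem_nhds haU] with y hy
      exact c.left_inv hy.2.1
    have hct : (c ∘ ψ₀) a ∈ c.target := c.map_source haU.2.1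
    have hdf : MDifferentiableAt 𝓘(ℝ, Model m) 𝓘(ℝ, Model m) (c ∘ ψ₀) a :=
      ((hf.contDiffAt (hU.mem_nhds haU)).differentiableAt (by simp)).mdifferentiableAt
    have hzero : (mfderiv 𝓘(ℝ, Model m) (𝓡 (2 * m)) ψ₀ a : Model m →L[ℝ] Model m) v = 0 := by
      have h5 := mfderiv_comp_apply a ((contMDiffAt_chart_symm x₀ hct).mdifferentiableAt (by simp))
        hdf v
      rw [hev.mfderiv_eq, mfderiv_eq_fderiv] at h5
      refine h5.trans ?_
      refine (congrArg (mfderiv 𝓘(ℝ, Model m) (𝓡 (2 * m)) c.symm ((c ∘ ψ₀) a) :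
        Model m →L[ℝ] Model m) hv).trans (map_zero _)
    have hm : ∀ᶠ z in 𝓝 a, T.momCoord ξ (ψ₀ z) = (Λ z).2 := by
      filter_upwards [hU₀.mem_nhds ha₀] with z hz
      funext i
      simp only [momCoord, ψ₀, T.mom_invariant]
      exact congrFun (hsm _ hz) i
    have hv2 : (Λ v).2 = 0 := by
      rw [← T.dmu_mfderiv ξ hda hm v]
      exact (congrArg (T.dmu ξ (ψ₀ a) : Model m →L[ℝ] (Fin m → ℝ)) hzero).trans (map_zero _)
    have hv1 : v = Λ.symm ((Λ v).1, 0) := by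
      rw [← hv2]
      simp
    have ht : ∀ᶠ r : ℝ in 𝓝 0, ψ₀ (a + r • Λ.symm ((Λ v).1, 0)) = torusExp (r • (Λ v).1) • ψ₀ a := by
      refine .of_forall fun r => ?_
      simp [ψ₀, a]
    have h6 := T.mfderiv_fundMap hda ht
    have h7 : fundMap (ψ₀ a) (Λ v).1 = 0 := by
      rw [← h6, ← hΛ, ← hv1]
      exact hzero
    have h8 : (Λ v).1 = 0 := by
      have hl : ψ₀ a ∈ locFree m M := haU.2.2
      exact (injective_iff_map_eq_zero _).1 hl _ h7
    rw [hv1, h8]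
    exact map_zero Λ.symm
  have hinv : (fderiv ℝ (c ∘ ψ₀) a).IsInvertible :=
    ⟨(LinearEquiv.ofInjectiveEndo (fderiv ℝ (c ∘ ψ₀) a).toLinearMap hinj).toContinuousLinearEquiv,
      rfl⟩
  obtain ⟨Φ, g1, g2, g3, g4⟩ := exists_smooth_localInverse hU hf haU hinv
  have hsub : ∀ y ∈ Φ.source, Φ y ∈ c.target ∧ c.symm (Φ y) = ψ₀ y := fun y hy => by
    rw [g3]
    exact ⟨c.map_source (g2 hy).2.1, c.left_inv (g2 hy).2.1⟩
  let ψ := Φ.trans c.symm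
  have hψs : ψ.source ⊆ Φ.source := fun y hy => hy.1
  have hψe : ∀ y ∈ ψ.source, ψ y = ψ₀ y := fun y hy => (hsub y (hψs hy)).2
  refine ⟨ψ, ⟨⟨?_, ?_⟩, ?_, ?_, ?_⟩, ?_⟩
  · exact (hψ₀.mono fun y hy => (g2 (hψs hy)).1).congr hψe
  · have hg4 : ContMDiffOn 𝓘(ℝ, Model m) 𝓘(ℝ, Model m) ∞ Φ.symm Φ.target := g4.contMDiffOn
    exact hg4.comp ((contMDiffOn_chart (I := 𝓡 (2 * m))).mono fun x hx => hx.1) fun x hx => hx.2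
  · intro x hx
    have h := ψ.map_target hx
    rw [← ψ.right_inv hx, hψe _ h]
    exact (g2 (hψs h)).2.2
  · intro y hy θ hy'
    rw [hψe y hy, hψe _ hy']
    simp only [ψ₀, map_add, ← hΛ, ContinuousLinearEquiv.apply_symm_apply, Prod.fst_add,
      Prod.snd_add, add_zero, smul_smul, ← torusExp_add]
    rw [add_comm]
  · intro y hy
    rw [hψe y hy]
    funext i
    simp only [momCoord, ψ₀, T.mom_invariant]
    exact congrFun (hsm _ (g2 (hψs hy)).1) i
  · have ha : a ∈ ψ.source := ⟨g1, (hsub a g1).1⟩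
    rw [← hψa, ← hψe a ha]
    exact ψ.map_source ha

end ToricStructure

/-! ### Independence of the volume from the momentum block -/

section Shear

/-- A unipotent map conjugate to its inverse by an involution has determinant `±1`. -/
lemma abs_det_one_add {V : Type*} [AddCommGroup V] [Module ℝ V] {N D : V →ₗ[ℝ] V}
    (hN : ∀ v, N (N v) = 0) (hD : ∀ v, D (D v) = v) (hDN : ∀ v, D (N v) = N v)
    (hND : ∀ v, N (D v) = -N v) : |LinearMap.det (LinearMap.id + N)| = 1 := by
  have h1 : (LinearMap.id + N) ∘ₗ (LinearMap.id - N) = LinearMap.id := by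
    ext v
    simp [hN]
  have h2 : D ∘ₗ (LinearMap.id + N) ∘ₗ D = LinearMap.id - N := by
    ext v
    simp [hD, hND, hDN, sub_eq_add_neg]
  have h3 : LinearMap.det D * LinearMap.det D = 1 := by
    rw [← LinearMap.det_comp, show D ∘ₗ D = LinearMap.id from LinearMap.ext hD, LinearMap.det_id]
  have h4 := congrArg LinearMap.det h1
  rw [← h2, LinearMap.det_comp, LinearMap.det_comp, LinearMap.det_comp, LinearMap.det_id] at h4
  have h5 : LinearMap.det (LinearMap.id + N) * LinearMap.det (LinearMap.id + N) = 1 := by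
    calc LinearMap.det (LinearMap.id + N) * LinearMap.det (LinearMap.id + N)
        = LinearMap.det (LinearMap.id + N) * LinearMap.det (LinearMap.id + N)
          * (LinearMap.det D * LinearMap.det D) := by rw [h3, mul_one]
      _ = 1 := by rw [← h4]; ring
  have h6 := abs_mul_abs_self (LinearMap.det (LinearMap.id + N))
  rw [h5] at h6
  nlinarith [abs_nonneg (LinearMap.det (LinearMap.id + N)), h6]

variable {m : ℕ}

/-- The volume of a form in Darboux position relative to the angular directions does not depend on
its values on the momentum directions. -/
lemma abs_pf_adapted (ξ : Module.Basis (Fin m) ℝ (Fin m → ℝ))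
    {B : Model m →ₗ[ℝ] Model m →ₗ[ℝ] ℝ} (hskew : ∀ v w, B v w = -B w v)
    (hB : ∀ θ w, B ((splitModel m).symm (θ, 0)) w = -∑ i, ξ.repr θ i * (splitModel m w).2 i) :
    |pf (fun a b => B (stdVec a) (stdVec b))|
      = |pf (fun a b : Fin (2 * m) =>
        -∑ i, ξ.repr (splitModel m (stdVec a)).1 i * (splitModel m (stdVec b)).2 i
        + ∑ i, ξ.repr (splitModel m (stdVec b)).1 i * (splitModel m (stdVec a)).2 i)| := by
  set Λ := splitModel m with hΛ
  let s : Model m →ₗ[ℝ] Model m := Λ.symm.toLinearMap ∘ₗ LinearMap.inr ℝ (Fin m → ℝ) (Fin m → ℝ) ∘ₗ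
    LinearMap.snd ℝ (Fin m → ℝ) (Fin m → ℝ) ∘ₗ Λ.toLinearMap
  have hs : ∀ v, s v = Λ.symm (0, (Λ v).2) := fun v => rfl
  let κ : Fin m → Model m := fun i => Λ.symm (0, Pi.single i 1)
  have hsκ : ∀ w, s w = ∑ i, (Λ w).2 i • κ i := by
    intro w
    apply Λ.injective
    simp only [hs, κ, map_sum, map_smul, ContinuousLinearEquiv.apply_symm_apply]
    refine Prod.ext ?_ ?_
    · simp [Prod.fst_sum]
    · funext j
      simp [Prod.snd_sum, Finset.sum_apply, Pi.single_apply]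
  -- `N` sends momentum directions to angular ones so that `B(Nv, w) = -½ B(sv, sw)`, with `s` the
  -- projection to the momentum part. Both arguments contribute, so the factor ½ makes `1 + N`
  -- remove the momentum block exactly.
  let N : Model m →ₗ[ℝ] Model m :=
    ∑ i, (((1 / 2 : ℝ) • (B.flip (κ i) ∘ₗ s)).smulRight (Λ.symm (ξ i, 0)))
  have hN : ∀ v, N v = ∑ i, ((1 / 2 : ℝ) * B (s v) (κ i)) • Λ.symm (ξ i, 0) := by
    intro v
    simp [N]
  have hΛN : ∀ v, (Λ (N v)).2 = 0 := by
    intro v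
    rw [hN, map_sum, Prod.snd_sum]
    exact Finset.sum_eq_zero fun i _ => by simp
  have hsN : ∀ v, s (N v) = 0 := fun v => by
    rw [hs, hΛN]
    exact map_zero Λ.symm
  have hBN : ∀ v w, B (N v) w = -(1 / 2) * B (s v) (s w) := by
    intro v w
    rw [hN, hsκ w]
    simp only [map_sum, map_smul, LinearMap.sum_apply, LinearMap.smul_apply, hB, smul_eq_mul,
      Module.Basis.repr_self, Finset.mul_sum]
    refine Finset.sum_congr rfl fun i _ => ?_
    rw [Finset.sum_eq_single i (fun j _ hj => by simp [hj.symm]) (by simp)]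
    simp
    ring
  have hBwN : ∀ v w, B v (N w) = -(1 / 2) * B (s v) (s w) := by
    intro v w
    rw [hskew, hBN, hskew (s v)]
    ring
  have hNN : ∀ v, N (N v) = 0 := by
    intro v
    rw [hN, hsN]
    simp
  -- Reflection changing the sign of the momentum directions; it conjugates `1 + N` to its inverse
  -- `1 - N`.
  let D : Model m →ₗ[ℝ] Model m := LinearMap.id - (2 : ℝ) • s
  have hss : ∀ v, s (s v) = s v := fun v => by simp [hs]
  have hdet := abs_det_one_add (N := N) (D := D) hNN
    (fun v => by
      simp only [D, LinearMap.sub_apply, LinearMap.id_apply, LinearMap.smul_apply, map_sub, map_smul,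
        hss]
      module)
    (fun v => by simp [D, hsN])
    (fun v => by
      rw [hN, hN, ← Finset.sum_neg_distrib]
      refine Finset.sum_congr rfl fun i _ => ?_
      simp only [D, LinearMap.sub_apply, LinearMap.id_apply, LinearMap.smul_apply, map_sub, map_smul,
        hss, smul_eq_mul]
      module)
  have hpf := pf_comp B (LinearMap.id + N)
  have key : ∀ v w, B ((LinearMap.id + N : Model m →ₗ[ℝ] Model m) v)
      ((LinearMap.id + N : Model m →ₗ[ℝ] Model m) w)
      = -∑ i, ξ.repr (Λ v).1 i * (Λ w).2 i + ∑ i, ξ.repr (Λ w).1 i * (Λ v).2 i := by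
    intro v w
    have hv : ∀ v, v = s v + Λ.symm ((Λ v).1, 0) := fun v => by
      rw [hs, ← map_add]
      simp
    have h1 : B v w = B (s v) (s w) - ∑ i, ξ.repr (Λ v).1 i * (Λ w).2 i
        + ∑ i, ξ.repr (Λ w).1 i * (Λ v).2 i := by
      have e1 : B v w = B (s v) w + B (Λ.symm ((Λ v).1, 0)) w := by
        conv_lhs => rw [hv v]
        rw [map_add, LinearMap.add_apply]
      have e2 : B (s v) w = B (s v) (s w) + B (s v) (Λ.symm ((Λ w).1, 0)) := by
        conv_lhs => rw [hv w]
        rw [map_add]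
      rw [e1, e2, hB, hskew (s v) (Λ.symm ((Λ w).1, 0)), hB]
      simp only [hs, ContinuousLinearEquiv.apply_symm_apply]
      ring
    simp only [LinearMap.add_apply, LinearMap.id_apply, map_add, hBN, hBwN, h1, hsN, map_zero]
    ring
  rw [show (fun a b : Fin (2 * m) =>
        -∑ i, ξ.repr (Λ (stdVec a)).1 i * (Λ (stdVec b)).2 i
        + ∑ i, ξ.repr (Λ (stdVec b)).1 i * (Λ (stdVec a)).2 i)
      = fun a b => B ((LinearMap.id + N : Model m →ₗ[ℝ] Model m) (stdVec a))
      ((LinearMap.id + N : Model m →ₗ[ℝ] Model m) (stdVec b)) from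
      funext fun a => funext fun b => (key _ _).symm, hpf, abs_mul, hdet, one_mul]

end Shear

/-! ### Vanishing integrals of derivatives -/

section CompactSupport

lemma integral_fderiv_eq_zero {m : ℕ} {u : Model m → ℝ} (hu : ContDiff ℝ 1 u)
    (hc : HasCompactSupport u) (e : Model m) : ∫ y, fderiv ℝ u y e = 0 := by
  have hi : Integrable (fun y => fderiv ℝ u y e) :=
    ((hu.continuous_fderiv (by simp)).clm_apply continuous_const).integrable_of_hasCompactSupport
      (hc.fderiv_apply (𝕜 := ℝ) e)
  have h := integral_mul_fderiv_eq_neg_fderiv_mul_of_integrable (μ := volume) (f := fun _ => (1 : ℝ))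
    (g := u) (v := e) (by simp) (by simpa using hi)
    (by simpa using hu.continuous.integrable_of_hasCompactSupport hc)
    (fun _ _ => differentiableAt_const _) (fun y _ => hu.differentiable (by simp) y)
  simpa using h

end CompactSupport

/-! ### Integration in an adapted parametrization -/

namespace ToricStructure

variable {m : ℕ} {M : Type*} [TopologicalSpace M] [ChartedSpace (Model m) M]
  [IsManifold (𝓡 (2 * m)) ∞ M] [MulAction (Torus m) M]
  {T : ToricStructure m M} {ξ : Module.Basis (Fin m) ℝ (Fin m → ℝ)}
  {ψ : OpenPartialHomeomorph (Model m) M}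

lemma AdaptedParam.mdiff (h : T.AdaptedParam ξ ψ) {y : Model m} (hy : y ∈ ψ.source) :
    MDifferentiableAt 𝓘(ℝ, Model m) (𝓡 (2 * m)) ψ y :=
  (h.param.contMDiffAt hy).mdifferentiableAt (by simp)

lemma AdaptedParam.dmu_mfderiv (h : T.AdaptedParam ξ ψ) {y : Model m} (hy : y ∈ ψ.source)
    (v : Model m) : T.dmu ξ (ψ y) (mfderiv 𝓘(ℝ, Model m) (𝓡 (2 * m)) ψ y v)
      = (splitModel m v).2 :=
  T.dmu_mfderiv ξ (h.mdiff hy)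
    (by filter_upwards [ψ.open_source.mem_nhds hy] with z hz using h.mom z hz) v

lemma AdaptedParam.eventually_mem (_h : T.AdaptedParam ξ ψ) {y : Model m} (hy : y ∈ ψ.source)
    (v : Model m) : ∀ᶠ s : ℝ in 𝓝 0, y + s • v ∈ ψ.source := by
  have hc : ContinuousAt (fun s : ℝ => y + s • v) 0 := by fun_prop
  exact hc.eventually_mem (ψ.open_source.mem_nhds (by simpa using hy))

lemma AdaptedParam.mfderiv_fundMap (h : T.AdaptedParam ξ ψ) {y : Model m} (hy : y ∈ ψ.source)
    (θ : Fin m → ℝ) :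
    mfderiv 𝓘(ℝ, Model m) (𝓡 (2 * m)) ψ y ((splitModel m).symm (θ, 0)) = fundMap (ψ y) θ := by
  refine T.mfderiv_fundMap (h.mdiff hy) ?_
  filter_upwards [h.eventually_mem hy ((splitModel m).symm (θ, 0))] with s hs
  have e : s • (splitModel m).symm (θ, 0) = (splitModel m).symm (s • θ, 0) := by
    rw [← map_smul]
    simp
  rw [e] at hs ⊢
  exact h.trans y hy _ hs

/-- The values of `ω` involving an angular direction are fixed by `ω(K_ξ, ·) = -dμ^ξ`, and the
remaining block does not affect the volume. Hence `v_ω` is a constant multiple of Lebesgue measure.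
-/
lemma AdaptedParam.abs_paramCoeff (h : T.AdaptedParam ξ ψ) :
    ∃ c : ℝ, ∀ y ∈ ψ.source, |paramCoeff T.toSymplecticForm ψ y| = c := by
  refine ⟨|pf (fun a b : Fin (2 * m) =>
        -∑ i, ξ.repr (splitModel m (stdVec a)).1 i * (splitModel m (stdVec b)).2 i
        + ∑ i, ξ.repr (splitModel m (stdVec b)).1 i * (splitModel m (stdVec a)).2 i)|,
    fun y hy => ?_⟩
  refine abs_pf_adapted ξ (B := pullBilin (T.form (ψ y))
    (mfderiv 𝓘(ℝ, Model m) (𝓡 (2 * m)) ψ y)) (fun v w => ?_) (fun θ w => ?_)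
  · exact T.skew (ψ y) _ _
  · have h1 := h.mfderiv_fundMap hy θ
    have h2 := h.dmu_mfderiv hy w
    change (T.form (ψ y) (mfderiv 𝓘(ℝ, Model m) (𝓡 (2 * m)) ψ y ((splitModel m).symm (θ, 0))))
      (mfderiv 𝓘(ℝ, Model m) (𝓡 (2 * m)) ψ y w) = _
    rw [h1, T.form_fundMap_sum ξ, h2]

variable [MeasurableSpace M] [BorelSpace M] [CompactSpace M] [T2Space M] [Nonempty M]

lemma contDiff_indicator_param (hp : SmoothParam ψ) {u : M → ℝ}
    (hu : ContMDiff (𝓡 (2 * m)) 𝓘(ℝ, ℝ) ∞ u) (hs : tsupport u ⊆ ψ.target) :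
    ContDiff ℝ ∞ (ψ.source.indicator (u ∘ ψ)) ∧ HasCompactSupport (ψ.source.indicator (u ∘ ψ)) := by
  have hK : IsCompact (ψ.symm '' tsupport u) :=
    (isClosed_tsupport u).isCompact.image_of_continuousOn (ψ.symm.continuousOn.mono hs)
  have hzero : ∀ y, y ∉ ψ.symm '' tsupport u → ψ.source.indicator (u ∘ ψ) y = 0 := by
    intro y hy
    by_cases hys : y ∈ ψ.source
    · rw [indicator_of_mem hys]
      by_contra hne
      exact hy ⟨ψ y, subset_tsupport u hne, ψ.left_inv hys⟩
    · exact indicator_of_notMem hys _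
  refine ⟨contDiff_iff_contDiffAt.2 fun y => ?_, HasCompactSupport.intro hK hzero⟩
  by_cases hys : y ∈ ψ.source
  · have h1 : ContDiffAt ℝ ∞ (u ∘ ψ) y :=
      ((hu (ψ y)).comp y (hp.contMDiffAt hys)).contDiffAt
    refine h1.congr_of_eventuallyEq ?_
    filter_upwards [ψ.open_source.mem_nhds hys] with z hz using indicator_of_mem hz _
  · have hyK : y ∉ ψ.symm '' tsupport u := by
      rintro ⟨x, hx, rfl⟩
      exact hys (ψ.map_target (hs hx))
    refine (contDiffAt_const (c := (0 : ℝ))).congr_of_eventuallyEq ?_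
    filter_upwards [hK.isClosed.isOpen_compl.mem_nhds hyK] with z hz using hzero z hz

lemma AdaptedParam.integral_fderiv (h : T.AdaptedParam ξ ψ) {u : M → ℝ}
    (hu : ContMDiff (𝓡 (2 * m)) 𝓘(ℝ, ℝ) ∞ u) (hs : tsupport u ⊆ ψ.target) (e : Model m) :
    ∫ x in ψ.target, fderiv ℝ (u ∘ ψ) (ψ.symm x) e ∂T.vol = 0 := by
  obtain ⟨c, hc⟩ := h.abs_paramCoeff
  obtain ⟨h1, h2⟩ := contDiff_indicator_param h.param hu hs
  rw [vol_restrict _ h.param, paramVol]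
  have hd : ((volume.restrict ψ.source).withDensity
      fun y => ENNReal.ofReal |paramCoeff T.toSymplecticForm ψ y|)
      = ENNReal.ofReal c • volume.restrict ψ.source := by
    rw [← withDensity_const]
    refine withDensity_congr_ae ?_
    filter_upwards [ae_restrict_mem ψ.open_source.measurableSet] with y hy
    rw [hc y hy]
  have haem := aemeasurable_param ψ
    (fun y => ENNReal.ofReal |paramCoeff T.toSymplecticForm ψ y|)
  have hcont : ContinuousOn (fun x => fderiv ℝ (u ∘ ψ) (ψ.symm x) e) ψ.target := by
    have h3 : ContinuousOn (fun x => fderiv ℝ (ψ.source.indicator (u ∘ ψ)) (ψ.symm x) e) ψ.target :=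
      ((h1.continuous_fderiv (by simp)).comp_continuousOn ψ.symm.continuousOn).clm_apply
        continuousOn_const
    refine h3.congr fun x hx => ?_
    have : u ∘ ψ =ᶠ[𝓝 (ψ.symm x)] ψ.source.indicator (u ∘ ψ) := by
      filter_upwards [ψ.open_source.mem_nhds (ψ.map_target hx)] with z hz
      exact (indicator_of_mem hz _).symm
    simp only [this.fderiv_eq]
  have hmeas : AEStronglyMeasurable (fun x => fderiv ℝ (u ∘ ψ) (ψ.symm x) e)
      (Measure.map ψ ((volume.restrict ψ.source).withDensity
        fun y => ENNReal.ofReal |paramCoeff T.toSymplecticForm ψ y|)) := by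
    have := hcont.aestronglyMeasurable (μ := T.vol) ψ.open_target.measurableSet
    rwa [vol_restrict _ h.param, paramVol] at this
  rw [integral_map haem hmeas, hd, integral_smul_measure]
  have h4 : ∫ y in ψ.source, fderiv ℝ (u ∘ ψ) (ψ.symm (ψ y)) e
      = ∫ y in ψ.source, fderiv ℝ (ψ.source.indicator (u ∘ ψ)) y e := by
    refine setIntegral_congr_fun ψ.open_source.measurableSet fun y hy => ?_
    have : u ∘ ψ =ᶠ[𝓝 y] ψ.source.indicator (u ∘ ψ) := by
      filter_upwards [ψ.open_source.mem_nhds hy] with z hz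
      exact (indicator_of_mem hz _).symm
    simp only [ψ.left_inv hy, this.fderiv_eq]
  have h5 : ∫ y in ψ.source, fderiv ℝ (ψ.source.indicator (u ∘ ψ)) y e
      = ∫ y, fderiv ℝ (ψ.source.indicator (u ∘ ψ)) y e := by
    refine setIntegral_eq_integral_of_forall_compl_eq_zero fun y hy => ?_
    have hy' : y ∉ tsupport (ψ.source.indicator (u ∘ ψ)) := by
      intro hmem
      have hK : IsCompact (ψ.symm '' tsupport u) :=
        (isClosed_tsupport u).isCompact.image_of_continuousOn (ψ.symm.continuousOn.mono hs)
      have hsub : tsupport (ψ.source.indicator (u ∘ ψ)) ⊆ ψ.symm '' tsupport u := by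
        refine closure_minimal (fun z hz => ?_) hK.isClosed
        have hzs : z ∈ ψ.source := mem_of_indicator_ne_zero hz
        rw [Function.mem_support, indicator_of_mem hzs] at hz
        exact ⟨ψ z, subset_tsupport u hz, ψ.left_inv hzs⟩
      obtain ⟨x, hx, rfl⟩ := hsub hmem
      exact hy (ψ.map_target (hs hx))
    rw [(notMem_tsupport_iff_eventuallyEq.1 hy').fderiv_eq]
    simp
  rw [h4, h5, integral_fderiv_eq_zero (h1.of_le (by simp)) h2, smul_zero]

end ToricStructure

/-! ### Divergence of invariant fields with constant momentum part -/

namespace ToricStructure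

variable {m : ℕ} {M : Type*} [TopologicalSpace M] [ChartedSpace (Model m) M]
  [IsManifold (𝓡 (2 * m)) ∞ M] [MulAction (Torus m) M]

/-- Invariant fields on the locally free locus with constant components in the momentum
directions. -/
structure MomField (T : ToricStructure m M) (ξ : Module.Basis (Fin m) ℝ (Fin m → ℝ)) (i : Fin m)
    (X : (x : M) → TangentSpace (𝓡 (2 * m)) x) : Prop where
  smooth : ∀ x ∈ locFree m M, SmoothVFAt X x
  inv : ∀ x ∈ locFree m M, ∀ t : Torus m, tangentMapAt m (fun y : M => t • y) x (X x) = X (t • x)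
  mom : ∀ x ∈ locFree m M, T.dmu ξ x (X x) = Pi.single i 1

section Angle

variable (ξ : Module.Basis (Fin m) ℝ (Fin m → ℝ)) (ψ : OpenPartialHomeomorph (Model m) M)

/-- The angle coordinates of a parametrization. -/
def angle (j : Fin m) (x : M) : ℝ := ξ.repr (splitModel m (ψ.symm x)).1 j

/-- The angle coordinates as linear functions on the model. -/
def angleL (j : Fin m) : Model m →L[ℝ] ℝ :=
  ((Finsupp.lapply j ∘ₗ ξ.repr.toLinearMap ∘ₗ LinearMap.fst ℝ (Fin m → ℝ) (Fin m → ℝ) ∘ₗ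
    (splitModel m).toLinearMap) : Model m →ₗ[ℝ] ℝ).toContinuousLinearMap

lemma angleL_apply (j : Fin m) (v : Model m) : angleL ξ j v = ξ.repr (splitModel m v).1 j := rfl

variable {T : ToricStructure m M} {ξ ψ}

lemma AdaptedParam.contMDiffAt_angle (h : T.AdaptedParam ξ ψ) (j : Fin m) {x : M}
    (hx : x ∈ ψ.target) : ContMDiffAt (𝓡 (2 * m)) 𝓘(ℝ, ℝ) ∞ (angle ξ ψ j) x :=
  (angleL ξ j).contMDiff.contMDiffAt.comp x (h.param.contMDiffAt_symm hx)

/-- The chain rule in a parametrization. -/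
lemma AdaptedParam.dif_mfderiv (h : T.AdaptedParam ξ ψ) {y : Model m} (hy : y ∈ ψ.source)
    {u : M → ℝ} (hu : MDifferentiableAt (𝓡 (2 * m)) 𝓘(ℝ, ℝ) u (ψ y)) (v : Model m) :
    dif m u (ψ y) (mfderiv 𝓘(ℝ, Model m) (𝓡 (2 * m)) ψ y v) = fderiv ℝ (u ∘ ψ) y v := by
  have h1 := mfderiv_comp_apply y hu (h.mdiff hy) v
  rw [mfderiv_eq_fderiv] at h1
  exact h1.symm

lemma AdaptedParam.dif_angle (h : T.AdaptedParam ξ ψ) {y : Model m} (hy : y ∈ ψ.source)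
    (j : Fin m) (v : Model m) :
    dif m (angle ξ ψ j) (ψ y) (mfderiv 𝓘(ℝ, Model m) (𝓡 (2 * m)) ψ y v)
      = ξ.repr (splitModel m v).1 j := by
  rw [h.dif_mfderiv hy ((h.contMDiffAt_angle j (ψ.map_source hy)).mdifferentiableAt (by simp))]
  have e : angle ξ ψ j ∘ ψ =ᶠ[𝓝 y] angleL ξ j := by
    filter_upwards [ψ.open_source.mem_nhds hy] with z hz
    simp [angle, angleL_apply, ψ.left_inv hz]
  rw [e.fderiv_eq, ContinuousLinearMap.fderiv]
  rfl

lemma AdaptedParam.angle_smul (h : T.AdaptedParam ξ ψ) {y : Model m} (hy : y ∈ ψ.source)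
    (j : Fin m) (θ : Fin m → ℝ) (hθ : y + (splitModel m).symm (θ, 0) ∈ ψ.source) :
    angle ξ ψ j (torusExp θ • ψ y) = angle ξ ψ j (ψ y) + ξ.repr θ j := by
  rw [← h.trans y hy θ hθ, angle, angle, ψ.left_inv hθ, ψ.left_inv hy]
  simp

variable {i : Fin m} {X : (x : M) → TangentSpace (𝓡 (2 * m)) x}

lemma AdaptedParam.contMDiffAt_coeff (h : T.AdaptedParam ξ ψ) (hX : T.MomField ξ i X) (j : Fin m)
    {x : M} (hx : x ∈ ψ.target) :
    ContMDiffAt (𝓡 (2 * m)) 𝓘(ℝ, ℝ) ∞ (fun z => dif m (angle ξ ψ j) z (X z)) x :=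
  SmoothVFAt.dif (h.contMDiffAt_angle j hx) (hX.smooth x (h.target_subset hx))

/-- Torus translation changes the angle coordinates by constants, so their differentials are locally
invariant; as `X` is invariant too, the angular components of `X` do not vary along orbits. -/
lemma AdaptedParam.dif_coeff_fundMap (h : T.AdaptedParam ξ ψ) (hX : T.MomField ξ i X) (j : Fin m)
    {y : Model m} (hy : y ∈ ψ.source) (ζ : Fin m → ℝ) :
    dif m (fun z => dif m (angle ξ ψ j) z (X z)) (ψ y) (fundMap (ψ y) ζ) = 0 := by
  set α : M → ℝ := fun z => dif m (angle ξ ψ j) z (X z) with hα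
  have hinv : ∀ θ : Fin m → ℝ, y + (splitModel m).symm (θ, 0) ∈ ψ.source →
      α (torusExp θ • ψ y) = α (ψ y) := by
    intro θ hθ
    have hx := h.target_subset (ψ.map_source hy)
    have hev : (fun z => angle ξ ψ j (torusExp θ • z)) =ᶠ[𝓝 (ψ y)]
        fun z => angle ξ ψ j z + ξ.repr θ j := by
      have h1 : ∀ᶠ z in 𝓝 (ψ y), ψ.symm z + (splitModel m).symm (θ, 0) ∈ ψ.source := by
        have hc : ContinuousAt (fun z => ψ.symm z + (splitModel m).symm (θ, 0)) (ψ y) :=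
          (ψ.symm.continuousAt (ψ.map_source hy)).add continuousAt_const
        refine hc.eventually_mem (ψ.open_source.mem_nhds ?_)
        rwa [ψ.left_inv hy]
      filter_upwards [h1, ψ.open_target.mem_nhds (ψ.map_source hy)] with z hz1 hz2
      have := h.angle_smul (ψ.map_target hz2) j θ hz1
      rwa [ψ.right_inv hz2] at this
    have htx : torusExp θ • ψ y ∈ ψ.target := by
      rw [← h.trans y hy θ hθ]
      exact ψ.map_source hθ
    have h2 := mfderiv_comp_apply (ψ y)
      ((h.contMDiffAt_angle j htx).mdifferentiableAt (by simp))
      (T.mdifferentiableAt_smul (torusExp θ) (ψ y)) (X (ψ y))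
    have hd := ((h.contMDiffAt_angle j (ψ.map_source hy)).mdifferentiableAt (by simp)).hasMFDerivAt
    have h3 : mfderiv (𝓡 (2 * m)) 𝓘(ℝ, ℝ) (fun z => angle ξ ψ j z + ξ.repr θ j) (ψ y)
        = mfderiv (𝓡 (2 * m)) 𝓘(ℝ, ℝ) (angle ξ ψ j) (ψ y) := by
      have := hd.add (hasMFDerivAt_const (I := 𝓡 (2 * m)) (I' := 𝓘(ℝ, ℝ)) (ξ.repr θ j) (ψ y))
      have h4 := this.mfderiv
      refine h4.trans ?_
      exact add_zero (M := Model m →L[ℝ] ℝ) _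
    have h5 : mfderiv (𝓡 (2 * m)) 𝓘(ℝ, ℝ) (angle ξ ψ j ∘ fun z => torusExp θ • z) (ψ y)
        = mfderiv (𝓡 (2 * m)) 𝓘(ℝ, ℝ) (angle ξ ψ j) (ψ y) := hev.mfderiv_eq.trans h3
    rw [h5] at h2
    have h6 : α (torusExp θ • ψ y) = dif m (angle ξ ψ j) (torusExp θ • ψ y)
        (tangentMapAt m (fun z : M => torusExp θ • z) (ψ y) (X (ψ y))) := by
      rw [hX.inv _ hx]
    rw [h6]
    exact h2.symm
  have hαd : MDifferentiableAt (𝓡 (2 * m)) 𝓘(ℝ, ℝ) α (ψ y) :=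
    (h.contMDiffAt_coeff hX j (ψ.map_source hy)).mdifferentiableAt (by simp)
  rw [← h.mfderiv_fundMap hy ζ, h.dif_mfderiv hy hαd]
  have hfd : DifferentiableAt ℝ (α ∘ ψ) y :=
    (hαd.comp y (h.mdiff hy)).differentiableAt
  rw [← hfd.lineDeriv_eq_fderiv]
  have hc : (fun s : ℝ => (α ∘ ψ) (y + s • (splitModel m).symm (ζ, 0))) =ᶠ[𝓝 0]
      fun _ => α (ψ y) := by
    filter_upwards [h.eventually_mem hy ((splitModel m).symm (ζ, 0))] with s hs
    have e : s • (splitModel m).symm (ζ, 0) = (splitModel m).symm (s • ζ, 0) := by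
      rw [← map_smul]
      simp
    rw [e] at hs ⊢
    rw [Function.comp_apply, h.trans y hy _ hs, hinv _ hs]
  rw [lineDeriv, hc.deriv_eq, deriv_const]

/-- `X` and the coordinate field `∂/∂b_i` have the same momentum components, so they differ by an
orbit vector, whose coefficients are the angle differentials of `X`. -/
lemma AdaptedParam.dif_momField (h : T.AdaptedParam ξ ψ) (hX : T.MomField ξ i X)
    {y : Model m} (hy : y ∈ ψ.source) {w : M → ℝ}
    (hw : MDifferentiableAt (𝓡 (2 * m)) 𝓘(ℝ, ℝ) w (ψ y)) :
    dif m w (ψ y) (X (ψ y))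
      = ∑ j, dif m (angle ξ ψ j) (ψ y) (X (ψ y)) * dif m w (ψ y) (fundMap (ψ y) (ξ j))
        + fderiv ℝ (w ∘ ψ) y ((splitModel m).symm (0, Pi.single i 1)) := by
  set e := (splitModel m).symm (0, Pi.single i 1)
  have hx := h.target_subset (ψ.map_source hy)
  obtain ⟨ζ, hζ⟩ := T.exists_fundMap_of_dmu_eq_zero ξ hx
    (v := X (ψ y) - mfderiv 𝓘(ℝ, Model m) (𝓡 (2 * m)) ψ y e) (by
      rw [map_sub, hX.mom _ hx, h.dmu_mfderiv hy]
      simp [e])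
  have hXe : X (ψ y) = fundMap (ψ y) ζ + mfderiv 𝓘(ℝ, Model m) (𝓡 (2 * m)) ψ y e := by
    rw [hζ]
    exact (sub_add_cancel _ _).symm
  have hα : ∀ j, dif m (angle ξ ψ j) (ψ y) (X (ψ y)) = ξ.repr ζ j := by
    intro j
    rw [hXe, ← h.mfderiv_fundMap hy ζ, map_add, h.dif_angle hy, h.dif_angle hy]
    simp [e]
  simp only [hα]
  rw [hXe, map_add, h.dif_mfderiv hy hw]
  congr 1
  conv_lhs => rw [← ξ.sum_repr ζ]
  simp only [map_sum, map_smul, smul_eq_mul]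

end Angle

section Integration

variable {T : ToricStructure m M} {ξ : Module.Basis (Fin m) ℝ (Fin m → ℝ)}
  {ψ : OpenPartialHomeomorph (Model m) M} {i : Fin m} {X : (x : M) → TangentSpace (𝓡 (2 * m)) x}
  [MeasurableSpace M] [BorelSpace M] [CompactSpace M] [T2Space M] [Nonempty M]

lemma AdaptedParam.integrableOn_fderiv (h : T.AdaptedParam ξ ψ) {u : M → ℝ}
    (hu : ContMDiff (𝓡 (2 * m)) 𝓘(ℝ, ℝ) ∞ u) (hs : tsupport u ⊆ ψ.target) (e : Model m) :
    IntegrableOn (fun x => fderiv ℝ (u ∘ ψ) (ψ.symm x) e) ψ.target T.vol := by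
  have := isFiniteMeasure_vol T.toSymplecticForm
  obtain ⟨h1, h2⟩ := contDiff_indicator_param h.param hu hs
  have hc : Continuous (fun y => fderiv ℝ (ψ.source.indicator (u ∘ ψ)) y e) :=
    (h1.continuous_fderiv (by simp)).clm_apply continuous_const
  obtain ⟨C, hC⟩ := (h2.fderiv_apply (𝕜 := ℝ) e).exists_bound_of_continuous hc
  have hcont : ContinuousOn (fun x => fderiv ℝ (ψ.source.indicator (u ∘ ψ)) (ψ.symm x) e)
      ψ.target := hc.comp_continuousOn ψ.symm.continuousOn
  have hi : IntegrableOn (fun x => fderiv ℝ (ψ.source.indicator (u ∘ ψ)) (ψ.symm x) e) ψ.target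
      T.vol := Integrable.of_bound
        (hcont.aestronglyMeasurable ψ.open_target.measurableSet) C (.of_forall fun x => hC _)
  refine hi.congr_fun (fun x hx => ?_) ψ.open_target.measurableSet
  have : u ∘ ψ =ᶠ[𝓝 (ψ.symm x)] ψ.source.indicator (u ∘ ψ) := by
    filter_upwards [ψ.open_source.mem_nhds (ψ.map_target hx)] with z hz
    exact (indicator_of_mem hz _).symm
  simp only [this.fderiv_eq]

/-- Since `α_j = dθ_j(X)` satisfies `dα_j(K_j) = 0`, one has `α_j dw(K_j) = d(α_j w)(K_j)`. The
integrand becomes a sum of coordinate derivatives of compactly supported functions, integrated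
against a constant density. -/
lemma AdaptedParam.integral_momField (h : T.AdaptedParam ξ ψ) (hX : T.MomField ξ i X) {w : M → ℝ}
    (hw : ContMDiff (𝓡 (2 * m)) 𝓘(ℝ, ℝ) ∞ w) (hs : tsupport w ⊆ ψ.target) :
    ∫ x, dif m w x (X x) ∂T.vol = 0 := by
  let u : Fin m → M → ℝ := fun j x => dif m (angle ξ ψ j) x (X x) * w x
  have hus : ∀ j, tsupport (u j) ⊆ ψ.target := fun j =>
    (tsupport_mul_subset_right (f := fun x => dif m (angle ξ ψ j) x (X x)) (g := w)).trans hs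
  have hu : ∀ j, ContMDiff (𝓡 (2 * m)) 𝓘(ℝ, ℝ) ∞ (u j) := by
    intro j x
    by_cases hx : x ∈ ψ.target
    · exact (h.contMDiffAt_coeff hX j hx).mul (hw x)
    · have hx' : x ∉ tsupport (u j) := fun h' => hx (hus j h')
      exact (contMDiffAt_const (c := (0 : ℝ))).congr_of_eventuallyEq
        (notMem_tsupport_iff_eventuallyEq.1 hx')
  have hset : ∫ x, dif m w x (X x) ∂T.vol = ∫ x in ψ.target, dif m w x (X x) ∂T.vol := by
    refine (setIntegral_eq_integral_of_forall_compl_eq_zero fun x hx => ?_).symm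
    rw [dif_eq_zero_of_notMem fun h' => hx (hs h')]
    rfl
  have key : ∀ x ∈ ψ.target, dif m w x (X x)
      = ∑ j, fderiv ℝ (u j ∘ ψ) (ψ.symm x) ((splitModel m).symm (ξ j, 0))
        + fderiv ℝ (w ∘ ψ) (ψ.symm x) ((splitModel m).symm (0, Pi.single i 1)) := by
    intro x hx
    obtain ⟨y, hy, rfl⟩ : ∃ y ∈ ψ.source, ψ y = x := ⟨ψ.symm x, ψ.map_target hx, ψ.right_inv hx⟩
    have hwd : MDifferentiableAt (𝓡 (2 * m)) 𝓘(ℝ, ℝ) w (ψ y) := hw.mdifferentiable (by simp) _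
    rw [ψ.left_inv hy, h.dif_momField hX hy hwd]
    congr 1
    refine Finset.sum_congr rfl fun j _ => ?_
    rw [← h.dif_mfderiv hy ((hu j).mdifferentiable (by simp) _), h.mfderiv_fundMap hy]
    have hα : MDifferentiableAt (𝓡 (2 * m)) 𝓘(ℝ, ℝ) (fun z => dif m (angle ξ ψ j) z (X z)) (ψ y) :=
      (h.contMDiffAt_coeff hX j (ψ.map_source hy)).mdifferentiableAt (by simp)
    have h0 := h.dif_coeff_fundMap hX j hy (ξ j)
    have h1 := congrArg (fun B : Model m →L[ℝ] ℝ => B (fundMap (ψ y) (ξ j)))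
      (hα.hasMFDerivAt.mul hwd.hasMFDerivAt).mfderiv
    have h2 : dif m (u j) (ψ y) (fundMap (ψ y) (ξ j))
        = dif m (angle ξ ψ j) (ψ y) (X (ψ y)) * dif m w (ψ y) (fundMap (ψ y) (ξ j))
          + w (ψ y) * dif m (fun z => dif m (angle ξ ψ j) z (X z)) (ψ y) (fundMap (ψ y) (ξ j)) := h1
    rw [h2, h0, mul_zero, add_zero]
  rw [hset, setIntegral_congr_fun ψ.open_target.measurableSet key, integral_add, integral_finsetSum]
  · simp only [h.integral_fderiv (hu _) (hus _), h.integral_fderiv hw hs, Finset.sum_const_zero,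
      add_zero]
  · exact fun j _ => h.integrableOn_fderiv (hu j) (hus j) _
  · exact integrable_finsetSum _ fun j _ => h.integrableOn_fderiv (hu j) (hus j) _
  · exact h.integrableOn_fderiv hw hs _

lemma MomField.continuous_dif (hX : T.MomField ξ i X) {w : M → ℝ}
    (hw : ContMDiff (𝓡 (2 * m)) 𝓘(ℝ, ℝ) ∞ w) (hs : tsupport w ⊆ locFree m M) :
    Continuous (fun x => dif m w x (X x)) := by
  rw [continuous_iff_continuousAt]
  intro x
  by_cases hx : x ∈ tsupport w
  · exact (SmoothVFAt.dif (hw x) (hX.smooth x (hs hx))).continuousAt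
  · refine (continuousAt_const (y := (0 : ℝ))).congr ?_
    filter_upwards [(isClosed_tsupport w).isOpen_compl.mem_nhds hx] with z hz
    rw [dif_eq_zero_of_notMem hz]
    rfl

/-- Invariant fields with constant momentum components have vanishing divergence. -/
lemma MomField.integral_dif (hX : T.MomField ξ i X) {w : M → ℝ}
    (hw : ContMDiff (𝓡 (2 * m)) 𝓘(ℝ, ℝ) ∞ w) (hs : tsupport w ⊆ locFree m M) :
    ∫ x, dif m w x (X x) ∂T.vol = 0 := by
  have := isFiniteMeasure_vol T.toSymplecticForm
  have : Nonempty (OpenPartialHomeomorph (Model m) M) :=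
    ⟨(chartAt (Model m) (Classical.arbitrary M)).symm⟩
  choose! P hP hPx using fun x (hx : x ∈ locFree m M) => T.exists_adaptedParam ξ hx
  obtain ⟨t, ht, hcov⟩ := (isClosed_tsupport w).isCompact.elim_nhds_subcover (fun x => (P x).target)
    (fun x hx => (P x).open_target.mem_nhds (hPx x (hs hx)))
  let c : Fin t.card → M := fun k => (t.equivFin.symm k).1
  have hc : ∀ k, c k ∈ t := fun k => (t.equivFin.symm k).2
  -- The pieces `ρ_k w` are in general not invariant, so their momentum derivatives depend on the
  -- chosen vector. The single field `X`, used on all pieces, is what makes the localization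
  -- legitimate.
  obtain ⟨ρ, hρ⟩ := SmoothPartitionOfUnity.exists_isSubordinate (𝓡 (2 * m)) (isClosed_tsupport w)
    (fun k => (P (c k)).target) (fun k => (P (c k)).open_target) (fun z hz => by
      obtain ⟨x, hx, hzx⟩ := mem_iUnion₂.1 (hcov hz)
      refine mem_iUnion.2 ⟨t.equivFin ⟨x, hx⟩, ?_⟩
      simpa [c] using hzx)
  have hρw : ∀ k, ContMDiff (𝓡 (2 * m)) 𝓘(ℝ, ℝ) ∞ (fun x => ρ k x * w x) := fun k =>
    (ρ k).contMDiff.mul hw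
  have hsum : w = ∑ k, fun x => ρ k x * w x := by
    funext x
    rw [Finset.sum_apply, ← Finset.sum_mul]
    by_cases hx : x ∈ tsupport w
    · have := ρ.sum_eq_one hx
      rw [finsum_eq_sum_of_fintype] at this
      rw [this, one_mul]
    · rw [image_eq_zero_of_notMem_tsupport hx, mul_zero]
  have hdif : ∀ x, dif m w x (X x) = ∑ k, dif m (fun x => ρ k x * w x) x (X x) := by
    intro x
    have h0 : ∀ k, HasMFDerivAt (𝓡 (2 * m)) 𝓘(ℝ, ℝ) (fun x => ρ k x * w x) x
        (dif m (fun x => ρ k x * w x) x) := fun k =>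
      ((hρw k).mdifferentiable (by simp) x).hasMFDerivAt
    have h1 : HasMFDerivAt (𝓡 (2 * m)) 𝓘(ℝ, ℝ) (∑ k, fun x => ρ k x * w x) x
        (∑ k, (dif m (fun x => ρ k x * w x) x : Model m →L[ℝ] ℝ)) := by
      apply HasMFDerivAt.sum
      intro k _
      exact h0 k
    have h2 : mfderiv (𝓡 (2 * m)) 𝓘(ℝ, ℝ) w x
        = ∑ k, (dif m (fun x => ρ k x * w x) x : Model m →L[ℝ] ℝ) := by
      conv_lhs => rw [hsum]
      exact h1.mfderiv
    have h3 := congrArg (fun B : Model m →L[ℝ] ℝ => B (X x)) h2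
    refine h3.trans ?_
    exact sum_apply Finset.univ (fun k => (dif m (fun x => ρ k x * w x) x : Model m →L[ℝ] ℝ)) (X x)
  simp only [hdif]
  have hsupp : ∀ k, tsupport (fun x => ρ k x * w x) ⊆ (P (c k)).target := fun k =>
    (tsupport_mul_subset_left (f := fun x => ρ k x) (g := w)).trans (hρ k)
  have hsupp' : ∀ k, tsupport (fun x => ρ k x * w x) ⊆ locFree m M := fun k =>
    (tsupport_mul_subset_right (f := fun x => ρ k x) (g := w)).trans hs
  rw [integral_finsetSum _ fun k _ =>
    (hX.continuous_dif (hρw k) (hsupp' k)).integrable_of_hasCompactSupport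
      (HasCompactSupport.of_compactSpace _)]
  exact Finset.sum_eq_zero fun k _ =>
    (hP (c k) (hs (ht _ (hc k)))).integral_momField hX (hρw k) (hsupp k)

end Integration

end ToricStructure

/-! ### Integration by parts in the momentum directions -/

namespace ToricStructure

variable {m : ℕ} {M : Type*} [TopologicalSpace M] [ChartedSpace (Model m) M]
  [IsManifold (𝓡 (2 * m)) ∞ M] [MulAction (Torus m) M]
  (T : ToricStructure m M) (ξ : Module.Basis (Fin m) ℝ (Fin m → ℝ))

lemma GAK.form_re_pos {T : ToricStructure m M} {K : CEndo m M} (hK : T.GAK K) {x : M}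
    {v : TangentSpace (𝓡 (2 * m)) x} (hv : v ≠ 0) : 0 < T.form x v (K.re x v) := by
  have := (T.pos_iff K x).1 (hK.pos x) v 0 (Or.inl hv)
  simpa using this

lemma contMDiffAt_dmu {X : (x : M) → TangentSpace (𝓡 (2 * m)) x} {x : M} (hX : SmoothVFAt X x)
    (k : Fin m) : ContMDiffAt (𝓡 (2 * m)) 𝓘(ℝ, ℝ) ∞ (fun y => T.dmu ξ y (X y) k) x :=
  SmoothVFAt.dif (T.contMDiffAt_momCoord ξ k x) hX

lemma dmu_smul (t : Torus m) (x : M) (v : TangentSpace (𝓡 (2 * m)) x) :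
    T.dmu ξ (t • x) (tangentMapAt m (fun y : M => t • y) x v) = T.dmu ξ x v := by
  funext k
  exact T.dif_smul t (.of_forall fun y => T.invFun_mom (ξ k) t y) (T.mdifferentiableAt_mom (ξ k) _) v

/-- The fields `A K_j`, `A = Re K`, are invariant and smooth. The matrix `dμ^k(A K_j)` is
invertible, since a kernel vector would give an orbit vector `v ≠ 0` with `ω(v, Av) = 0` against
positivity. Its inverse normalizes them. -/
lemma GAK.exists_momField {T : ToricStructure m M} {K : CEndo m M} (hK : T.GAK K) (i : Fin m) :
    ∃ X, T.MomField ξ i X := by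
  let A := K.re
  have hAi := ((T.invariant_iff K).1 hK.invariant).1
  let G : M → Matrix (Fin m) (Fin m) ℝ := fun x => Matrix.of fun k j =>
    T.dmu ξ x (A x (fundMap x (ξ j))) k
  have hvf : ∀ j x, SmoothVFAt (fun y => A y (fundMap y (ξ j))) x := fun j x =>
    SmoothEndAt.apply (hK.smooth.1 x) (T.smoothVFAt_fundMap (ξ j) x)
  have hG : ∀ x k j, ContMDiffAt (𝓡 (2 * m)) 𝓘(ℝ, ℝ) ∞ (fun y => G y k j) x := fun x k j =>
    T.contMDiffAt_dmu ξ (hvf j x) k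
  have hdet : ∀ x ∈ locFree m M, (G x).det ≠ 0 := by
    intro x hx h0
    obtain ⟨c, hc, hc0⟩ := Matrix.exists_mulVec_eq_zero_iff.2 h0
    set v := fundMap x (∑ j, c j • ξ j) with hv
    have hvz : v ≠ 0 := by
      intro h
      have h1 := (injective_iff_map_eq_zero _).1 hx _ h
      exact hc (funext fun j => (Fintype.linearIndependent_iff.1 ξ.linearIndependent c h1 j))
    have h2 : T.dmu ξ x (A x v) = 0 := by
      rw [← hc0]
      funext k
      simp only [hv, map_sum, map_smul, Matrix.mulVec, dotProduct, G, Matrix.of_apply,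
        Finset.sum_apply, Pi.smul_apply, smul_eq_mul]
      exact Finset.sum_congr rfl fun j _ => mul_comm _ _
    have h3 := hK.form_re_pos hvz
    rw [hv, T.form_fundMap_sum ξ, ← hv, show K.re x v = A x v from rfl, h2] at h3
    simp at h3
  have hGi : ∀ (x : M) (t : Torus m), G (t • x) = G x := by
    intro x t
    ext k j
    simp only [G, Matrix.of_apply]
    rw [← T.tangentMap_fundMap, hAi t x, T.dmu_smul]
  refine ⟨fun x => ∑ j, (G x)⁻¹ j i • A x (fundMap x (ξ j)), fun x hx => ?_, fun x hx t => ?_,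
    fun x hx => ?_⟩
  · exact SmoothVFAt.sum _ fun j _ => (hvf j x).smul
      (contMDiffAt_matrix_inv (hG x) (hdet x hx) j i)
  · rw [map_sum]
    simp only [map_smul, hGi, ← T.tangentMap_fundMap]
    refine Finset.sum_congr rfl fun j _ => ?_
    rw [hAi t x]
  · funext k
    have h1 : G x * (G x)⁻¹ = 1 := Matrix.mul_nonsing_inv _ (isUnit_iff_ne_zero.2 (hdet x hx))
    have h2 := congrFun (congrFun h1 k) i
    rw [Matrix.mul_apply, Matrix.one_apply] at h2
    simp only [map_sum, map_smul, Finset.sum_apply, Pi.smul_apply, smul_eq_mul, Pi.single_apply]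
    rw [← h2]
    exact Finset.sum_congr rfl fun j _ => mul_comm _ _

lemma Adm.mul {f h : M → ℝ} (hf : Adm m f) (hh : SmoothInv m h) : Adm m (fun x => f x * h x) := by
  have hs : tsupport (fun x => f x * h x) ⊆ tsupport f := tsupport_mul_subset_left
  refine ⟨fun x => ?_, fun t x => ?_, hs.trans hf.supp⟩
  · by_cases hx : x ∈ tsupport f
    · exact (hf.smooth x).mul (hh.smooth x (hf.supp hx))
    · exact (contMDiffAt_const (c := (0 : ℝ))).congr_of_eventuallyEq
        (notMem_tsupport_iff_eventuallyEq.1 fun h' => hx (hs h'))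
  · by_cases hx : x ∈ tsupport f
    · simp only [hf.inv t x, hh.inv x (hf.supp hx) t]
    · simp only [hf.inv t x, image_eq_zero_of_notMem_tsupport hx, zero_mul]

lemma momPartial_mul {f h : M → ℝ} {x : M} (hf : MDifferentiableAt (𝓡 (2 * m)) 𝓘(ℝ, ℝ) f x)
    (hh : MDifferentiableAt (𝓡 (2 * m)) 𝓘(ℝ, ℝ) h x) (i : Fin m) :
    T.momPartial ξ i (fun y => f y * h y) x
      = f x * T.momPartial ξ i h x + T.momPartial ξ i f x * h x := by
  have h1 := congrArg (fun B : Model m →L[ℝ] ℝ => B (T.momFrame ξ i x))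
    (hf.hasMFDerivAt.mul hh.hasMFDerivAt).mfderiv
  have h2 : T.momPartial ξ i (fun y => f y * h y) x
    = f x * T.momPartial ξ i h x + h x * T.momPartial ξ i f x := h1
  rw [h2]
  ring

section Integration

variable [MeasurableSpace M] [BorelSpace M] [CompactSpace M] [T2Space M] [Nonempty M]

lemma Adm.integrable {f : M → ℝ} (hf : Adm m f) : Integrable f T.vol := by
  have := isFiniteMeasure_vol T.toSymplecticForm
  exact hf.smooth.continuous.integrable_of_hasCompactSupport (HasCompactSupport.of_compactSpace _)

variable {T ξ}

/-- On an invariant function the field `X` and the pointwise choice `momFrame` have the same effect,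
so the vanishing integral for `X` applies. -/
lemma GAK.integral_momPartial {K : CEndo m M} (hK : T.GAK K) {f : M → ℝ} (hf : Adm m f)
    (i : Fin m) : ∫ x, T.momPartial ξ i f x ∂T.vol = 0 := by
  obtain ⟨X, hX⟩ := hK.exists_momField ξ i
  rw [← hX.integral_dif hf.smooth hf.supp]
  congr 1
  funext x
  by_cases hx : x ∈ tsupport f
  · exact (T.dif_eq_momPartial ξ (hf.supp hx) (fun t => hf.inv t x)
      (hf.smooth.mdifferentiable (by simp) x) (hX.mom x (hf.supp hx))).symm
  · rw [T.momPartial_eq_zero_of_notMem ξ hx, dif_eq_zero_of_notMem hx]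
    rfl

/-- Integration by parts in the momentum directions. -/
lemma GAK.integral_mul_momPartial {K : CEndo m M} (hK : T.GAK K) {f h : M → ℝ} (hf : Adm m f)
    (hh : SmoothInv m h) (i : Fin m) :
    ∫ x, f x * T.momPartial ξ i h x ∂T.vol = -∫ x, T.momPartial ξ i f x * h x ∂T.vol := by
  have h0 := hK.integral_momPartial (ξ := ξ) (hf.mul hh) i
  have e : ∀ x, T.momPartial ξ i (fun y => f y * h y) x
      = f x * T.momPartial ξ i h x + T.momPartial ξ i f x * h x := by
    intro x
    by_cases hx : x ∈ tsupport f
    · exact T.momPartial_mul ξ (hf.smooth.mdifferentiable (by simp) x) (hh.mdiff (hf.supp hx)) i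
    · rw [T.momPartial_eq_zero_of_notMem ξ fun h' => hx (tsupport_mul_subset_left h'),
        image_eq_zero_of_notMem_tsupport hx, T.momPartial_eq_zero_of_notMem ξ hx]
      simp
  simp only [e] at h0
  rw [integral_add ((hf.mul (hh.momPartial T ξ i)).integrable T)
    (((hf.momPartial T ξ i).mul hh).integrable T)] at h0
  linarith

lemma GAK.integral_mul_momPartial₂ {K : CEndo m M} (hK : T.GAK K) {f h : M → ℝ} (hf : Adm m f)
    (hh : SmoothInv m h) (i j : Fin m) :
    ∫ x, f x * T.momPartial ξ i (T.momPartial ξ j h) x ∂T.vol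
      = ∫ x, T.momPartial ξ j (T.momPartial ξ i f) x * h x ∂T.vol := by
  rw [hK.integral_mul_momPartial hf (hh.momPartial T ξ j),
    hK.integral_mul_momPartial (hf.momPartial T ξ i) hh, neg_neg]

end Integration

lemma contMDiff_Q_re {K : CEndo m M} (hs : K.Smooth) (i j : Fin m) :
    ContMDiff (𝓡 (2 * m)) 𝓘(ℝ, ℝ) ∞ (fun x => (T.Q ξ K i j x).re) := by
  intro x
  have : (fun x => (T.Q ξ K i j x).re)
      = fun x => T.form x (K.re x (fundMap x (ξ i))) (fundMap x (ξ j)) := by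
    funext x
    rw [Q_re, T.fundMap_apply, T.fundMap_apply]
  rw [this]
  exact SmoothVFAt.form (SmoothEndAt.apply (hs.1 x) (T.smoothVFAt_fundMap (ξ i) x))
    (T.smoothVFAt_fundMap (ξ j) x)

lemma Q_re_smul {K : CEndo m M} (hi : K.Invariant) (i j : Fin m) (t : Torus m) (x : M) :
    (T.Q ξ K i j (t • x)).re = (T.Q ξ K i j x).re := by
  have h := ((T.invariant_iff K).1 hi).1
  rw [Q_re, Q_re, ← T.fundMap_apply, ← T.fundMap_apply, ← T.fundMap_apply, ← T.fundMap_apply,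
    ← T.tangentMap_fundMap, ← T.tangentMap_fundMap, h t x, T.form_invariant]

lemma smoothInv_Q_re {K : CEndo m M} (hs : K.Smooth) (hi : K.Invariant) (i j : Fin m) :
    SmoothInv m (fun x => (T.Q ξ K i j x).re) :=
  ⟨fun x _ => T.contMDiff_Q_re ξ hs i j x, fun x _ t => T.Q_re_smul ξ hi i j t x⟩

lemma SmoothInv.sum {ι : Type*} (s : Finset ι) {u : ι → M → ℝ} (hu : ∀ i ∈ s, SmoothInv m (u i)) :
    SmoothInv m (fun x => ∑ i ∈ s, u i x) :=
  ⟨fun x hx => contMDiffAt_finsetSum fun i hi => (hu i hi).smooth x hx,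
    fun x hx t => Finset.sum_congr rfl fun i hi => (hu i hi).inv x hx t⟩

lemma smoothInv_sum_momPartial {q : Fin m → Fin m → M → ℝ} (hq : ∀ i j, SmoothInv m (q i j)) :
    SmoothInv m (fun x => ∑ i, ∑ j, T.momPartial ξ i (T.momPartial ξ j (q i j)) x) :=
  SmoothInv.sum _ fun i _ => SmoothInv.sum _ fun j _ =>
    ((hq i j).momPartial T ξ j).momPartial T ξ i

/-! ### The moment map after integration by parts -/

section Moment

variable [MeasurableSpace M] [BorelSpace M] [CompactSpace M] [T2Space M] [Nonempty M]
variable {T ξ}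

lemma CompactZeroMean.eq_zero {f : M → ℝ} (hf : T.CompactZeroMean f) {x : M}
    (hx : x ∉ freeLocus m M) : f x = 0 :=
  image_eq_zero_of_notMem_tsupport fun h => hx (hf.support h)

lemma CompactZeroMean.integral_freeLocus {f : M → ℝ} (hf : T.CompactZeroMean f) (u : M → ℝ) :
    ∫ x in freeLocus m M, f x * u x ∂T.vol = ∫ x, f x * u x ∂T.vol :=
  setIntegral_eq_integral_of_forall_compl_eq_zero fun x hx => by rw [hf.eq_zero hx, zero_mul]

lemma integrable_mul_uGK {K : CEndo m M} (hs : K.Smooth) (hi : K.Invariant) {f : M → ℝ}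
    (hf : Adm m f) : Integrable (fun x => f x * T.uGK ξ K x) T.vol :=
  (hf.mul (T.smoothInv_sum_momPartial ξ fun i j => T.smoothInv_Q_re ξ hs hi i j)).integrable T

/-- The moment map without derivatives of `K`. -/
lemma GAK.nu_eq {K₀ : CEndo m M} (hK₀ : T.GAK K₀) {K : CEndo m M} (hs : K.Smooth)
    (hi : K.Invariant) {f : M → ℝ} (hf : T.CompactZeroMean f) :
    T.nu ξ f K = -∫ x, ∑ i, ∑ j, T.momPartial ξ j (T.momPartial ξ i f) x * (T.Q ξ K i j x).re
      ∂T.vol := by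
  have hq := fun i j => T.smoothInv_Q_re ξ hs hi i j
  rw [nu, hf.integral_freeLocus]
  simp only [uGK, Finset.mul_sum]
  rw [integral_finsetSum _ fun i _ => integrable_finsetSum _ fun j _ =>
    (hf.adm.mul (((hq i j).momPartial T ξ j).momPartial T ξ i)).integrable T,
    integral_finsetSum _ fun i _ => integrable_finsetSum _ fun j _ =>
    (((hf.adm.momPartial T ξ i).momPartial T ξ j).mul (hq i j)).integrable T]
  congr 1
  refine Finset.sum_congr rfl fun i _ => ?_
  rw [integral_finsetSum _ fun j _ =>
    (hf.adm.mul (((hq i j).momPartial T ξ j).momPartial T ξ i)).integrable T,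
    integral_finsetSum _ fun j _ =>
    (((hf.adm.momPartial T ξ i).momPartial T ξ j).mul (hq i j)).integrable T]
  exact Finset.sum_congr rfl fun j _ => hK₀.integral_mul_momPartial₂ hf.adm (hq i j) i j

end Moment

end ToricStructure

/-! ### Differentiation under the integral -/

section ParametricIntegral

variable {m : ℕ} {M : Type*} [TopologicalSpace M] [ChartedSpace (Model m) M]
  [IsManifold (𝓡 (2 * m)) ∞ M]

lemma contMDiff_slice {G : ℝ × M → ℝ} (hG : ContMDiff (𝓘(ℝ, ℝ).prod (𝓡 (2 * m))) 𝓘(ℝ, ℝ) ∞ G)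
    (x : M) : ContDiff ℝ ∞ (fun s => G (s, x)) :=
  (hG.comp (contMDiff_id.prodMk contMDiff_const)).contDiff

/-- The derivative in the parameter of a smooth function on `ℝ × M` is continuous. -/
lemma continuous_deriv_param {G : ℝ × M → ℝ}
    (hG : ContMDiff (𝓘(ℝ, ℝ).prod (𝓡 (2 * m))) 𝓘(ℝ, ℝ) ∞ G) :
    Continuous (fun p : ℝ × M => deriv (fun s => G (s, p.2)) p.1) := by
  rw [continuous_iff_continuousAt]
  rintro ⟨s₀, x₀⟩
  set c := chartAt (Model m) x₀ with hc
  have hsrc : x₀ ∈ c.source := mem_chart_source _ x₀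
  let H : ℝ × Model m → ℝ := fun q => G (q.1, c.symm q.2)
  have hU : IsOpen (univ ×ˢ c.target : Set (ℝ × Model m)) := isOpen_univ.prod c.open_target
  have hH : ContDiffOn ℝ ∞ H (univ ×ˢ c.target) := by
    have h1 : ContMDiffOn (𝓘(ℝ, ℝ).prod 𝓘(ℝ, Model m)) (𝓘(ℝ, ℝ).prod (𝓡 (2 * m))) ∞
        (fun q : ℝ × Model m => (q.1, c.symm q.2)) (univ ×ˢ c.target) :=
      contMDiff_fst.contMDiffOn.prodMk ((contMDiffOn_chart_symm' x₀).comp contMDiff_snd.contMDiffOn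
        fun q hq => hq.2)
    have h2 := hG.comp_contMDiffOn h1
    rw [← modelWithCornersSelf_prod, chartedSpaceSelf_prod] at h2
    exact contMDiffOn_iff_contDiffOn.1 h2
  have hcont : ContinuousAt (fun p : ℝ × M => fderiv ℝ H (p.1, c p.2) (1, 0)) (s₀, x₀) := by
    have h3 : ContinuousAt (fderiv ℝ H) (s₀, c x₀) :=
      (hH.continuousOn_fderiv_of_isOpen hU (by simp)).continuousAt
        (hU.mem_nhds ⟨mem_univ _, c.map_source hsrc⟩)
    have h4 : ContinuousAt (fun p : ℝ × M => (p.1, c p.2)) (s₀, x₀) :=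
      continuousAt_fst.prodMk ((c.continuousAt hsrc).comp continuousAt_snd)
    exact (ContinuousAt.comp (f := fun p : ℝ × M => (p.1, c p.2)) h3 h4).clm_apply
      continuousAt_const
  refine hcont.congr ?_
  have : ∀ᶠ p : ℝ × M in 𝓝 (s₀, x₀), p.2 ∈ c.source :=
    continuousAt_snd.eventually_mem (c.open_source.mem_nhds hsrc)
  filter_upwards [this] with p hp
  have hd : DifferentiableAt ℝ H (p.1, c p.2) :=
    (hH.contDiffAt (hU.mem_nhds ⟨mem_univ _, c.map_source hp⟩)).differentiableAt (by simp)
  have hl : HasDerivAt (fun s : ℝ => (s, c p.2)) ((1 : ℝ), (0 : Model m)) p.1 :=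
    (hasDerivAt_id p.1).prodMk (hasDerivAt_const p.1 (c p.2))
  have h5 := hd.hasFDerivAt.comp_hasDerivAt p.1 hl
  have e : (H ∘ fun s : ℝ => (s, c p.2)) = fun s => G (s, p.2) := by
    funext s
    simp [H, c.left_inv hp]
  rw [e] at h5
  exact h5.deriv.symm

/-- The parameter derivative is continuous, hence bounded on the compact set `[-1, 1] × M`, and a
constant is integrable for a finite measure. -/
lemma hasDerivAt_integral_param [CompactSpace M] [MeasurableSpace M] [BorelSpace M]
    {μ : Measure M} [IsFiniteMeasure μ] {G : ℝ × M → ℝ}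
    (hG : ContMDiff (𝓘(ℝ, ℝ).prod (𝓡 (2 * m))) 𝓘(ℝ, ℝ) ∞ G) :
    HasDerivAt (fun s => ∫ x, G (s, x) ∂μ) (∫ x, deriv (fun s => G (s, x)) 0 ∂μ) 0 := by
  have hc := continuous_deriv_param hG
  obtain ⟨C, hC⟩ := (isCompact_Icc.prod isCompact_univ : IsCompact
    (Icc (-1 : ℝ) 1 ×ˢ (univ : Set M))).exists_bound_of_continuousOn hc.continuousOn
  have hGs : ∀ s, Continuous (fun x => G (s, x)) := fun s =>
    hG.continuous.comp (Continuous.prodMk_right s)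
  refine (hasDerivAt_integral_of_dominated_loc_of_deriv_le (μ := μ) (F := fun s x => G (s, x))
    (F' := fun s x => deriv (fun s => G (s, x)) s) (bound := fun _ => C)
    (Icc_mem_nhds (by norm_num : (-1 : ℝ) < 0) one_pos)
    (.of_forall fun s => (hGs s).aestronglyMeasurable_of_compactSpace)
    ((hGs 0).integrable_of_hasCompactSupport (HasCompactSupport.of_compactSpace _))
    ((hc.comp (Continuous.prodMk_right (0 : ℝ))).aestronglyMeasurable_of_compactSpace)
    (.of_forall fun x s hs => hC (s, x) ⟨hs, mem_univ x⟩) (integrable_const C)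
    (.of_forall fun x s _ =>
      ((contMDiff_slice hG x).differentiable (by simp) s).hasDerivAt)).2

end ParametricIntegral

/-! ### Smooth curves of endomorphism fields -/

section Curves

variable {m : ℕ} {M : Type*} [TopologicalSpace M] [ChartedSpace (Model m) M]
  [IsManifold (𝓡 (2 * m)) ∞ M]

lemma SmoothEndCurve.smoothEnd
    {A : ℝ → (x : M) → TangentSpace (𝓡 (2 * m)) x →L[ℝ] TangentSpace (𝓡 (2 * m)) x}
    (hA : SmoothEndCurve A) (s : ℝ) : SmoothEnd (A s) :=
  ContMDiff.comp (g := fun p : ℝ × M => TotalSpace.mk' (Model m →L[ℝ] Model m)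
      (E := fun y : M => TangentSpace (𝓡 (2 * m)) y →L[ℝ] TangentSpace (𝓡 (2 * m)) y)
      p.2 (A p.1 p.2)) (f := fun x => (s, x)) hA (contMDiff_const.prodMk contMDiff_id)

lemma SmoothEndCurve.contMDiff_form
    {A : ℝ → (x : M) → TangentSpace (𝓡 (2 * m)) x →L[ℝ] TangentSpace (𝓡 (2 * m)) x}
    (hA : SmoothEndCurve A) (σ : SymplecticForm m M) {X Y : (x : M) → TangentSpace (𝓡 (2 * m)) x}
    (hX : ∀ x, SmoothVFAt X x) (hY : ∀ x, SmoothVFAt Y x) :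
    ContMDiff (𝓘(ℝ, ℝ).prod (𝓡 (2 * m))) 𝓘(ℝ, ℝ) ∞
      (fun p : ℝ × M => σ.form p.2 (A p.1 p.2 (X p.2)) (Y p.2)) := by
  rintro ⟨s₀, x₀⟩
  have h1 := ((contMDiffAt_hom_bundle _).1 (hA (s₀, x₀))).2
  have h1' : ContMDiffAt (𝓘(ℝ, ℝ).prod (𝓡 (2 * m))) 𝓘(ℝ, Model m →L[ℝ] Model m) ∞
      (fun p : ℝ × M => tc x₀ p.2 ∘L A p.1 p.2 ∘L tcs x₀ p.2) (s₀, x₀) := h1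
  have hsnd : ContMDiffAt (𝓘(ℝ, ℝ).prod (𝓡 (2 * m))) (𝓡 (2 * m)) ∞ (Prod.snd : ℝ × M → M)
      (s₀, x₀) := contMDiffAt_snd
  have h2 : ContMDiffAt (𝓘(ℝ, ℝ).prod (𝓡 (2 * m))) 𝓘(ℝ, Model m) ∞
      (fun p : ℝ × M => tc x₀ p.2 (X p.2)) (s₀, x₀) :=
    ContMDiffAt.comp (s₀, x₀) (g := fun x => tc x₀ x (X x)) ((smoothVFAt_iff _ _).1 (hX x₀)) hsnd
  have h3 : ContMDiffAt (𝓘(ℝ, ℝ).prod (𝓡 (2 * m))) 𝓘(ℝ, Model m) ∞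
      (fun p : ℝ × M => tc x₀ p.2 (Y p.2)) (s₀, x₀) :=
    ContMDiffAt.comp (s₀, x₀) (g := fun x => tc x₀ x (Y x)) ((smoothVFAt_iff _ _).1 (hY x₀)) hsnd
  have h4 : ContMDiffAt (𝓘(ℝ, ℝ).prod (𝓡 (2 * m))) 𝓘(ℝ, Model m →L[ℝ] Model m →L[ℝ] ℝ) ∞
      (fun p : ℝ × M => coordForm σ x₀ p.2) (s₀, x₀) :=
    ContMDiffAt.comp (s₀, x₀) (g := coordForm σ x₀) (contMDiffAt_coordForm σ x₀) hsnd
  refine ((h4.clm_apply (h1'.clm_apply h2)).clm_apply h3).congr_of_eventuallyEq ?_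
  have : ∀ᶠ p : ℝ × M in 𝓝 (s₀, x₀), p.2 ∈ (chartAt (Model m) x₀).source :=
    continuousAt_snd.eventually (source_nhds (m := m) x₀)
  filter_upwards [this] with p hp
  simp [tcs_tc hp]

end Curves

/-! ### The infinitesimal action as a commutator -/

namespace ToricStructure

variable {m : ℕ} {M : Type*} [TopologicalSpace M] [ChartedSpace (Model m) M]
  [IsManifold (𝓡 (2 * m)) ∞ M] [MulAction (Torus m) M]

/-- The commutator `[R, K]` with the field `R = ∑ K_i ⊗ dF_i`. -/
def twistComm (F : M → Fin m → ℝ) (K : CEndo m M) : CEndo m M where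
  re x := twistEnd F x ∘L K.re x - K.re x ∘L twistEnd F x
  im x := twistEnd F x ∘L K.im x - K.im x ∘L twistEnd F x

lemma commutator_anticomm {R : Type*} [Ring R] {k : R} (h : k * k = -1) (r : R) :
    (r * k - k * r) * k + k * (r * k - k * r) = 0 := by
  have e : (r * k - k * r) * k + k * (r * k - k * r) = r * (k * k) - (k * k) * r := by
    noncomm_ring
  rw [e, h]
  noncomm_ring

lemma twistComm_re_apply (F : M → Fin m → ℝ) (K : CEndo m M) (x : M)
    (v : TangentSpace (𝓡 (2 * m)) x) : (twistComm F K).re x v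
      = twistEnd F x (K.re x v) - K.re x (twistEnd F x v) := rfl

lemma twistComm_im_apply (F : M → Fin m → ℝ) (K : CEndo m M) (x : M)
    (v : TangentSpace (𝓡 (2 * m)) x) : (twistComm F K).im x v
      = twistEnd F x (K.im x v) - K.im x (twistEnd F x v) := rfl

lemma toEnd_twistComm (F : M → Fin m → ℝ) (K : CEndo m M) (x : M) :
    (twistComm F K).toEnd x = (twistEnd F x).toLinearMap.baseChange ℂ * K.toEnd x
      - K.toEnd x * (twistEnd F x).toLinearMap.baseChange ℂ := by
  ext v
  change (CEndo.toEnd (twistComm F K) x) ((1 : ℂ) ⊗ₜ[ℝ] v)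
    = (twistEnd F x).toLinearMap.baseChange ℂ (K.toEnd x ((1 : ℂ) ⊗ₜ[ℝ] v))
      - K.toEnd x ((twistEnd F x).toLinearMap.baseChange ℂ ((1 : ℂ) ⊗ₜ[ℝ] v))
  have hb : ∀ a b, (LinearMap.baseChange ℂ (twistEnd F x).toLinearMap) (cvec a b)
      = cvec (twistEnd F x a) (twistEnd F x b) := fun a b => baseChange_cvec _ a b
  have : (1 : ℂ) ⊗ₜ[ℝ] v = cvec v 0 := by simp [cvec]
  rw [this, toEnd_cvec, toEnd_cvec, hb, hb, toEnd_cvec]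
  simp [twistComm_re_apply, twistComm_im_apply, sub_eq_add_neg, neg_cvec, cvec_add]

variable {T : ToricStructure m M} {F : M → Fin m → ℝ}

lemma Twist.gakTangent_twistComm (hF : T.Twist F) {K : CEndo m M} (hK : T.GAK K) :
    T.GAKTangent K (twistComm F K) := by
  have hi := (T.invariant_iff K).1 hK.invariant
  have hR := endInv_twistEnd T hF.smooth hF.inv
  have hRs := fun x => smoothEndAt_twistEnd T hF.smooth x
  have hsk := (T.conjSkew_iff K).1 hK.conjSkew
  refine ⟨⟨fun x => ?_, fun x => ?_⟩, (T.invariant_iff _).2 ⟨?_, ?_⟩,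
    (T.conjSkew_iff _).2 ⟨fun x v w => ?_, fun x v w => ?_⟩, fun x => ?_⟩
  · exact ((hRs x).comp (hK.smooth.1 x)).sub (SmoothEndAt.comp (hK.smooth.1 x) (hRs x))
  · exact ((hRs x).comp (hK.smooth.2 x)).sub (SmoothEndAt.comp (hK.smooth.2 x) (hRs x))
  · exact (hR.comp hi.1).sub (hi.1.comp hR)
  · exact (hR.comp hi.2).sub (hi.2.comp hR)
  · simp only [twistComm_re_apply, map_sub, _root_.sub_apply, hF.form_twistEnd, hsk.1]
    ring
  · simp only [twistComm_im_apply, map_sub, _root_.sub_apply, hF.form_twistEnd, hsk.2]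
    ring
  · rw [toEnd_twistComm]
    exact commutator_anticomm (hK.sq x) _

lemma hasDerivAt_conj_curve {E : Type*} [NormedAddCommGroup E] [NormedSpace ℝ E]
    (a b c : E) : HasDerivAt (fun s : ℝ => a + s • b - (s * s) • c) b 0 := by
  have h1 : HasDerivAt (fun s : ℝ => s • b) ((1 : ℝ) • b) 0 := (hasDerivAt_id 0).smul_const b
  have h2 : HasDerivAt (fun s : ℝ => (s * s) • c) ((1 * 0 + 0 * 1 : ℝ) • c) 0 :=
    ((hasDerivAt_id (0 : ℝ)).mul (hasDerivAt_id (0 : ℝ))).smul_const c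
  refine ((h1.const_add a).sub h2).congr_deriv ?_
  simp

/-- The curve is an exact quadratic polynomial: `(1 + sR) A (1 - sR) = A + s [R, A] - s² R A R`. -/
lemma Twist.hasVelocity (hF : T.Twist F) {K : CEndo m M} (hK : K.Invariant) :
    CEndo.HasVelocity (fun s => CEndo.push (twistPerm (fun x => s • F x) (hF.const_smul s).inv) K)
      (twistComm F K) := by
  have key : ∀ (A : (x : M) → TangentSpace (𝓡 (2 * m)) x →L[ℝ] TangentSpace (𝓡 (2 * m)) x) (x : M)
      (v : TangentSpace (𝓡 (2 * m)) x) (s : ℝ), twistConj (fun x => s • F x) A x v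
      = A x v + s • (twistEnd F x (A x v) - A x (twistEnd F x v))
        - (s * s) • twistEnd F x (A x (twistEnd F x v)) := by
    intro A x v s
    rw [twistConj_apply, twistEnd_smul s x hF.smooth]
    simp only [smul_apply, map_sub, map_smul, smul_sub, smul_smul]
    abel
  intro x v
  simp only [fun s : ℝ => push_twistPerm (hF.const_smul s) hK, key]
  exact ⟨hasDerivAt_conj_curve (E := Model m) _ _ _, hasDerivAt_conj_curve (E := Model m) _ _ _⟩

end ToricStructure

namespace ToricStructure

variable {m : ℕ} {M : Type*} [TopologicalSpace M] [ChartedSpace (Model m) M]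
  [IsManifold (𝓡 (2 * m)) ∞ M] [MulAction (Torus m) M]

/-! ### The trace pairing with `R` and the Hessian of `f` -/

section Trace

variable (T : ToricStructure m M) (ξ : Module.Basis (Fin m) ℝ (Fin m → ℝ))

/-- This is `d(df) = 0` evaluated on two vectors of the momentum frame. -/
lemma Adm.momPartial_comm {f : M → ℝ} (hf : Adm m f) (i j : Fin m) (x : M) :
    T.momPartial ξ i (T.momPartial ξ j f) x = T.momPartial ξ j (T.momPartial ξ i f) x := by
  by_cases hx : x ∈ tsupport f
  · have h := sum_dif_wedge_symm hf.smooth (fun i => (hf.momPartial T ξ i).smooth)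
      (fun i x => T.contMDiffAt_momCoord ξ i x) (hf.dif_eq_sum T ξ) x
      (T.momFrame ξ i x) (T.momFrame ξ j x)
    have hs : ∀ i k, dif m (fun y => T.momCoord ξ y k) x (T.momFrame ξ i x)
        = (Pi.single i 1 : Fin m → ℝ) k := fun i k =>
      congrFun (T.momFrame_spec ξ (hf.supp hx) i) k
    simp only [hs, Pi.single_apply, mul_ite, mul_one, mul_zero, Finset.sum_ite_eq',
      Finset.mem_univ, if_true] at h
    exact h
  · rw [T.momPartial_eq_zero_of_notMem ξ fun h => hx (T.tsupport_momPartial_subset ξ f j h),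
      T.momPartial_eq_zero_of_notMem ξ fun h => hx (T.tsupport_momPartial_subset ξ f i h)]

/-- `R ∘ A` is a sum of rank-one maps, and the trace of `α ⊗ v` is `α(v)`. Expanding `d(∂f/∂μ^i)` in
the `dμ^j` and using `dμ^j = ω(·, K_j)` gives the double sum. -/
lemma trace_twistEnd_comp {f : M → ℝ} (hf : Adm m f) (x : M)
    (A : TangentSpace (𝓡 (2 * m)) x →L[ℝ] TangentSpace (𝓡 (2 * m)) x) :
    LinearMap.trace ℝ (TangentSpace (𝓡 (2 * m)) x)
      ((twistEnd (T.tgrad ξ f) x).toLinearMap ∘ₗ A.toLinearMap)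
      = ∑ i, ∑ j, T.momPartial ξ j (T.momPartial ξ i f) x
        * T.form x (A (fundMap x (ξ i))) (fundMap x (ξ j)) := by
  have e : (twistEnd (T.tgrad ξ f) x).toLinearMap ∘ₗ A.toLinearMap
      = ∑ i, (((dif m (T.momPartial ξ i f) x).toLinearMap ∘ₗ A.toLinearMap).smulRight
        (fundMap x (ξ i))) := by
    ext v
    have h := T.twistEnd_tgrad ξ hf x (A v)
    simp only [LinearMap.sum_apply, LinearMap.smulRight_apply, LinearMap.comp_apply]
    exact h
  rw [e, map_sum]
  refine Finset.sum_congr rfl fun i _ => ?_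
  rw [LinearMap.trace_smulRight]
  refine ((hf.momPartial T ξ i).dif_eq_sum T ξ x (A (fundMap x (ξ i)))).trans ?_
  refine Finset.sum_congr rfl fun j _ => ?_
  rw [T.skew x (A (fundMap x (ξ i))), T.form_fundMap_basis, neg_neg]

/-- The imaginary part drops out: `ω(B K_i, K_j)` is antisymmetric in `i`, `j` because `B` is
`ω`-selfadjoint, while the Hessian of `f` is symmetric. -/
lemma trace_twist_mul {f : M → ℝ} (hf : Adm m f) {K' : CEndo m M} (hK' : T.ConjSkew K') (x : M) :
    LinearMap.trace ℂ (ℂ ⊗[ℝ] TangentSpace (𝓡 (2 * m)) x)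
      ((twistEnd (T.tgrad ξ f) x).toLinearMap.baseChange ℂ * K'.toEnd x)
      = ((∑ i, ∑ j, T.momPartial ξ j (T.momPartial ξ i f) x * (T.Q ξ K' i j x).re : ℝ) : ℂ) := by
  set R := (twistEnd (T.tgrad ξ f) x).toLinearMap
  have e : (R.baseChange ℂ) * K'.toEnd x
      = (R ∘ₗ (K'.re x).toLinearMap).baseChange ℂ
        + Complex.I • (R ∘ₗ (K'.im x).toLinearMap).baseChange ℂ := by
    rw [LinearMap.baseChange_comp, LinearMap.baseChange_comp]
    ext v
    simp [CEndo.toEnd]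
  have him : ∑ i, ∑ j, T.momPartial ξ j (T.momPartial ξ i f) x
        * T.form x (K'.im x (fundMap x (ξ i))) (fundMap x (ξ j)) = 0 := by
    have hsk := (T.conjSkew_iff K').1 hK'
    have h : ∑ i, ∑ j, T.momPartial ξ j (T.momPartial ξ i f) x
        * T.form x (K'.im x (fundMap x (ξ i))) (fundMap x (ξ j))
        = -∑ i, ∑ j, T.momPartial ξ j (T.momPartial ξ i f) x
        * T.form x (K'.im x (fundMap x (ξ i))) (fundMap x (ξ j)) := by
      conv_lhs => rw [Finset.sum_comm]
      rw [← Finset.sum_neg_distrib]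
      refine Finset.sum_congr rfl fun i _ => ?_
      rw [← Finset.sum_neg_distrib]
      refine Finset.sum_congr rfl fun j _ => ?_
      rw [hf.momPartial_comm T ξ i j, hsk.2, T.skew]
      ring
    linarith
  rw [e, map_add, map_smul, LinearMap.trace_baseChange, LinearMap.trace_baseChange,
    T.trace_twistEnd_comp ξ hf, T.trace_twistEnd_comp ξ hf, him]
  simp only [Q_re, T.fundMap_apply]
  simp

end Trace

/-! ### The hamiltonian action -/

section Hamiltonian

variable {T : ToricStructure m M} {ξ : Module.Basis (Fin m) ℝ (Fin m → ℝ)}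

lemma Twist.comp_symm {F : M → Fin m → ℝ} (hF : T.Twist F) {α : Type*} {f : M → α}
    (hf : InvFun m f) : f ∘ (twistPerm F hF.inv).symm = f := by
  funext x
  exact hf _ _

lemma momPartial_const_mul (c : ℝ) {f : M → ℝ} {x : M}
    (hf : MDifferentiableAt (𝓡 (2 * m)) 𝓘(ℝ, ℝ) f x) (i : Fin m) :
    T.momPartial ξ i (fun y => c * f y) x = c * T.momPartial ξ i f x := by
  have h := congrArg (fun B : Model m →L[ℝ] ℝ => B (T.momFrame ξ i x))
    (hf.hasMFDerivAt.const_smul c).mfderiv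
  exact h

lemma tgrad_const_mul (c : ℝ) {f : M → ℝ} (hf : Adm m f) (x : M) :
    T.tgrad ξ (fun y => c * f y) x = c • T.tgrad ξ f x := by
  simp only [tgrad, momPartial_const_mul c (hf.smooth.mdifferentiable (by simp) x), Finset.smul_sum,
    smul_smul]

lemma CompactZeroMean.const_mul [MeasurableSpace M] {f : M → ℝ} (hf : T.CompactZeroMean f) (c : ℝ) :
    T.CompactZeroMean (fun x => c * f x) :=
  ⟨contMDiff_const.mul hf.smooth, fun t x => by rw [hf.invariant t x],
    (tsupport_mul_subset_right (f := fun _ => c) (g := f)).trans hf.support, by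
      rw [integral_const_mul, hf.zero_mean, mul_zero]⟩

/-- The time-`s` flow of `f` is the time-one flow of `s f`, which is again admissible. -/
lemma CompactZeroMean.twist_mem [T2Space M] [MeasurableSpace M] {f : M → ℝ}
    (hf : T.CompactZeroMean f) (s : ℝ) :
    twistPerm (fun x => s • T.tgrad ξ f x) ((T.twist_tgrad ξ hf.adm).inv.const_smul s) ∈ T.HamC := by
  refine Subgroup.subset_closure ⟨fun x => s * f x, _, hf.const_mul s,
    T.isHamFlow_twist ξ (hf.const_mul s).adm, ?_⟩
  ext x
  change torusExp (s • T.tgrad ξ f x) • x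
    = torusExp ((1 : ℝ) • T.tgrad ξ (fun x => s * f x) x) • x
  rw [one_smul, tgrad_const_mul s hf.adm]

lemma Twist.twistConj_twistConj {F G : M → Fin m → ℝ} (hF : T.Twist F) (hG : T.Twist G)
    (A : (x : M) → TangentSpace (𝓡 (2 * m)) x →L[ℝ] TangentSpace (𝓡 (2 * m)) x) :
    twistConj (fun x => F x + G x) A = twistConj F (twistConj G A) := by
  funext x
  ext v : 1
  have h1 : ∀ v, twistEnd F x (twistEnd G x v) = 0 := fun v =>
    twistEnd_fundMap T hF.smooth hF.inv x _
  have h2 : ∀ v, twistEnd G x (twistEnd F x v) = 0 := fun v =>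
    twistEnd_fundMap T hG.smooth hG.inv x _
  rw [twistConj_apply, twistConj_apply, twistConj_apply, twistEnd_add x hF.smooth hG.smooth]
  simp only [_root_.add_apply, map_sub, map_add, h1, h2, sub_zero, add_zero]
  abel

lemma Q_re_hasDerivAt {γ : ℝ → CEndo m M} {K' : CEndo m M} (hγ : CEndo.HasVelocity γ K')
    (i j : Fin m) (x : M) :
    HasDerivAt (fun s => (T.Q ξ (γ s) i j x).re) (T.Q ξ K' i j x).re 0 := by
  simp only [Q_re]
  let B : Model m →L[ℝ] Model m →L[ℝ] ℝ := T.form x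
  let c : ℝ → Model m := fun s => (γ s).re x (fundField (ξ i) x)
  let c' : Model m := K'.re x (fundField (ξ i) x)
  let w : Model m := fundField (ξ j) x
  have h : HasDerivAt c c' 0 := (hγ x (fundField (ξ i) x)).1
  exact (B.flip w).hasFDerivAt.comp_hasDerivAt (0 : ℝ) h

variable [MeasurableSpace M] [BorelSpace M] [CompactSpace M] [T2Space M] [Nonempty M]

lemma hasDerivAt_nu {f : M → ℝ} (hf : T.CompactZeroMean f) {K K' : CEndo m M} (hK : T.GAK K)
    {γ : ℝ → CEndo m M} (hs : CEndo.SmoothCurve γ) (hi : ∀ s, (γ s).Invariant)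
    (hv : CEndo.HasVelocity γ K') :
    HasDerivAt (fun s => T.nu ξ f (γ s))
      (-∫ x, ∑ i, ∑ j, T.momPartial ξ j (T.momPartial ξ i f) x * (T.Q ξ K' i j x).re ∂T.vol) 0 := by
  have := isFiniteMeasure_vol T.toSymplecticForm
  -- The curve need not stay in `GAK`. Positivity enters only through the field used for integration
  -- by parts, and the base point `K` supplies it for every `γ s`.
  have e : (fun s => T.nu ξ f (γ s)) = fun s => -∫ x, ∑ i, ∑ j,
      T.momPartial ξ j (T.momPartial ξ i f) x * (T.Q ξ (γ s) i j x).re ∂T.vol :=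
    funext fun s => hK.nu_eq ⟨hs.1.smoothEnd s, hs.2.smoothEnd s⟩ (hi s) hf
  rw [e]
  refine HasDerivAt.neg ?_
  have hG : ContMDiff (𝓘(ℝ, ℝ).prod (𝓡 (2 * m))) 𝓘(ℝ, ℝ) ∞ (fun p : ℝ × M => ∑ i, ∑ j,
      T.momPartial ξ j (T.momPartial ξ i f) p.2 * (T.Q ξ (γ p.1) i j p.2).re) := by
    refine contMDiff_finsetSum fun i _ => contMDiff_finsetSum fun j _ => ContMDiff.mul ?_ ?_
    · exact ((hf.adm.momPartial T ξ i).momPartial T ξ j).smooth.comp contMDiff_snd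
    · simp only [Q_re, ← T.fundMap_apply]
      exact hs.1.contMDiff_form T.toSymplecticForm (fun x => T.smoothVFAt_fundMap (ξ i) x)
        (fun x => T.smoothVFAt_fundMap (ξ j) x)
  refine (hasDerivAt_integral_param (μ := T.vol) hG).congr_deriv ?_
  congr 1
  funext x
  have h : HasDerivAt (fun s => ∑ i, ∑ j,
      T.momPartial ξ j (T.momPartial ξ i f) x * (T.Q ξ (γ s) i j x).re)
      (∑ i, ∑ j, T.momPartial ξ j (T.momPartial ξ i f) x * (T.Q ξ K' i j x).re) 0 :=
    HasDerivAt.fun_sum fun i _ => HasDerivAt.fun_sum fun j _ =>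
      (Q_re_hasDerivAt hv i j x).const_mul _
  exact h.deriv

/-- The factor ½ in `Ω` cancels the 2 of `trace_commutator`. -/
lemma Omega_twistComm {f : M → ℝ} (hf : T.CompactZeroMean f) {K K' : CEndo m M} (hK : T.GAK K)
    (hK' : T.GAKTangent K K') : T.Omega K (twistComm (T.tgrad ξ f) K) K'
      = ((∫ x, ∑ i, ∑ j, T.momPartial ξ j (T.momPartial ξ i f) x * (T.Q ξ K' i j x).re ∂T.vol : ℝ)
        : ℂ) := by
  rw [Omega, ← integral_complex_ofReal, ← integral_const_mul]
  congr 1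
  funext x
  rw [toEnd_twistComm, trace_commutator _ _ _ (hK.sq x) (hK'.anticomm x),
    T.trace_twist_mul ξ hf.adm hK'.conjSkew]
  ring

theorem isHamiltonianAction_nu : T.IsHamiltonianAction (T.nu ξ) where
  act_mem φ hφ K hK := by
    obtain ⟨F, hF, rfl⟩ := T.exists_twist_of_mem_HamC hφ
    exact hF.gak hK
  act_one K hK := by
    -- Pushing forward by the identity is the action of the unit of the torus, under which `K` is
    -- invariant.
    have h := hK.invariant 1
    rwa [MulAction.toPerm_one] at h
  act_mul φ hφ ψ hψ K hK := by
    obtain ⟨F, hF, rfl⟩ := T.exists_twist_of_mem_HamC hφ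
    obtain ⟨G, hG, rfl⟩ := T.exists_twist_of_mem_HamC hψ
    rw [twistPerm_mul hF.inv hG.inv (hF.add hG).inv, push_twistPerm (hF.add hG) hK.invariant,
      push_twistPerm hF (hG.gak hK).invariant, push_twistPerm hG hK.invariant,
      hF.twistConj_twistConj hG, hF.twistConj_twistConj hG]
  act_tangent φ hφ K K' hK hK' := by
    obtain ⟨F, hF, rfl⟩ := T.exists_twist_of_mem_HamC hφ
    exact hF.gakTangent hK hK'
  symplectic φ hφ K K₁ K₂ hK hK₁ hK₂ := by
    obtain ⟨F, hF, rfl⟩ := T.exists_twist_of_mem_HamC hφ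
    simp only [Omega, push_twistPerm hF hK.invariant, push_twistPerm hF hK₁.invariant,
      push_twistPerm hF hK₂.invariant, hF.trace_twistConj]
  map_add K hK f g hf hg := by
    simp only [nu, add_mul]
    rw [integral_add (integrable_mul_uGK hK.smooth hK.invariant hf.adm).integrableOn
      (integrable_mul_uGK hK.smooth hK.invariant hg.adm).integrableOn]
    ring
  map_smul K hK c f hf := by
    simp only [nu, mul_assoc]
    rw [integral_const_mul]
    ring
  adjoint_mem φ hφ f hf := by
    obtain ⟨F, hF, rfl⟩ := T.exists_twist_of_mem_HamC hφ
    rwa [hF.comp_symm hf.invariant]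
  equivariant φ hφ f hf K hK := by
    obtain ⟨F, hF, rfl⟩ := T.exists_twist_of_mem_HamC hφ
    rw [hF.comp_symm hf.invariant, push_twistPerm hF hK.invariant]
    simp only [nu, uGK, hF.Q_re_twistConj]
  hamiltonian f hf := by
    have hF := T.twist_tgrad ξ hf.adm
    refine ⟨_, T.isHamFlow_twist ξ hf.adm, fun s => hf.twist_mem s, fun K hK =>
      ⟨twistComm (T.tgrad ξ f) K, hF.gakTangent_twistComm hK, hF.hasVelocity hK.invariant,
        fun K' hK' γ hs hi _ hv => ?_⟩⟩
    -- Both sides are now minus the integral of the Hessian of `f` against `Re Q(K')`.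
    rw [Omega_twistComm hf hK hK', ← Complex.ofReal_neg]
    exact (hasDerivAt_nu hf hK hs hi hv).ofReal_comp

end Hamiltonian

end ToricStructure

namespace ToricStructure

variable {m : ℕ} {M : Type*} [TopologicalSpace M] [ChartedSpace (Model m) M]
  [IsManifold (𝓡 (2 * m)) ∞ M] [MulAction (Torus m) M] {T : ToricStructure m M}
  {J : (x : M) → TangentSpace (𝓡 (2 * m)) x →L[ℝ] TangentSpace (𝓡 (2 * m)) x}

/-! ### The element of `GAK` attached to a tamed complex structure -/

section Tamed

lemma form_symplAdjoint_left (T : ToricStructure m M)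
    (J : (x : M) → TangentSpace (𝓡 (2 * m)) x →L[ℝ] TangentSpace (𝓡 (2 * m)) x) (x : M)
    (v w : TangentSpace (𝓡 (2 * m)) x) :
    T.form x (T.symplAdjoint J x v) w = T.form x v (J x w) := by
  rw [T.skew, T.form_symplAdjoint, ← T.skew]

lemma DGK.symplAdjoint_sq (hJ : T.DGK J) (x : M) (v : TangentSpace (𝓡 (2 * m)) x) :
    T.symplAdjoint J x (T.symplAdjoint J x v) = -v :=
  T.form_ext_right fun w => by
    rw [T.form_symplAdjoint, T.form_symplAdjoint, hJ.sq, map_neg, map_neg, neg_apply]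

/-- Taming gives `ω(v, (J - J^{*_ω}) v) = 2 ω(v, Jv) > 0` for `v ≠ 0`. -/
lemma DGK.isInvertible_sub (hJ : T.DGK J) (x : M) :
    (J x - T.symplAdjoint J x).IsInvertible := by
  have hinj : Function.Injective (J x - T.symplAdjoint J x).toLinearMap := by
    rw [← LinearMap.ker_eq_bot, LinearMap.ker_eq_bot']
    intro v hv
    by_contra h0
    have h1 : T.form x v ((J x - T.symplAdjoint J x) v) = 0 := by
      rw [show (J x - T.symplAdjoint J x) v = 0 from hv, map_zero]
    rw [sub_apply, map_sub, T.form_symplAdjoint, T.skew x (J x v)] at h1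
    linarith [hJ.tamed x v h0]
  exact ⟨(LinearEquiv.ofInjectiveEndo _ hinj).toContinuousLinearEquiv, by ext v; rfl⟩

/-- Substituting `v = (J - J^{*_ω}) u` clears the inverse from identities about `ofTamed`, which
become polynomial in `J` and `J^{*_ω}`. -/
lemma DGK.sub_inverse (hJ : T.DGK J) (x : M) (v : TangentSpace (𝓡 (2 * m)) x) :
    ∃ u, v = J x u - T.symplAdjoint J x u ∧ (J x - T.symplAdjoint J x).inverse v = u := by
  obtain ⟨e, he⟩ := hJ.isInvertible_sub x
  refine ⟨e.symm v, ?_, ?_⟩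
  · have := congrArg (fun B => B (e.symm v)) he
    exact (e.apply_symm_apply v).symm.trans this
  · rw [← he, ContinuousLinearMap.inverse_equiv]
    rfl

lemma DGK.inverse_sub (hJ : T.DGK J) (x : M) (u : TangentSpace (𝓡 (2 * m)) x) :
    (J x - T.symplAdjoint J x).inverse (J x u - T.symplAdjoint J x u) = u := by
  obtain ⟨e, he⟩ := hJ.isInvertible_sub x
  have := congrArg (fun B => B u) he
  rw [← he, ContinuousLinearMap.inverse_equiv]
  exact (congrArg e.symm this.symm).trans (e.symm_apply_apply u)

lemma tangentMap_smul_surjective (T : ToricStructure m M) (t : Torus m) (x : M)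
    (w : TangentSpace (𝓡 (2 * m)) (t • x)) :
    ∃ v, tangentMapAt m (fun y : M => t • y) x v = w := by
  have h := T.tangentMap_smul_inv t (t • x) w
  rw [inv_smul_smul] at h
  exact ⟨_, h⟩

lemma endInv_symplAdjoint (T : ToricStructure m M) (hJ : EndInv J) :
    EndInv (T.symplAdjoint J) := fun t x v => by
  refine T.form_ext_right fun w => ?_
  obtain ⟨w, rfl⟩ := T.tangentMap_smul_surjective t x w
  rw [T.form_symplAdjoint, hJ t x w, T.form_invariant, T.form_invariant, T.form_symplAdjoint]

lemma DGK.endInv (hJ : T.DGK J) : EndInv J := fun t x v => (hJ.invariant t x v).symm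

lemma DGK.endInv_inverse (hJ : T.DGK J) :
    EndInv (fun x => (J x - T.symplAdjoint J x).inverse) := fun t x v => by
  obtain ⟨u, rfl, hu⟩ := hJ.sub_inverse x v
  rw [hu, map_sub, ← hJ.endInv t x, ← T.endInv_symplAdjoint hJ.endInv t x]
  exact hJ.inverse_sub (t • x) _

lemma DGK.smoothEndAt_inverse (hJ : T.DGK J) (x : M) :
    SmoothEndAt (fun x => (J x - T.symplAdjoint J x).inverse) x :=
  SmoothEndAt.inverse (SmoothEndAt.sub (hJ.smooth x) (T.smoothEndAt_symplAdjoint (hJ.smooth x)))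
    hJ.isInvertible_sub

lemma ofTamed_re_apply (T : ToricStructure m M) (x : M) (v : TangentSpace (𝓡 (2 * m)) x) :
    (T.ofTamed J).re x v = -((2 : ℝ) • (J x - T.symplAdjoint J x).inverse v) := rfl

lemma ofTamed_im_apply (T : ToricStructure m M) (x : M) (v : TangentSpace (𝓡 (2 * m)) x) :
    (T.ofTamed J).im x v = -(J x ((J x - T.symplAdjoint J x).inverse v)
      + T.symplAdjoint J x ((J x - T.symplAdjoint J x).inverse v)) := rfl

lemma DGK.smooth_ofTamed (hJ : T.DGK J) : (T.ofTamed J).Smooth :=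
  ⟨fun x => (SmoothEndAt.const_smul 2 (hJ.smoothEndAt_inverse x)).neg,
    fun x => (SmoothEndAt.comp (SmoothEndAt.add (hJ.smooth x)
      (T.smoothEndAt_symplAdjoint (hJ.smooth x))) (hJ.smoothEndAt_inverse x)).neg⟩

lemma DGK.invariant_ofTamed (hJ : T.DGK J) : (T.ofTamed J).Invariant := by
  refine (T.invariant_iff _).2 ⟨fun t x v => ?_, fun t x v => ?_⟩
  · rw [ofTamed_re_apply, ofTamed_re_apply, map_neg, map_smul]
    congr 2
    exact hJ.endInv_inverse t x v
  · rw [ofTamed_im_apply, ofTamed_im_apply, map_neg, map_add, ← hJ.endInv t x,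
      ← T.endInv_symplAdjoint hJ.endInv t x]
    have h := hJ.endInv_inverse t x v
    beta_reduce at h
    rw [h]

lemma DGK.conjSkew_ofTamed (hJ : T.DGK J) : T.ConjSkew (T.ofTamed J) := by
  refine (T.conjSkew_iff _).2 ⟨fun x v w => ?_, fun x v w => ?_⟩
  · obtain ⟨a, rfl, ha⟩ := hJ.sub_inverse x v
    obtain ⟨b, rfl, hb⟩ := hJ.sub_inverse x w
    rw [ofTamed_re_apply, ofTamed_re_apply, ha, hb]
    simp only [map_neg, map_smul, map_sub, neg_apply, smul_apply, sub_apply, smul_eq_mul,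
      T.form_symplAdjoint, T.form_symplAdjoint_left]
    ring
  · obtain ⟨a, rfl, ha⟩ := hJ.sub_inverse x v
    obtain ⟨b, rfl, hb⟩ := hJ.sub_inverse x w
    rw [ofTamed_im_apply, ofTamed_im_apply, ha, hb]
    simp only [map_neg, map_add, map_sub, neg_apply, add_apply, sub_apply,
      T.form_symplAdjoint, T.form_symplAdjoint_left, hJ.sq]
    ring

/-- With `D = J - J^{*_ω}` and `P = J + J^{*_ω}`, both squares being `-1` gives `DP = -PD` and `D² +
P² = -4`. For `A = -2D⁻¹`, `B = -PD⁻¹` these say `AB + BA = 0` and `A² - B² = -1`. -/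
lemma DGK.sq_ofTamed (hJ : T.DGK J) (x : M) :
    (T.ofTamed J).toEnd x * (T.ofTamed J).toEnd x = -1 := by
  refine (toEnd_sq_iff _ x).2 fun v => ?_
  obtain ⟨w, rfl, hw⟩ := hJ.sub_inverse x v
  obtain ⟨u, rfl, hu⟩ := hJ.sub_inverse x w
  have hs : (J x - T.symplAdjoint J x).inverse
      (J x (J x u - T.symplAdjoint J x u) + T.symplAdjoint J x (J x u - T.symplAdjoint J x u))
      = -(J x u + T.symplAdjoint J x u) := by
    rw [← hJ.inverse_sub x (-(J x u + T.symplAdjoint J x u))]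
    congr 1
    simp only [map_sub, map_add, map_neg, hJ.sq, hJ.symplAdjoint_sq]
    abel
  constructor
  · rw [ofTamed_re_apply, ofTamed_re_apply, ofTamed_im_apply, ofTamed_im_apply, hw]
    simp only [map_neg, map_smul]
    rw [hu, hs]
    simp only [map_sub, map_add, map_neg, hJ.sq, hJ.symplAdjoint_sq]
    module
  · rw [ofTamed_re_apply, ofTamed_re_apply, ofTamed_im_apply, ofTamed_im_apply, hw]
    simp only [map_neg, map_smul]
    rw [hu, hs]
    module

lemma DGK.pos_ofTamed (hJ : T.DGK J) (x : M) (U : ℂ ⊗[ℝ] TangentSpace (𝓡 (2 * m)) x) (hU : U ≠ 0) :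
    0 < (T.formC x U (conjC _ ((T.ofTamed J).toEnd x U))).re := by
  refine (T.pos_iff _ x).2 (fun v w hvw => ?_) U hU
  obtain ⟨a, rfl, ha⟩ := hJ.sub_inverse x v
  obtain ⟨b, rfl, hb⟩ := hJ.sub_inverse x w
  rw [ofTamed_re_apply, ofTamed_re_apply, ofTamed_im_apply, ofTamed_im_apply, ha, hb]
  have key : ∀ v, 0 ≤ T.form x v (J x v) := fun v => by
    by_cases h : v = 0
    · simp [h]
    · exact (hJ.tamed x v h).le
  -- This is half the quantity to be shown positive, after substituting `v = (J - J^{*_ω}) a` and `w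
  -- = (J - J^{*_ω}) b`. Both terms vanish only if `a = Jb = J^{*_ω} b`, whence `b = 0` and `a = 0`.
  have h1 : 0 < T.form x (a - J x b) (J x (a - J x b))
      + T.form x (a - T.symplAdjoint J x b) (J x (a - T.symplAdjoint J x b)) := by
    by_cases h : a - J x b = 0
    · refine add_pos_of_nonneg_of_pos (key _) (hJ.tamed x _ fun h' => ?_)
      have hD : J x b - T.symplAdjoint J x b = 0 := by
        rw [← sub_eq_zero.1 h, h']
      have hb0 : b = 0 := by
        rw [← hJ.inverse_sub x b, hD, map_zero]
      have ha0 : a = 0 := by rw [sub_eq_zero.1 h, hb0, map_zero]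
      rw [hb0, ha0] at hvw
      simp at hvw
    · exact add_pos_of_pos_of_nonneg (hJ.tamed x _ h) (key _)
  have e1 := T.skew x (J x a) a
  have e2 := T.skew x (J x b) b
  have e3 := T.skew x b a
  have e4 := T.skew x (J x b) (J x a)
  have e5 := T.skew x (J x b) a
  have e6 := T.skew x (J x a) b
  have e7 := T.form_symplAdjoint J x
  have e8 := T.form_symplAdjoint_left J x
  have e9 : T.form x (T.symplAdjoint J x b) (T.symplAdjoint J x a)
      = -T.form x (T.symplAdjoint J x a) (T.symplAdjoint J x b) := T.skew x _ _
  have e10 : ∀ v w, T.form x (J x v) (T.symplAdjoint J x w) = -T.form x v w := fun v w => by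
    rw [e7, hJ.sq, map_neg, neg_apply]
  have e11 : ∀ v w, T.form x (T.symplAdjoint J x v) (J x w) = -T.form x v w := fun v w => by
    rw [e8, hJ.sq, map_neg]
  have e12 : T.form x a (J x (T.symplAdjoint J x b))
      = T.form x (T.symplAdjoint J x a) (T.symplAdjoint J x b) := (e8 _ _).symm
  simp only [map_neg, map_smul, map_add, map_sub, sub_apply, smul_eq_mul, e10, e11, e12,
    hJ.sq] at h1 ⊢
  rw [e9]
  have e14 := e8 a a
  have e15 := e8 b b
  have e16 := e7 b b
  linarith

lemma DGK.gak_ofTamed (hJ : T.DGK J) : T.GAK (T.ofTamed J) :=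
  ⟨hJ.smooth_ofTamed, hJ.invariant_ofTamed, hJ.sq_ofTamed, hJ.conjSkew_ofTamed, hJ.pos_ofTamed⟩

end Tamed

end ToricStructure

namespace ToricStructure

variable {m : ℕ} {M : Type*} [TopologicalSpace M] [ChartedSpace (Model m) M]
  [IsManifold (𝓡 (2 * m)) ∞ M] [MulAction (Torus m) M] {T : ToricStructure m M}
  (ξ : Module.Basis (Fin m) ℝ (Fin m → ℝ))
  {J : (x : M) → TangentSpace (𝓡 (2 * m)) x →L[ℝ] TangentSpace (𝓡 (2 * m)) x}

/-! ### The anti-diagonal form and the matrix `S` -/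

section Antidiagonal

/-- The matrix `Ψ⁻¹ = (-dμ^i(J K_j))`. -/
def orbitMatrix (T : ToricStructure m M) (ξ : Module.Basis (Fin m) ℝ (Fin m → ℝ))
    (J : (x : M) → TangentSpace (𝓡 (2 * m)) x →L[ℝ] TangentSpace (𝓡 (2 * m)) x) (x : M) :
    Matrix (Fin m) (Fin m) ℝ :=
  Matrix.of fun i j => -T.dmu ξ x (J x (fundMap x (ξ j))) i

lemma Psi_eq (T : ToricStructure m M) (x : M) : T.Psi ξ J x = (T.orbitMatrix ξ J x)⁻¹ := by
  rw [Psi, orbitMatrix]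
  simp only [T.fundMap_apply, dmu_apply]

lemma dmu_J_sum (T : ToricStructure m M) (x : M) (c : Fin m → ℝ) :
    T.dmu ξ x (J x (fundMap x (∑ k, c k • ξ k))) = -(T.orbitMatrix ξ J x).mulVec c := by
  funext i
  simp only [map_sum, map_smul, Finset.sum_apply, Pi.smul_apply, Pi.neg_apply, Matrix.mulVec,
    dotProduct, orbitMatrix, Matrix.of_apply, smul_eq_mul, neg_mul, Finset.sum_neg_distrib, neg_neg]
  exact Finset.sum_congr rfl fun k _ => mul_comm _ _

/-- Since `dμ^i` is the pairing with `K_i`, passing to the `ω`-adjoint transposes the matrix of `dμ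
∘ J` on orbit vectors, and skewness of `ω` reverses its sign. -/
lemma dmu_symplAdjoint_sum (T : ToricStructure m M) (x : M) (c : Fin m → ℝ) :
    T.dmu ξ x (T.symplAdjoint J x (fundMap x (∑ k, c k • ξ k)))
      = (T.orbitMatrix ξ J x).transpose.mulVec c := by
  funext i
  have h : ∀ k, T.dmu ξ x (T.symplAdjoint J x (fundMap x (ξ k))) i = T.orbitMatrix ξ J x k i := by
    intro k
    rw [← neg_neg (T.dmu ξ x _ i), ← T.form_fundMap_basis, T.form_symplAdjoint, T.skew,
      T.form_fundMap_basis, neg_neg]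
    rfl
  simp only [map_sum, map_smul, Finset.sum_apply, Pi.smul_apply, Matrix.mulVec,
    dotProduct, Matrix.transpose_apply, smul_eq_mul, h]
  exact Finset.sum_congr rfl fun k _ => mul_comm _ _

lemma DGK.det_orbitMatrix_ne_zero (hJ : T.DGK J) {x : M} (hx : x ∈ locFree m M) :
    (T.orbitMatrix ξ J x).det ≠ 0 := by
  intro h0
  obtain ⟨c, hc, h1⟩ := Matrix.exists_mulVec_eq_zero_iff.2 h0
  have h2 := T.dmu_J_sum ξ (J := J) x c
  rw [h1, neg_zero] at h2
  have h3 : fundMap x (∑ k, c k • ξ k) ≠ 0 := fun h => by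
    have h4 : ∑ k, c k • ξ k = 0 := hx (by rw [h, map_zero])
    exact hc (funext (Fintype.linearIndependent_iff.1 ξ.linearIndependent c h4))
  have h5 := hJ.tamed x _ h3
  rw [T.form_fundMap_sum ξ, h2] at h5
  simp at h5

lemma mem_orbitDistribution (T : ToricStructure m M) {x : M} {v : TangentSpace (𝓡 (2 * m)) x} :
    v ∈ orbitDistribution m x ↔ ∃ c : Fin m → ℝ, v = fundMap x (∑ k, c k • ξ k) := by
  have h : orbitDistribution m x = LinearMap.range (fundMap (m := m) x).toLinearMap := by
    rw [orbitDistribution]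
    simp only [← T.fundMap_apply]
    rw [show (Set.range fun ζ : Fin m → ℝ => fundMap x ζ)
      = (LinearMap.range (fundMap (m := m) x).toLinearMap : Set _) from
        (LinearMap.coe_range _).symm, Submodule.span_eq]
  rw [h]
  constructor
  · rintro ⟨ζ, rfl⟩
    exact ⟨ξ.repr ζ, by rw [ξ.sum_repr]; rfl⟩
  · rintro ⟨c, rfl⟩
    exact ⟨_, rfl⟩

/-- Take `E` in `J𝒦` with `dμ(E) = e_j`; then `J E` is the orbit vector given by column `j` of `Ψ`.
As `E` also lies in `J^{*_ω}𝒦`, the transposed matrix shows that `J^{*_ω} E` is minus the orbit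
vector given by row `j`. The difference is twice column `j` of `S`. -/
lemma DGK.exists_frame (hJ : T.DGK J) {x : M} (hx : x ∈ locFree m M)
    (ha : x ∈ freeLocus m M) (j : Fin m) :
    ∃ E, T.dmu ξ x E = Pi.single j 1 ∧ J x E - T.symplAdjoint J x E
      = (2 : ℝ) • ∑ k, T.symPsi ξ J x k j • fundMap x (ξ k) := by
  set P := T.orbitMatrix ξ J x with hP
  have hdet : IsUnit P.det := isUnit_iff_ne_zero.2 (hJ.det_orbitMatrix_ne_zero ξ hx)
  set c : Fin m → ℝ := fun k => P⁻¹ k j with hc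
  have hcol : c = P⁻¹.mulVec (Pi.single j 1) := by
    rw [Matrix.mulVec_single_one]; rfl
  refine ⟨-J x (fundMap x (∑ k, c k • ξ k)), ?_, ?_⟩
  · rw [map_neg, T.dmu_J_sum, neg_neg, hcol, Matrix.mulVec_mulVec, Matrix.mul_nonsing_inv _ hdet,
      Matrix.one_mulVec]
  · have hmem : -J x (fundMap x (∑ k, c k • ξ k)) ∈
        (orbitDistribution m x).map (T.symplAdjoint J x).toLinearMap := by
      rw [hJ.antidiagonal x ha]
      exact neg_mem ⟨_, (T.mem_orbitDistribution ξ).2 ⟨c, rfl⟩, rfl⟩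
    obtain ⟨w, hw, hE⟩ := hmem
    obtain ⟨d, rfl⟩ := (T.mem_orbitDistribution ξ).1 hw
    change T.symplAdjoint J x _ = _ at hE
    have h1 : P.transpose.mulVec d = Pi.single j 1 := by
      rw [← T.dmu_symplAdjoint_sum ξ, hE, map_neg, T.dmu_J_sum, neg_neg, hcol,
        Matrix.mulVec_mulVec, Matrix.mul_nonsing_inv _ hdet, Matrix.one_mulVec]
    have h2 : d = P⁻¹.transpose.mulVec (Pi.single j 1) := by
      rw [← h1, Matrix.mulVec_mulVec, ← Matrix.transpose_mul, Matrix.mul_nonsing_inv _ hdet,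
        Matrix.transpose_one, Matrix.one_mulVec]
    have h3 : ∀ k, d k = P⁻¹ j k := fun k => by
      rw [h2, Matrix.mulVec_single_one]; rfl
    have hS : ∀ k, (2 : ℝ) * T.symPsi ξ J x k j = c k + d k := fun k => by
      rw [h3, symPsi, T.Psi_eq]
      simp only [Matrix.smul_apply, Matrix.add_apply, Matrix.transpose_apply, smul_eq_mul, hc, hP]
      ring
    rw [← hE, hJ.symplAdjoint_sq, hE, map_neg, hJ.sq, neg_neg, sub_neg_eq_add, ← map_add,
      ← Finset.sum_add_distrib, map_sum, Finset.smul_sum]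
    refine Finset.sum_congr rfl fun k _ => ?_
    rw [smul_smul, hS, ← add_smul, map_smul]

lemma symPsi_transpose (T : ToricStructure m M) (x : M) :
    (T.symPsi ξ J x).transpose = T.symPsi ξ J x := by
  rw [symPsi, Matrix.transpose_smul, Matrix.transpose_add, Matrix.transpose_transpose, add_comm]

lemma dmu_frame_sum {x : M} {E : Fin m → TangentSpace (𝓡 (2 * m)) x}
    (hE : ∀ j, T.dmu ξ x (E j) = Pi.single j 1) (z : Fin m → ℝ) :
    T.dmu ξ x (∑ k, z k • E k) = z := by
  rw [map_sum]
  simp only [map_smul, hE]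
  funext i
  simp [Pi.single_apply, Finset.sum_apply]

lemma sub_symplAdjoint_frame_sum {x : M} {E : Fin m → TangentSpace (𝓡 (2 * m)) x}
    (hD : ∀ j, J x (E j) - T.symplAdjoint J x (E j)
      = (2 : ℝ) • ∑ k, T.symPsi ξ J x k j • fundMap x (ξ k)) (z : Fin m → ℝ) :
    J x (∑ k, z k • E k) - T.symplAdjoint J x (∑ k, z k • E k)
      = (2 : ℝ) • ∑ l, ((T.symPsi ξ J x).mulVec z) l • fundMap x (ξ l) := by
  simp only [map_sum, map_smul, ← Finset.sum_sub_distrib, ← smul_sub, hD, Matrix.mulVec,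
    dotProduct, Finset.sum_smul, Finset.smul_sum, smul_smul]
  rw [Finset.sum_comm]
  refine Finset.sum_congr rfl fun k _ => Finset.sum_congr rfl fun l _ => ?_
  congr 1
  ring

variable [T2Space M]

lemma DGK.det_symPsi_ne_zero (hJ : T.DGK J) {x : M} (ha : x ∈ freeLocus m M) :
    (T.symPsi ξ J x).det ≠ 0 := by
  choose E hE hD using hJ.exists_frame ξ (T.freeLocus_subset_locFree ha) ha
  intro h0
  obtain ⟨z, hz, h1⟩ := Matrix.exists_mulVec_eq_zero_iff.2 h0
  refine hz ?_
  rw [← dmu_frame_sum ξ hE z, ← hJ.inverse_sub x (∑ k, z k • E k),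
    sub_symplAdjoint_frame_sum ξ hD, h1]
  simp

/-- Solving `(J - J^{*_ω}) ∑ z_k E_k = 2 K_i` gives `z = S⁻¹ e_i`, so `A K_i = -∑ z_k E_k`; pairing
with `K_j` extracts its `j`-th momentum component. -/
lemma DGK.Q_re_ofTamed (hJ : T.DGK J) {x : M} (ha : x ∈ freeLocus m M) (i j : Fin m) :
    (T.Q ξ (T.ofTamed J) i j x).re = -(T.symPsi ξ J x)⁻¹ i j := by
  choose E hE hD using hJ.exists_frame ξ (T.freeLocus_subset_locFree ha) ha
  have hdet : IsUnit (T.symPsi ξ J x).det := isUnit_iff_ne_zero.2 (hJ.det_symPsi_ne_zero ξ ha)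
  set z := (T.symPsi ξ J x)⁻¹.mulVec (Pi.single i 1) with hz
  have h1 : J x (∑ k, z k • E k) - T.symplAdjoint J x (∑ k, z k • E k)
      = (2 : ℝ) • fundMap x (ξ i) := by
    rw [sub_symplAdjoint_frame_sum ξ hD, hz, Matrix.mulVec_mulVec, Matrix.mul_nonsing_inv _ hdet,
      Matrix.one_mulVec, Finset.sum_eq_single i (fun l _ hl => by simp [hl]) (by simp)]
    simp
  have h2 : (T.ofTamed J).re x (fundMap x (ξ i)) = -∑ k, z k • E k := by
    rw [ofTamed_re_apply, ← map_smul, ← h1, hJ.inverse_sub]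
  rw [Q_re, ← T.fundMap_apply, ← T.fundMap_apply, h2, T.skew, T.form_fundMap_basis, map_neg,
    dmu_frame_sum ξ hE, hz, Matrix.mulVec_single_one, neg_neg]
  change -(T.symPsi ξ J x)⁻¹ j i = _
  rw [← Matrix.transpose_apply (T.symPsi ξ J x)⁻¹, Matrix.transpose_nonsing_inv,
    T.symPsi_transpose]

end Antidiagonal

/-! ### Symplectic potentials and derivatives on the polytope -/

section Potential

/-- The domain of a local section of the moment map is an open subset of the image. -/
lemma momCoord_mem_polytopeInterior (T : ToricStructure m M) {x : M} (hx : x ∈ locFree m M) :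
    T.momCoord ξ x ∈ T.polytopeInterior ξ := by
  obtain ⟨B, s, hB, hb, -, -, hs⟩ := T.exists_section ξ hx
  exact mem_interior.2 ⟨B, fun b hb => ⟨s b, hs b hb⟩, hB, hb⟩

lemma contDiffAt_partialD {F : (Fin m → ℝ) → ℝ} {y : Fin m → ℝ} (hF : ContDiffAt ℝ ∞ F y)
    (i : Fin m) : ContDiffAt ℝ ∞ (partialD i F) y :=
  (hF.fderiv_right (m := ∞) (by simp)).clm_apply contDiffAt_const

lemma hess_transpose {τ : (Fin m → ℝ) → ℝ} {y : Fin m → ℝ} (hτ : ContDiffAt ℝ ∞ τ y) :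
    (hess τ y).transpose = hess τ y := by
  have hd : DifferentiableAt ℝ (fderiv ℝ τ) y :=
    (hτ.fderiv_right (m := ∞) (by simp)).differentiableAt (by simp)
  have key : ∀ i j, hess τ y i j = fderiv ℝ (fderiv ℝ τ) y (Pi.single i 1) (Pi.single j 1) := by
    intro i j
    change fderiv ℝ (fun z => fderiv ℝ τ z (Pi.single j 1)) y (Pi.single i 1) = _
    rw [fderiv_clm_apply hd (differentiableAt_const _)]
    simp
  ext i j
  rw [Matrix.transpose_apply, key, key]
  exact (hτ.isSymmSndFDerivAt (by simpa using ENat.LEInfty.out)) _ _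

/-- Symmetrization removes the antisymmetric `C` and keeps the symmetric Hessian. -/
lemma IsSymplecticPotential.symPsi_eq [T2Space M] (hJ : T.DGK J) {τ : (Fin m → ℝ) → ℝ}
    (hτ : T.IsSymplecticPotential ξ J τ) {x : M} (ha : x ∈ freeLocus m M) :
    T.symPsi ξ J x = hess τ (T.momCoord ξ x) := by
  have hx := T.freeLocus_subset_locFree ha
  obtain ⟨hs, C, hC, h⟩ := hτ
  obtain ⟨E, -, hE, -, hK⟩ := h x ha
  set H := hess τ (T.momCoord ξ x)
  have hHt : H.transpose = H := hess_transpose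
    (hs.contDiffAt (isOpen_interior.mem_nhds (T.momCoord_mem_polytopeInterior ξ hx)))
  have hP : T.orbitMatrix ξ J x = (H + C)⁻¹ := by
    ext i j
    rw [orbitMatrix, Matrix.of_apply, T.fundMap_apply, hK, dmu_apply, map_neg, neg_neg, map_sum]
    simp only [map_smul, hE, smul_eq_mul]
    simp
  have hdet := hJ.det_orbitMatrix_ne_zero ξ hx
  rw [hP] at hdet
  have hu : IsUnit (H + C).det := Matrix.isUnit_nonsing_inv_det_iff.1 (isUnit_iff_ne_zero.2 hdet)
  rw [symPsi, T.Psi_eq, hP, Matrix.nonsing_inv_nonsing_inv _ hu, Matrix.transpose_add, hC, hHt]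
  module

lemma momPartial_comp_momCoord (T : ToricStructure m M) {F : (Fin m → ℝ) → ℝ} {x : M}
    (hx : x ∈ locFree m M) (hF : DifferentiableAt ℝ F (T.momCoord ξ x)) (i : Fin m) :
    T.momPartial ξ i (fun y => F (T.momCoord ξ y)) x = partialD i F (T.momCoord ξ x) := by
  have h1 := hF.hasFDerivAt.hasMFDerivAt.comp x
    (hasMFDerivAt_pi (F := T.momCoord ξ) (fun i x => T.contMDiffAt_momCoord ξ i x) x)
  have h2 := congrArg (fun B : Model m →L[ℝ] ℝ => B (T.momFrame ξ i x)) h1.mfderiv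
  refine Eq.trans h2 ?_
  change fderiv ℝ F (T.momCoord ξ x) (T.dmu ξ x (T.momFrame ξ i x)) = _
  rw [T.momFrame_spec ξ hx]
  rfl

lemma momPartial_congr (T : ToricStructure m M) {u v : M → ℝ} {x : M} (h : u =ᶠ[𝓝 x] v)
    (i : Fin m) : T.momPartial ξ i u =ᶠ[𝓝 x] T.momPartial ξ i v := by
  filter_upwards [h.eventually_nhds] with y hy
  have : dif m u y = dif m v y := Filter.EventuallyEq.mfderiv_eq hy
  rw [momPartial, momPartial, this]

lemma momPartial_momPartial_comp_momCoord (T : ToricStructure m M) {F : (Fin m → ℝ) → ℝ} {x : M}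
    (hx : x ∈ locFree m M) (hF : ContDiffAt ℝ ∞ F (T.momCoord ξ x)) (i j : Fin m) :
    T.momPartial ξ i (T.momPartial ξ j (fun y => F (T.momCoord ξ y))) x
      = partialD i (partialD j F) (T.momCoord ξ x) := by
  rw [← T.momPartial_comp_momCoord ξ hx ((contDiffAt_partialD hF j).differentiableAt (by simp))]
  have hc : ContinuousAt (T.momCoord ξ) x :=
    continuousAt_pi.2 fun i => (T.contMDiffAt_momCoord ξ i x).continuousAt
  have hev : ∀ᶠ y in 𝓝 x, DifferentiableAt ℝ F (T.momCoord ξ y) :=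
    hc.eventually (((hF.of_le (m := 1) (by simp)).eventually (by simp)).mono
      fun z hz => hz.differentiableAt (by simp))
  refine (T.momPartial_congr ξ (i := i) ?_).self_of_nhds
  filter_upwards [hev, T.isOpen_locFree.mem_nhds hx] with y h1 h2
  exact T.momPartial_comp_momCoord ξ h2 h1 j

end Potential

/-! ### The moment map on `DGK` -/

section Scalar

variable [MeasurableSpace M] [T2Space M]

/-- Identities known only on the free locus hold near every point where `f ≠ 0`, so they can be
differentiated there. -/
lemma CompactZeroMean.eventually_freeLocus {f : M → ℝ} (hf : T.CompactZeroMean f) {x : M}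
    (hx : f x ≠ 0) : ∀ᶠ y in 𝓝 x, y ∈ freeLocus m M :=
  (hf.smooth.continuous.continuousAt.eventually_ne hx).mono fun _ hy =>
    hf.support (subset_tsupport f hy)

/-- The functions `q` are prescribed only on the free locus, so the statement serves both for the
entries of `S⁻¹` and for the inverse Hessian of a potential pulled back by the moment map. -/
lemma DGK.nu_ofTamed (hJ : T.DGK J) {f : M → ℝ} (hf : T.CompactZeroMean f)
    {q : Fin m → Fin m → M → ℝ}
    (hq : ∀ i j, ∀ x ∈ freeLocus m M, q i j x = (T.symPsi ξ J x)⁻¹ i j) :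
    T.nu ξ f (T.ofTamed J) = ∫ x in freeLocus m M, f x *
      (∑ i, ∑ j, T.momPartial ξ i (T.momPartial ξ j (q i j)) x) ∂T.vol := by
  rw [nu, ← integral_neg]
  congr 1
  funext x
  by_cases hx : f x = 0
  · simp [hx]
  have hev := hf.eventually_freeLocus hx
  have hxL : x ∈ locFree m M := T.freeLocus_subset_locFree hev.self_of_nhds
  rw [uGK, ← mul_neg, ← Finset.sum_neg_distrib]
  congr 1
  refine Finset.sum_congr rfl fun i _ => ?_
  rw [← Finset.sum_neg_distrib]
  refine Finset.sum_congr rfl fun j _ => ?_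
  have hQ := T.smoothInv_Q_re ξ hJ.smooth_ofTamed hJ.invariant_ofTamed i j
  have h1 : q i j =ᶠ[𝓝 x] fun y => (-1) * (T.Q ξ (T.ofTamed J) i j y).re := by
    filter_upwards [hev] with y hy
    rw [hq i j y hy, hJ.Q_re_ofTamed ξ hy]
    simp
  have h2 : T.momPartial ξ j (q i j)
      =ᶠ[𝓝 x] fun y => (-1) * T.momPartial ξ j (fun y => (T.Q ξ (T.ofTamed J) i j y).re) y := by
    refine (T.momPartial_congr ξ h1 j).trans ?_
    filter_upwards [T.isOpen_locFree.mem_nhds hxL] with y hy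
    exact momPartial_const_mul _ (hQ.mdiff hy) j
  rw [(T.momPartial_congr ξ h2 i).self_of_nhds,
    momPartial_const_mul _ ((hQ.momPartial T ξ j).mdiff hxL) i]
  ring

lemma DGK.nu_ofTamed_potential (hJ : T.DGK J) {f : M → ℝ} (hf : T.CompactZeroMean f)
    {τ : (Fin m → ℝ) → ℝ} (hτ : T.IsSymplecticPotential ξ J τ) :
    T.nu ξ f (T.ofTamed J) = ∫ x in freeLocus m M, f x *
      (∑ i, ∑ j, partialD i (partialD j (fun y => (hess τ y)⁻¹ i j)) (T.momCoord ξ x)) ∂T.vol := by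
  rw [hJ.nu_ofTamed ξ hf (q := fun i j x => (hess τ (T.momCoord ξ x))⁻¹ i j)
    fun i j x hx => by rw [hτ.symPsi_eq ξ hJ hx]]
  congr 1
  funext x
  by_cases hx : f x = 0
  · simp [hx]
  have ha : x ∈ freeLocus m M := hf.support (subset_tsupport f hx)
  have hxL : x ∈ locFree m M := T.freeLocus_subset_locFree ha
  have hsm : ContDiffAt ℝ ∞ τ (T.momCoord ξ x) :=
    hτ.1.contDiffAt (isOpen_interior.mem_nhds (T.momCoord_mem_polytopeInterior ξ hxL))
  have hdet : (hess τ (T.momCoord ξ x)).det ≠ 0 := by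
    rw [← hτ.symPsi_eq ξ hJ ha]
    exact hJ.det_symPsi_ne_zero ξ ha
  congr 1
  refine Finset.sum_congr rfl fun i _ => Finset.sum_congr rfl fun j _ => ?_
  refine T.momPartial_momPartial_comp_momCoord ξ hxL
    (F := fun y => (hess τ y)⁻¹ i j) ?_ i j
  exact (contMDiffAt_matrix_inv (I := 𝓘(ℝ, Fin m → ℝ)) (G := hess τ)
    (fun k l => (contDiffAt_partialD (contDiffAt_partialD hsm l) k).contMDiffAt) hdet i j).contDiffAt

end Scalar

end ToricStructure

end ToricGK

end

open ToricGK ToricGK.ToricStructure in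
theorem theorem4p1 {m : ℕ} {M : Type*} [TopologicalSpace M] [T2Space M] [CompactSpace M]
    [ConnectedSpace M] [ChartedSpace (EuclideanSpace ℝ (Fin (2 * m))) M]
    [IsManifold (𝓡 (2 * m)) ∞ M] [MeasurableSpace M] [BorelSpace M]
    [MulAction (Torus m) M] (T : ToricStructure m M)
    (ξ : Module.Basis (Fin m) ℝ (Fin m → ℝ)) :
    T.IsHamiltonianAction (T.nu ξ) ∧
    (∀ f, T.CompactZeroMean f → ∀ K, T.GAK K →
      IntegrableOn (fun x => f x * T.uGK ξ K x) (freeLocus m M) T.vol) ∧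
    (∀ J, T.DGK J → T.GAK (T.ofTamed J) ∧
      ∀ f, T.CompactZeroMean f →
        T.nu ξ f (T.ofTamed J) = ∫ x in freeLocus m M, f x *
          (∑ i, ∑ j, T.momPartial ξ i (T.momPartial ξ j
            (fun y => (T.symPsi ξ J y)⁻¹ i j)) x) ∂T.vol ∧
        ∀ τ, T.IsSymplecticPotential ξ J τ →
          T.nu ξ f (T.ofTamed J) = ∫ x in freeLocus m M, f x *
            (∑ i, ∑ j, partialD i (partialD j
              (fun y => (hess τ y)⁻¹ i j)) (T.momCoord ξ x)) ∂T.vol) := by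
  have : Nonempty M := ConnectedSpace.toNonempty
  exact ⟨isHamiltonianAction_nu,
    fun f hf K hK => (integrable_mul_uGK hK.smooth hK.invariant hf.adm).integrableOn,
    fun J hJ => ⟨hJ.gak_ofTamed, fun f hf => ⟨hJ.nu_ofTamed ξ hf fun _ _ _ _ => rfl,
      fun τ hτ => hJ.nu_ofTamed_potential ξ hf hτ⟩⟩⟩
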